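/- Conventions. On $L^2(\mathbb R)$ put $\hat Q=x$, $\hat P=-i\,d/dx$, $\hat a=(\hat Q+i\hat P)/\sqrt2$, $\hat R(\varphi)=e^{i\varphi \hat a^\dagger \hat a}$, $\hat X(x)=e^{-ix\hat P}$, $\hat S(\rho)=e^{\frac{\rho}{2}(\hat a^{\dagger2}-\hat a^2)}$. Let $H_n$ be the physicists' Hermite polynomials, $\psi_n(x)=\pi^{-1/4}(2^n n!)^{-1/2}e^{-x^2/2}H_n(x)$ the wavefunction of the $n$-photon state $|n\rangle$, and $\langle m|_P=(2\pi)^{-1/2}\int dv\,e^{-imv}\langle v|_Q$. Circuit. Fix $\theta,r',m\in\mathbb R$ and $n\in\mathbb N$; put $t=\cos\theta$, $r=\sin\theta$, $s=e^{r'}$, $\sigma=\frac{2t}{1+t^2}$. Take three modes: mode 1 in the vacuum $|0\rangle$, mode 2 carrying the input $\psi\in L^2(\mathbb R)$, mode 3 in the squeezed vacuum $\hat S(r')|0\rangle$. Apply $e^{i\hat Q_2\hat Q_3}$, then the beamsplitter $e^{\theta(\hat a_1\hat a_2^\dagger-\hat a_1^\dagger \hat a_2)}$, and project mode 1 on $\langle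 n|$ and mode 2 on $\langle m|_P$ (the $v$-integral over $|v|\le L$ being taken in the limit $L\to\infty$ in $L^2$ of mode 3). Define $$f_n(x)=\int_{\mathbb R}\psi_n(ty-rx)\,\psi_0(y)\,e^{-im(tx+ry)}\,dy .$$ Theorem. There is a bounded operator $\hat K_n$ on $L^2(\mathbb R)$ such that for every $\psi\in L^2(\mathbb R)$ the circuit has the (unnormalised) output $(2\pi)^{-1/2}\hat K_n\psi$ in mode 3, and $$\hat K_n=\pi^{1/4}\sqrt{\tfrac2s}\;e^{-\hat Q^2/2s^2}\,\hat R(\tfrac\pi2)\,f_n(\hat Q).$$ Moreover, for all $x\in\mathbb R$, $$f_n(x)=e^{-im\sigma x}\,e^{-\frac{r^2x^2}{2(1+t^2)}}\,f_n'(x),$$ where $$f_n'(x)=\frac{i^n e^{-\frac{m^2r^2}{2(1+t^2)}}}{\sqrt{2^{n-1}n!\,(1+t^2)^{n+1}}}\sum_{k=0}^{n}\sum_{j=0}^{\lfloor (n-k)/2\rfloor}\binom nk\binom{n-k}{2j}\frac{(2j)!\,r^{2j}}{2^j j!}\,t^{\,n-k-2j}\Big(\tfrac{1+t^2}{2}\Big)^{k/2}(-i)^k\,H_k\!\Big(\tfrac{-\sqrt2\,r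 x}{1+t^2}\Big)H_{n-k-2j}\!\Big(\tfrac{-mr}{\sqrt{1+t^2}}\Big)$$ is a polynomial in $x$, of degree $n$ when $r\neq0$. Equivalently, $$\hat K_n=\pi^{1/4}\sqrt{\tfrac2s}\;\hat X(m\sigma)\,\hat R(\tfrac\pi2)\,e^{-\frac{1}{2s^2}(\hat P-m\sigma)^2}\,e^{-\frac{r^2}{2(1+t^2)}\hat Q^2}\,f_n'(\hat Q)$$ on the natural domain of the right-hand side, which is dense in $L^2(\mathbb R)$ (so $\hat K_n$ is its unique bounded extension). -/

import Mathlib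

open MeasureTheory Filter Topology
open scoped SchwartzMap LineDeriv FourierTransform

noncomputable section

namespace Phantm

/-! ### Wavefunction spaces and quadrature operators -/

/-- The Hilbert space `L²(V)` of wavefunctions in the position representation;
`V = ℝ` for one mode, `V = ℝ × ℝ × ℝ` for three modes. -/
abbrev Wave (V : Type*) [MeasureSpace V] : Type _ := Lp ℂ 2 (volume : Measure V)

/-- Configuration space of three modes. -/
abbrev R3 : Type := ℝ × ℝ × ℝ

/-- A mode: the coordinate functional of its position variable and the corresponding
coordinate direction. -/
structure Mode (V : Type*) [NormedAddCommGroup V] [NormedSpace ℝ V] where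
  coord : V →L[ℝ] ℝ
  dir : V

/-- The only mode of a one-mode system. -/
def oneMode : Mode ℝ := ⟨ContinuousLinearMap.id ℝ ℝ, 1⟩

/-- The first (top) mode of the three-mode system. -/
def mode1 : Mode R3 := ⟨ContinuousLinearMap.fst ℝ ℝ (ℝ × ℝ), (1, 0, 0)⟩

/-- The second (middle) mode of the three-mode system. -/
def mode2 : Mode R3 :=
  ⟨(ContinuousLinearMap.fst ℝ ℝ ℝ).comp (ContinuousLinearMap.snd ℝ ℝ (ℝ × ℝ)), (0, 1, 0)⟩

section Quadratures

variable {V : Type*} [NormedAddCommGroup V] [NormedSpace ℝ V]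

/-- The position quadrature `Q` of a mode on Schwartz wavefunctions. -/
def opQ (μ : Mode V) : 𝓢(V, ℂ) →L[ℂ] 𝓢(V, ℂ) :=
  SchwartzMap.smulLeftCLM ℂ (fun x : V => ((μ.coord x : ℝ) : ℂ))

theorem opQ_apply (μ : Mode V) (f : 𝓢(V, ℂ)) (x : V) :
    opQ μ f x = ((μ.coord x : ℝ) : ℂ) * f x := by
  have h : (fun x : V => ((μ.coord x : ℝ) : ℂ)).HasTemperateGrowth :=
    (Complex.ofRealCLM.comp μ.coord).hasTemperateGrowth
  simp [opQ, SchwartzMap.smulLeftCLM_apply_apply h]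

/-- The momentum quadrature `P = -i ∂` of a mode on Schwartz wavefunctions. -/
def opP (μ : Mode V) : 𝓢(V, ℂ) →L[ℂ] 𝓢(V, ℂ) :=
  (-Complex.I) • LineDeriv.lineDerivOpCLM ℂ 𝓢(V, ℂ) μ.dir

/-- The annihilation operator `a = (Q + iP)/√2`. -/
def opA (μ : Mode V) : 𝓢(V, ℂ) →L[ℂ] 𝓢(V, ℂ) :=
  ((Real.sqrt 2 : ℂ)⁻¹) • (opQ μ + Complex.I • opP μ)

/-- The creation operator `a† = (Q - iP)/√2`. -/
def opAd (μ : Mode V) : 𝓢(V, ℂ) →L[ℂ] 𝓢(V, ℂ) :=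
  ((Real.sqrt 2 : ℂ)⁻¹) • (opQ μ - Complex.I • opP μ)

end Quadratures

/-! ### Exponentials of skew-symmetric generators -/

section Exponentials

variable {V : Type*} [NormedAddCommGroup V] [NormedSpace ℝ V] [MeasureSpace V] [BorelSpace V]
  [SecondCountableTopology V] [(volume : Measure V).HasTemperateGrowth]

/-- `U` is a one-parameter group of unitaries of `L²(V)` whose derivative at `0` on Schwartz
wavefunctions is `G`; strong continuity follows from these two conditions. -/
structure IsUnitaryGroup (G : 𝓢(V, ℂ) →L[ℂ] 𝓢(V, ℂ)) (U : ℝ → (Wave V ≃ₗᵢ[ℂ] Wave V)) :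
    Prop where
  add : ∀ (a b : ℝ) (ψ : Wave V), U (a + b) ψ = U a (U b ψ)
  deriv : ∀ f : 𝓢(V, ℂ),
    HasDerivAt (fun a : ℝ => U a (f.toLp 2 (volume : Measure V)))
      ((G f).toLp 2 (volume : Measure V)) 0

open scoped Classical in
/-- The unitary `e^G`: the value at time `1` of the unitary group generated by `G`. The group
exists and is unique when `G` is essentially skew-adjoint on Schwartz space, as it is for the
quadratic expressions in `Q` and `P` to which this is applied; otherwise the value is `0`
or not specified. -/
def unitaryExp (G : 𝓢(V, ℂ) →L[ℂ] 𝓢(V, ℂ)) : Wave V →L[ℂ] Wave V :=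
  if h : ∃ U : ℝ → (Wave V ≃ₗᵢ[ℂ] Wave V), IsUnitaryGroup G U then
    ((h.choose 1).toContinuousLinearEquiv : Wave V →L[ℂ] Wave V)
  else 0

end Exponentials

/-- The rotation `R(φ) = e^{iφ a†a}`. -/
def rotation (φ : ℝ) : Wave ℝ →L[ℂ] Wave ℝ :=
  unitaryExp ((Complex.I * (φ : ℂ)) • (opAd oneMode * opA oneMode))

/-- The squeezing operator `S(ρ) = e^{(ρ/2)(a†² - a²)}`. -/
def squeezer (ρ : ℝ) : Wave ℝ →L[ℂ] Wave ℝ :=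
  unitaryExp (((ρ : ℂ) / 2) • (opAd oneMode ^ 2 - opA oneMode ^ 2))

instance instHaarR3 : (volume : Measure R3).IsAddHaarMeasure :=
  haveI _h : (volume : Measure (ℝ × ℝ)).IsAddHaarMeasure :=
    Measure.prod.instIsAddHaarMeasure (volume : Measure ℝ) (volume : Measure ℝ)
  Measure.prod.instIsAddHaarMeasure (volume : Measure ℝ) (volume : Measure (ℝ × ℝ))

/-- The beamsplitter `B = e^{θ(a₁ a₂† - a₁† a₂)}` on the first two of three modes. -/
def beamsplitter (θ : ℝ) : Wave R3 →L[ℂ] Wave R3 :=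
  unitaryExp ((θ : ℂ) • (opA mode1 * opAd mode2 - opAd mode1 * opA mode2))

/-! ### Unbounded operators and functions of a quadrature -/

/-- An everywhere defined operator as a partially defined one. -/
def total (K : Wave ℝ →L[ℂ] Wave ℝ) : Wave ℝ →ₗ.[ℂ] Wave ℝ :=
  LinearMap.toPMap (K : Wave ℝ →ₗ[ℂ] Wave ℝ) ⊤

/-- The product `T S` of partially defined operators on its natural domain
`{ψ ∈ dom S | S ψ ∈ dom T}`. -/
def prodOp (T S : Wave ℝ →ₗ.[ℂ] Wave ℝ) : Wave ℝ →ₗ.[ℂ] Wave ℝ where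
  domain := (T.domain.comap S.toFun).map S.domain.subtype
  toFun :=
    { toFun := fun ψ => T ⟨S ⟨ψ.1, by
          obtain ⟨x, -, hx⟩ := ψ.2
          rw [← hx]; exact x.2⟩, by
          obtain ⟨x, hx, hx'⟩ := ψ.2
          have e : (⟨ψ.1, by rw [← hx']; exact x.2⟩ : S.domain) = x := Subtype.ext hx'.symm
          rw [e]; exact hx⟩
      map_add' := by
        intro a b
        rw [← LinearPMap.map_add]
        congr 1
        apply Subtype.ext
        change S _ = S _ + S _
        rw [← LinearPMap.map_add]
        rfl
      map_smul' := by
        intro c a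
        rw [RingHom.id_apply, ← LinearPMap.map_smul]
        congr 1
        apply Subtype.ext
        change S _ = c • S _
        rw [← LinearPMap.map_smul]
        rfl }

infixr:80 " ⊚ " => prodOp

/-- The function `g(Q)` of the position operator: multiplication by `g`, on its maximal
domain `{ψ ∈ L² | g ψ ∈ L²}`. -/
def funQ (g : ℝ → ℂ) : Wave ℝ →ₗ.[ℂ] Wave ℝ where
  domain :=
    { carrier := {ψ | MemLp (fun x => g x * ψ x) 2 (volume : Measure ℝ)}
      add_mem' := by
        intro a b ha hb
        refine (MemLp.add ha hb).ae_eq ?_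
        filter_upwards [Lp.coeFn_add a b] with x hx
        simp only [Pi.add_apply] at hx ⊢
        rw [hx]; ring
      zero_mem' := by
        refine (MemLp.zero (ε := ℂ) (p := 2) (μ := (volume : Measure ℝ))).ae_eq ?_
        filter_upwards [Lp.coeFn_zero ℂ 2 (volume : Measure ℝ)] with x hx
        rw [hx]; simp
      smul_mem' := by
        intro c a ha
        refine (MemLp.const_smul ha c).ae_eq ?_
        filter_upwards [Lp.coeFn_smul c a] with x hx
        simp only [Pi.smul_apply, smul_eq_mul] at hx ⊢
        rw [hx]; ring }
  toFun :=
    { toFun := fun ψ => MemLp.toLp (fun x => g x * (ψ : Wave ℝ) x) ψ.2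
      map_add' := by
        intro a b
        rw [← MemLp.toLp_add]
        apply (MemLp.toLp_eq_toLp_iff _ _).2
        filter_upwards [Lp.coeFn_add (a : Wave ℝ) (b : Wave ℝ)] with x hx
        simp only [Pi.add_apply, Submodule.coe_add] at hx ⊢
        rw [hx]; ring
      map_smul' := by
        intro c a
        rw [RingHom.id_apply, ← MemLp.toLp_const_smul]
        apply (MemLp.toLp_eq_toLp_iff _ _).2
        filter_upwards [Lp.coeFn_smul c (a : Wave ℝ)] with x hx
        simp only [Pi.smul_apply, smul_eq_mul, Submodule.coe_smul] at hx ⊢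
        rw [hx]; ring }

/-- The function `g(P)` of the momentum operator `P = -i d/dx`, which the Fourier transform
`f ↦ ∫ e^{-2πikx} f(x) dx` turns into multiplication by `2πk`. -/
def funP (g : ℝ → ℂ) : Wave ℝ →ₗ.[ℂ] Wave ℝ :=
  total ((Lp.fourierTransformₗᵢ ℝ ℂ).symm.toContinuousLinearEquiv : Wave ℝ →L[ℂ] Wave ℝ) ⊚
    funQ (fun k => g (2 * Real.pi * k)) ⊚
      total ((Lp.fourierTransformₗᵢ ℝ ℂ).toContinuousLinearEquiv : Wave ℝ →L[ℂ] Wave ℝ)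

/-- The position shift `X(x) = e^{-iPx}`. -/
def shiftX (x : ℝ) : Wave ℝ →ₗ.[ℂ] Wave ℝ :=
  funP (fun p => Complex.exp (-Complex.I * p * x))

/-! ### Fock states -/

/-- The physicists' Hermite polynomials: `H₀ = 1`, `Hₙ₊₁ = 2x Hₙ - Hₙ'`. -/
def hermiteH : ℕ → Polynomial ℂ
  | 0 => 1
  | n + 1 => 2 * Polynomial.X * hermiteH n - Polynomial.derivative (hermiteH n)

/-- The (real-valued) wavefunction `ψₙ(x) = e^{-x²/2} Hₙ(x) / (π^{1/4} √(2ⁿ n!))` of the `n`-photon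
state. -/
def fock (n : ℕ) (x : ℝ) : ℂ :=
  ((Real.pi ^ (1 / 4 : ℝ) * Real.sqrt (2 ^ n * n.factorial) : ℝ) : ℂ)⁻¹ *
    (Real.exp (-x ^ 2 / 2) : ℂ) * (hermiteH n).eval (x : ℂ)

theorem fock_zero_memLp : MemLp (fock 0) 2 (volume : Measure ℝ) := by
  have h : fock 0 = fun x : ℝ => ((Real.pi ^ (1 / 4 : ℝ) : ℝ) : ℂ)⁻¹ *
      ((Real.exp (-x ^ 2 / 2) : ℝ) : ℂ) := by
    funext x
    simp [fock, hermiteH]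
  rw [h]
  refine MemLp.const_mul ?_ _
  have hc : Continuous (fun x : ℝ => Real.exp (-x ^ 2 / 2)) := by fun_prop
  suffices hr : MemLp (fun x : ℝ => Real.exp (-x ^ 2 / 2)) 2 (volume : Measure ℝ) from
    hr.ofReal
  rw [memLp_two_iff_integrable_sq hc.aestronglyMeasurable]
  refine (integrable_exp_neg_mul_sq (b := 1) one_pos).congr (Eventually.of_forall fun x => ?_)
  change Real.exp (-1 * x ^ 2) = Real.exp (-x ^ 2 / 2) ^ 2
  rw [← Real.exp_nat_mul]
  congr 1
  push_cast
  ring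

/-- The vacuum state. -/
def vacuum : Wave ℝ := fock_zero_memLp.toLp (fock 0)

/-! ### The circuit -/

theorem memLp_tensor3 (f g h : Wave ℝ) :
    MemLp (fun p : R3 => f p.1 * (g p.2.1 * h p.2.2)) 2 (volume : Measure R3) := by
  have key : ∀ {A B : Type} [MeasureSpace A] [MeasureSpace B]
      [SigmaFinite (volume : Measure A)] [SigmaFinite (volume : Measure B)]
      (a : A → ℂ) (b : B → ℂ), MemLp a 2 (volume : Measure A) → MemLp b 2 (volume : Measure B) →
      MemLp (fun p : A × B => a p.1 * b p.2) 2 (volume : Measure (A × B)) := by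
    intro A B _ _ _ _ a b ha hb
    have hm : AEStronglyMeasurable (fun p : A × B => a p.1 * b p.2)
        ((volume : Measure A).prod (volume : Measure B)) :=
      (ha.1.comp_fst).mul (hb.1.comp_snd)
    rw [Measure.volume_eq_prod, memLp_two_iff_integrable_sq_norm hm]
    refine (((memLp_two_iff_integrable_sq_norm ha.1).1 ha).mul_prod
      ((memLp_two_iff_integrable_sq_norm hb.1).1 hb)).congr (Eventually.of_forall fun p => ?_)
    simp [mul_pow]
  exact key (f : ℝ → ℂ) (fun q : ℝ × ℝ => g q.1 * h q.2) (Lp.memLp f)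
    (key (g : ℝ → ℂ) (h : ℝ → ℂ) (Lp.memLp g) (Lp.memLp h))

/-- The product state `f ⊗ g ⊗ h` of three modes. -/
def tensor3 (f g h : Wave ℝ) : Wave R3 := (memLp_tensor3 f g h).toLp _

theorem memLp_phase (Φ : Wave R3) :
    MemLp (fun p : R3 => Complex.exp (Complex.I * p.2.1 * p.2.2) * Φ p) 2
      (volume : Measure R3) := by
  have hc : Continuous (fun p : R3 => Complex.exp (Complex.I * p.2.1 * p.2.2)) := by fun_prop
  refine MemLp.of_le (Lp.memLp Φ) (hc.aestronglyMeasurable.mul (Lp.memLp Φ).1)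
    (Eventually.of_forall fun p => ?_)
  have : ‖Complex.exp (Complex.I * p.2.1 * p.2.2)‖ = 1 := by
    have e : Complex.I * (p.2.1 : ℂ) * (p.2.2 : ℂ) = ((p.2.1 * p.2.2 : ℝ) : ℂ) * Complex.I := by
      push_cast; ring
    rw [e, Complex.norm_exp_ofReal_mul_I]
  simp [this]

/-- The controlled-Z gate `e^{i Q₂ Q₃}` on the second and third mode. -/
def controlZ (Φ : Wave R3) : Wave R3 := (memLp_phase Φ).toLp _

/-- The three-mode state before detection. The top mode is in the vacuum, the middle mode carries
the input `ψ`, the bottom mode is in the squeezed vacuum `S(r')|0⟩`; first the controlled-Z gate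
couples the lower two modes, then the beamsplitter couples the upper two. -/
def stateBeforeDetection (θ r' : ℝ) (ψ : Wave ℝ) : Wave R3 :=
  beamsplitter θ (controlZ (tensor3 vacuum ψ (squeezer r' vacuum)))

/-- The projection of a three-mode wavefunction `Φ(u, v, z)` with the bra `⟨n|` of the photon
number states in `u` and the bra `⟨m|_P = (2π)^{-1/2} ∫ dv e^{-imv} ⟨v|_Q` in `v`, the latter cut
off to `|v| ≤ L`. For `Φ ∈ L²` all these integrals converge absolutely for almost every `z`. -/
def cutoffProjection (n : ℕ) (m L : ℝ) (Φ : R3 → ℂ) (z : ℝ) : ℂ :=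
  ((Real.sqrt (2 * Real.pi) : ℝ) : ℂ)⁻¹ *
    ∫ v in Set.Icc (-L) L, Complex.exp (-Complex.I * m * v) *
      ∫ u, starRingEnd ℂ (fock n u) * Φ (u, v, z)

/-- `φ` is the (unnormalised) output of the circuit for the input `ψ` and the outcomes `n`
(photon number of the top mode) and `m` (momentum of the middle mode): it is the `L²` limit
of the cut-off projections. -/
def IsCircuitOutput (θ r' : ℝ) (n : ℕ) (m : ℝ) (ψ φ : Wave ℝ) : Prop :=
  Tendsto (fun L : ℝ =>
    eLpNorm (fun z => cutoffProjection n m L (stateBeforeDetection θ r' ψ) z - φ z) 2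
      (volume : Measure ℝ)) atTop (𝓝 0)

/-! ### The functions in the Kraus operator -/

/-- `fₙ(x) = ∫ ψₙ(ty - rx) ψ₀(y) e^{-im(tx + ry)} dy` with `t = cos θ`, `r = sin θ`. -/
def fn (θ : ℝ) (n : ℕ) (m x : ℝ) : ℂ :=
  ∫ y : ℝ, fock n (Real.cos θ * y - Real.sin θ * x) * fock 0 y *
    Complex.exp (-Complex.I * m * (Real.cos θ * x + Real.sin θ * y))

/-- `σ = 2t/(1+t²)`. -/
def sigma (θ : ℝ) : ℝ := 2 * Real.cos θ / (1 + Real.cos θ ^ 2)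

/-- The polynomial part `fₙ'` of `fₙ`. -/
def fnPoly (θ : ℝ) (n : ℕ) (m : ℝ) : Polynomial ℂ :=
  let t : ℝ := Real.cos θ
  let r : ℝ := Real.sin θ
  Polynomial.C (Complex.I ^ n * (Real.exp (-(m ^ 2 * r ^ 2) / (2 * (1 + t ^ 2))) : ℂ) /
      (Real.sqrt ((2 : ℝ) ^ ((n : ℤ) - 1) * n.factorial * (1 + t ^ 2) ^ (n + 1)) : ℂ)) *
    ∑ k ∈ Finset.range (n + 1), ∑ j ∈ Finset.range ((n - k) / 2 + 1),
      Polynomial.C ((n.choose k : ℂ) * ((n - k).choose (2 * j) : ℂ) *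
          (((2 * j).factorial : ℂ) * (r : ℂ) ^ (2 * j) / (2 ^ j * (j.factorial : ℂ))) *
          (t : ℂ) ^ (n - k - 2 * j) * (Real.sqrt ((1 + t ^ 2) / 2) : ℂ) ^ k * (-Complex.I) ^ k *
          (hermiteH (n - k - 2 * j)).eval ((-(m * r) / Real.sqrt (1 + t ^ 2) : ℝ) : ℂ)) *
        (hermiteH k).comp
          (Polynomial.C ((-(Real.sqrt 2 * r) / (1 + t ^ 2) : ℝ) : ℂ) * Polynomial.X)

/-- The scalar prefactor `π^{1/4} √(2/s)`. -/
def prefactor (s : ℝ) : ℂ := ((Real.pi ^ (1 / 4 : ℝ) * Real.sqrt (2 / s) : ℝ) : ℂ)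

/-- The operator `π^{1/4} √(2/s) e^{-Q²/2s²} R(π/2) fₙ(Q)`, with `s = e^{r'}`. -/
def krausForm (θ r' : ℝ) (n : ℕ) (m : ℝ) : Wave ℝ →ₗ.[ℂ] Wave ℝ :=
  let s : ℝ := Real.exp r'
  prefactor s •
    (funQ (fun x => (Real.exp (-x ^ 2 / (2 * s ^ 2)) : ℂ)) ⊚
      total (rotation (Real.pi / 2)) ⊚ funQ (fn θ n m))

/-- The operator
`π^{1/4} √(2/s) X(mσ) R(π/2) e^{-(P - mσ)²/2s²} e^{-Q² r²/(2(1+t²))} fₙ'(Q)`, with `s = e^{r'}`. -/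
def krausDisplacedForm (θ r' : ℝ) (n : ℕ) (m : ℝ) : Wave ℝ →ₗ.[ℂ] Wave ℝ :=
  let s : ℝ := Real.exp r'
  prefactor s •
    (shiftX (m * sigma θ) ⊚ total (rotation (Real.pi / 2)) ⊚
      funP (fun p => (Real.exp (-(p - m * sigma θ) ^ 2 / (2 * s ^ 2)) : ℂ)) ⊚
      funQ (fun x =>
        (Real.exp (-(x ^ 2 * Real.sin θ ^ 2) / (2 * (1 + Real.cos θ ^ 2))) : ℂ)) ⊚
      funQ (fun x => (fnPoly θ n m).eval (x : ℂ)))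

end Phantm

end

/-!
The proof has three independent ingredients: the gates are made explicit, the detection integral is
evaluated by rotating coordinates, and the function `fₙ` is a Gaussian integral.

**The gates.** `unitaryExp G` is only characterised by its generator, so each gate is computed by
exhibiting a unitary group with that generator which maps a total set of Schwartz functions into
Schwartz space. Such a group agrees with every other one, because `a ↦ U(-a) W(a) f` has derivative
zero (`IsUnitaryGroup.eq_on_invariant`, `unitaryExp_eq`). The generators of the squeezer and of the
beamsplitter are first-order differential operators; their groups are changes of variables along
linear flows (`IsLinearFlow.isUnitaryGroup`), namely a dilation (`coeFn_squeezer`) and a rotation of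
the plane (`coeFn_beamsplitter`). The generator `i a†a` of `R(φ)` is diagonal in the Hermite
functions. These are orthonormal as eigenvectors of a symmetric operator, and complete since a
function orthogonal to all of them has, after multiplication by the Gaussian, a vanishing Fourier
transform (`eq_zero_of_orthogonal`). The unitary Fourier transform with kernel
`(2π)^{-1/2} e^{ixz}` commutes with the creation operator up to the factor `i` and fixes the
Gaussian, so it multiplies `|n⟩` by `iⁿ` and equals `R(π/2)` (`rotation_pi_div_two`).

**The circuit.** Before detection the wavefunction at `(u, v, z)` is a product of the squeezed
vacuum in `z`, the phase `e^{ixz}`, the vacuum in `y` and `ψ` in `x`, where `(v, u)` is `(x, y)`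
rotated by the angle `-θ` (`coeFn_stateBeforeDetection`). In the variables `(x, y)` the detection
integral over `|v| ≤ L` becomes `∫ e^{ixz} f_{n,L}(x) ψ(x) dx` with a truncated version `f_{n,L}` of
`fₙ`; the integrand is integrable since, up to phases, it is a product of two functions in
`L²(ℝ²)` (`integral_detection`). So the cut-off projection is the squeezed vacuum times
`R(π/2) (f_{n,L} ψ)` (`cutoffProjection_ae`). As `f_{n,L} → fₙ` boundedly and pointwise, dominated
convergence gives the limit in `L²`.

**The closed form.** Integration by parts turns the recursion of the Hermite polynomials into a
recursion of the form `e_{n+1} = a eₙ + 2bn e_{n-1}` for the Gaussian integrals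
(`integral_gaussian_mul_hermiteH`). Its solution `expSeq a b` has the exponential generating function
`exp (a w + b w²)`, and the double sum in `fₙ'` is a binomial convolution of three such sequences,
whose parameters add (`sum_choose_expSeq`, `eval_fnPoly`, `fn_eq`).

The second form of the Kraus operator follows since the Fourier transform exchanges the modulation
`e^{-imσx}` in `fₙ` with a translation, which carries the Gaussian in `Q` into a displaced Gaussian
in `P` (`damping_rotation_modulate`). Its natural domain contains the Schwartz functions.
-/

noncomputable section

namespace Phantm

/-! ### Graphs of products of partially defined operators -/

theorem mem_graph_prodOp (T S : Wave ℝ →ₗ.[ℂ] Wave ℝ) (p : Wave ℝ × Wave ℝ) :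
    p ∈ (T ⊚ S).graph ↔ ∃ χ, (p.1, χ) ∈ S.graph ∧ (χ, p.2) ∈ T.graph := by
  constructor
  · intro h
    obtain ⟨y, hy1, hy2⟩ := (LinearPMap.mem_graph_iff _).1 h
    have hmem := y.2
    obtain ⟨x, hx, hx'⟩ := hmem
    have hx1 : (y : Wave ℝ) ∈ S.domain := by rw [← hx']; exact x.2
    have hxe : (⟨(y : Wave ℝ), hx1⟩ : S.domain) = x := Subtype.ext hx'.symm
    have hT : S ⟨(y : Wave ℝ), hx1⟩ ∈ T.domain := by rw [hxe]; exact hx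
    refine ⟨S ⟨y, hx1⟩, (LinearPMap.mem_graph_iff _).2 ⟨⟨y, hx1⟩, hy1, rfl⟩,
      (LinearPMap.mem_graph_iff _).2 ⟨⟨_, hT⟩, rfl, ?_⟩⟩
    rw [← hy2]
    rfl
  · rintro ⟨χ, h1, h2⟩
    obtain ⟨x, hx1, hx2⟩ := (LinearPMap.mem_graph_iff _).1 h1
    obtain ⟨y, hy1, hy2⟩ := (LinearPMap.mem_graph_iff _).1 h2
    have hT : S x ∈ T.domain := by
      have : S x = (y : Wave ℝ) := hx2.trans hy1.symm
      rw [this]; exact y.2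
    refine (LinearPMap.mem_graph_iff _).2 ⟨⟨(x : Wave ℝ), x, hT, rfl⟩, hx1, ?_⟩
    rw [← hy2]
    change T ⟨S x, hT⟩ = T y
    congr 1
    exact Subtype.ext (hx2.trans hy1.symm)

theorem mem_graph_total (K : Wave ℝ →L[ℂ] Wave ℝ) (p : Wave ℝ × Wave ℝ) :
    p ∈ (total K).graph ↔ K p.1 = p.2 := by
  constructor
  · intro h
    obtain ⟨y, hy1, hy2⟩ := (LinearPMap.mem_graph_iff _).1 h
    rw [← hy1, ← hy2]
    rfl
  · intro h
    exact (LinearPMap.mem_graph_iff _).2 ⟨⟨p.1, Submodule.mem_top⟩, rfl, h⟩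

theorem mem_graph_funQ (g : ℝ → ℂ) (p : Wave ℝ × Wave ℝ) :
    p ∈ (funQ g).graph ↔ (fun x => g x * p.1 x) =ᵐ[volume] p.2 := by
  constructor
  · intro h
    obtain ⟨y, hy1, hy2⟩ := (LinearPMap.mem_graph_iff _).1 h
    rw [← hy1, ← hy2]
    exact (MemLp.coeFn_toLp y.2).symm
  · intro h
    have hm : MemLp (fun x => g x * p.1 x) 2 (volume : Measure ℝ) :=
      (Lp.memLp p.2).ae_eq h.symm
    refine (LinearPMap.mem_graph_iff _).2 ⟨⟨p.1, hm⟩, rfl, ?_⟩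
    apply Lp.ext
    exact (MemLp.coeFn_toLp hm).trans h

theorem mem_graph_smul (c : ℂ) (T : Wave ℝ →ₗ.[ℂ] Wave ℝ) (p : Wave ℝ × Wave ℝ) :
    p ∈ (c • T).graph ↔ ∃ χ, (p.1, χ) ∈ T.graph ∧ c • χ = p.2 := by
  rw [LinearPMap.smul_graph]
  constructor
  · rintro ⟨q, hq, rfl⟩
    exact ⟨q.2, hq, rfl⟩
  · rintro ⟨χ, h, h'⟩
    exact ⟨(p.1, χ), h, Prod.ext rfl h'⟩

/-! ### Multiplication by a bounded function -/

theorem memLp_bounded_mul {g : ℝ → ℂ} (hg : AEStronglyMeasurable g volume) {C : ℝ}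
    (hC : ∀ x, ‖g x‖ ≤ C) (f : Wave ℝ) :
    MemLp (fun x => g x * f x) 2 (volume : Measure ℝ) := by
  refine MemLp.of_le_mul (c := C) (Lp.memLp f) (hg.mul (Lp.memLp f).1)
    (Eventually.of_forall fun x => ?_)
  rw [norm_mul]
  exact mul_le_mul_of_nonneg_right (hC x) (norm_nonneg _)

/-- Multiplication by a bounded measurable function, as a bounded operator on `L²(ℝ)`. -/
def mulOp (g : ℝ → ℂ) (hg : AEStronglyMeasurable g volume) (C : ℝ) (hC : ∀ x, ‖g x‖ ≤ C) :
    Wave ℝ →L[ℂ] Wave ℝ :=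
  LinearMap.mkContinuous
    { toFun := fun f => (memLp_bounded_mul hg hC f).toLp _
      map_add' := by
        intro a b
        rw [← MemLp.toLp_add]
        apply (MemLp.toLp_eq_toLp_iff _ _).2
        filter_upwards [Lp.coeFn_add a b] with x hx
        simp only [Pi.add_apply] at hx ⊢
        rw [hx]; ring
      map_smul' := by
        intro c a
        rw [RingHom.id_apply, ← MemLp.toLp_const_smul]
        apply (MemLp.toLp_eq_toLp_iff _ _).2
        filter_upwards [Lp.coeFn_smul c a] with x hx
        simp only [Pi.smul_apply, smul_eq_mul] at hx ⊢
        rw [hx]; ring }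
    C (by
      intro f
      refine Lp.norm_le_mul_norm_of_ae_le_mul ?_
      filter_upwards [MemLp.coeFn_toLp (memLp_bounded_mul hg hC f)] with x hx
      change ‖((memLp_bounded_mul hg hC f).toLp _ : Wave ℝ) x‖ ≤ _
      rw [hx, norm_mul]
      exact mul_le_mul_of_nonneg_right (hC x) (norm_nonneg _))

theorem coeFn_mulOp (g : ℝ → ℂ) (hg : AEStronglyMeasurable g volume) (C : ℝ)
    (hC : ∀ x, ‖g x‖ ≤ C) (f : Wave ℝ) :
    (mulOp g hg C hC f : ℝ → ℂ) =ᵐ[volume] fun x => g x * f x :=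
  MemLp.coeFn_toLp (memLp_bounded_mul hg hC f)

/-! ### Uniqueness of the unitary group with a given generator -/

section Uniqueness

variable {V : Type*} [NormedAddCommGroup V] [NormedSpace ℝ V] [MeasureSpace V] [BorelSpace V]
  [(volume : Measure V).HasTemperateGrowth]

theorem IsUnitaryGroup.zero_apply {G : 𝓢(V, ℂ) →L[ℂ] 𝓢(V, ℂ)}
    {U : ℝ → (Wave V ≃ₗᵢ[ℂ] Wave V)} (hU : IsUnitaryGroup G U) (ψ : Wave V) : U 0 ψ = ψ := by
  have h := hU.add 0 0 ψ
  rw [add_zero] at h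
  exact ((U 0).injective h).symm

/-- Two unitary groups with the same generator on Schwartz space agree on every Schwartz
wavefunction which one of them keeps in Schwartz space: `a ↦ U(-a) V(a) f` has derivative `0`. -/
theorem IsUnitaryGroup.eq_on_invariant {G : 𝓢(V, ℂ) →L[ℂ] 𝓢(V, ℂ)}
    {U W : ℝ → (Wave V ≃ₗᵢ[ℂ] Wave V)} (hU : IsUnitaryGroup G U) (hW : IsUnitaryGroup G W)
    (f : 𝓢(V, ℂ)) (hf : ∀ a, ∃ g : 𝓢(V, ℂ), W a (f.toLp 2 volume) = g.toLp 2 volume) (a : ℝ) :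
    U a (f.toLp 2 volume) = W a (f.toLp 2 volume) := by
  have hder : ∀ b : ℝ, HasDerivAt (fun c : ℝ => U (-c) (W c (f.toLp 2 volume))) 0 b := by
    intro b
    obtain ⟨g, hg⟩ := hf b
    -- By isometry the increment at `b` has the norm of `W h g - U h g`, which is `o(h)`.
    have h1 := (hW.deriv g).sub (hU.deriv g)
    rw [sub_self] at h1
    rw [hasDerivAt_iff_isLittleO_nhds_zero] at h1 ⊢
    rw [← Asymptotics.isLittleO_norm_left] at h1 ⊢
    refine h1.congr_left fun h => ?_
    simp only [smul_zero, sub_zero, zero_add, Pi.sub_apply]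
    rw [hW.zero_apply, hU.zero_apply, sub_self, sub_zero]
    have e1 : U (-(b + h)) (W (b + h) (f.toLp 2 volume)) =
        U (-b) (U (-h) (W h (g.toLp 2 volume))) := by
      rw [← hU.add, add_comm b h, hW.add, hg]
      congr 2
      ring
    have e2 : (g.toLp 2 volume : Wave V) = U (-h) (U h (g.toLp 2 volume)) := by
      rw [← hU.add, neg_add_cancel, hU.zero_apply]
    have e3 : U (-h) (W h (g.toLp 2 volume)) - g.toLp 2 volume =
        U (-h) (W h (g.toLp 2 volume) - U h (g.toLp 2 volume)) := by rw [map_sub, ← e2]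
    rw [e1, hg, ← map_sub, LinearIsometryEquiv.norm_map, e3, LinearIsometryEquiv.norm_map]
  have hconst := is_const_of_deriv_eq_zero (fun b => (hder b).differentiableAt)
    (fun b => (hder b).deriv) a 0
  simp only [neg_zero] at hconst
  rw [hU.zero_apply, hW.zero_apply] at hconst
  rw [← hconst, ← hU.add, add_neg_cancel, hU.zero_apply, hconst]

/-- A unitary group `W` generated by `G` which keeps a total family of Schwartz wavefunctions
inside Schwartz space computes `e^G`. -/
theorem unitaryExp_eq [SecondCountableTopology V] {G : 𝓢(V, ℂ) →L[ℂ] 𝓢(V, ℂ)}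
    {W : ℝ → (Wave V ≃ₗᵢ[ℂ] Wave V)}
    (hW : IsUnitaryGroup G W) (D : Set 𝓢(V, ℂ))
    (hD : Dense (Submodule.span ℂ ((fun f : 𝓢(V, ℂ) => f.toLp 2 volume) '' D) : Set (Wave V)))
    (hf : ∀ f ∈ D, ∀ a, ∃ g : 𝓢(V, ℂ), W a (f.toLp 2 volume) = g.toLp 2 volume) (ψ : Wave V) :
    unitaryExp G ψ = W 1 ψ := by
  have hex : ∃ U : ℝ → (Wave V ≃ₗᵢ[ℂ] Wave V), IsUnitaryGroup G U := ⟨W, hW⟩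
  have hU := hex.choose_spec
  have hEq : unitaryExp G =
      ((W 1).toContinuousLinearEquiv : Wave V →L[ℂ] Wave V) := by
    unfold unitaryExp
    rw [dif_pos hex]
    refine ContinuousLinearMap.ext_on hD ?_
    rintro _ ⟨f, hfD, rfl⟩
    exact hU.eq_on_invariant hW f (hf f hfD) 1
  rw [hEq]
  rfl

end Uniqueness

/-! ### Dominated convergence in `L²` -/

theorem tendsto_eLpNorm_two_of_dominated {α ι : Type*} [MeasurableSpace α] {μ : Measure α}
    {l : Filter ι} [l.IsCountablyGenerated] {F : ι → α → ℂ} {B : α → ℝ}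
    (hF : ∀ᶠ i in l, AEStronglyMeasurable (F i) μ) (hB : MemLp B 2 μ)
    (hdom : ∀ᶠ i in l, ∀ᵐ x ∂μ, ‖F i x‖ ≤ B x)
    (hlim : ∀ᵐ x ∂μ, Tendsto (fun i => F i x) l (𝓝 0)) :
    Tendsto (fun i => eLpNorm (F i) 2 μ) l (𝓝 0) := by
  have hp0 : (2 : ENNReal) ≠ 0 := two_ne_zero
  have hpt : (2 : ENNReal) ≠ ⊤ := ENNReal.ofNat_ne_top
  have key : Tendsto (fun i => ∫⁻ x, ‖F i x‖ₑ ^ (2 : ℝ) ∂μ) l (𝓝 (∫⁻ _, 0 ∂μ)) := by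
    refine tendsto_of_seq_tendsto fun u hu => ?_
    obtain ⟨N, hN⟩ := eventually_atTop.1 (hu.eventually (hF.and hdom))
    rw [← tendsto_add_atTop_iff_nat N]
    refine tendsto_lintegral_of_dominated_convergence' (fun x => ‖B x‖ₑ ^ (2 : ℝ)) ?_ ?_ ?_ ?_
    · intro i
      exact (hN (i + N) (Nat.le_add_left N i)).1.enorm.pow_const _
    · intro i
      filter_upwards [(hN (i + N) (Nat.le_add_left N i)).2] with x hx
      gcongr
      rw [enorm_le_iff_norm_le, Real.norm_eq_abs]
      exact hx.trans (le_abs_self _)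
    · have := lintegral_rpow_enorm_lt_top_of_eLpNorm_lt_top hp0 hpt hB.2
      simpa using this.ne
    · filter_upwards [hlim] with x hx'
      have hx := hx'.comp (hu.comp (tendsto_add_atTop_nat N))
      have h1 : Tendsto (fun i => ‖F (u (i + N)) x‖ₑ) atTop (𝓝 0) := by
        have := (continuous_enorm.tendsto (0 : ℂ)).comp hx
        simpa [Function.comp_def] using this
      have h2 := (ENNReal.continuous_rpow_const (y := (2 : ℝ))).tendsto (0 : ENNReal)
      have h3 := h2.comp h1
      simpa [Function.comp_def] using h3
  simp only [lintegral_zero] at key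
  have h2 := ((ENNReal.continuous_rpow_const (y := (1 / 2 : ℝ))).tendsto (0 : ENNReal)).comp key
  have h3 : (0 : ENNReal) ^ (1 / 2 : ℝ) = 0 := ENNReal.zero_rpow_of_pos (by norm_num)
  rw [h3] at h2
  refine h2.congr fun i => ?_
  rw [eLpNorm_eq_lintegral_rpow_enorm_toReal hp0 hpt]
  simp

/-! ### Unitaries induced by linear changes of variables -/

section LinearFlow

theorem det_equiv_ne_zero {V : Type*} [NormedAddCommGroup V] [NormedSpace ℝ V] (A : V ≃L[ℝ] V) :
    LinearMap.det (A : V →ₗ[ℝ] V) ≠ 0 :=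
  (LinearEquiv.isUnit_det' A.toLinearEquiv).ne_zero

variable {V : Type*} [NormedAddCommGroup V] [NormedSpace ℝ V] [FiniteDimensional ℝ V]
  [MeasureSpace V] [BorelSpace V] [(volume : Measure V).IsAddHaarMeasure]

theorem map_equiv_volume (A : V ≃L[ℝ] V) :
    Measure.map A (volume : Measure V) =
      ENNReal.ofReal |(LinearMap.det (A : V →ₗ[ℝ] V))⁻¹| • (volume : Measure V) :=
  Measure.map_linearMap_addHaar_eq_smul_addHaar volume (det_equiv_ne_zero A)

theorem quasiMeasurePreserving_equiv (A : V ≃L[ℝ] V) :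
    Measure.QuasiMeasurePreserving A (volume : Measure V) volume := by
  refine ⟨A.continuous.measurable, ?_⟩
  rw [map_equiv_volume]
  exact Measure.smul_absolutelyContinuous

theorem eLpNorm_comp_equiv (A : V ≃L[ℝ] V) (f : Wave V) :
    eLpNorm (fun x => (Real.sqrt |LinearMap.det (A : V →ₗ[ℝ] V)| : ℂ) * f (A x)) 2 volume =
      eLpNorm f 2 volume := by
  have hd := det_equiv_ne_zero A
  have hm : AEStronglyMeasurable f (Measure.map A (volume : Measure V)) :=
    (Lp.memLp f).1.mono_ac (quasiMeasurePreserving_equiv A).2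
  have h1 : eLpNorm (fun x => f (A x)) 2 volume =
      ENNReal.ofReal |(LinearMap.det (A : V →ₗ[ℝ] V))⁻¹| ^ (1 / 2 : ℝ) * eLpNorm f 2 volume := by
    have := eLpNorm_map_measure (p := 2) hm A.continuous.measurable.aemeasurable
    rw [map_equiv_volume, eLpNorm_smul_measure_of_ne_top ENNReal.ofNat_ne_top] at this
    simpa [Function.comp_def] using this.symm
  have h2 : (fun x => (Real.sqrt |LinearMap.det (A : V →ₗ[ℝ] V)| : ℂ) * f (A x)) =
      (Real.sqrt |LinearMap.det (A : V →ₗ[ℝ] V)| : ℂ) • (fun x => f (A x)) := rfl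
  rw [h2, eLpNorm_const_smul, h1, ← mul_assoc]
  have h3 : ‖(Real.sqrt |LinearMap.det (A : V →ₗ[ℝ] V)| : ℂ)‖ₑ =
      ENNReal.ofReal |LinearMap.det (A : V →ₗ[ℝ] V)| ^ (1 / 2 : ℝ) := by
    rw [← ofReal_norm, Complex.norm_real, Real.norm_of_nonneg (Real.sqrt_nonneg _),
      Real.sqrt_eq_rpow, ENNReal.ofReal_rpow_of_nonneg (abs_nonneg _) (by norm_num)]
  rw [h3, ← ENNReal.mul_rpow_of_nonneg _ _ (by norm_num), ← ENNReal.ofReal_mul (abs_nonneg _),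
    ← abs_mul, mul_inv_cancel₀ hd]
  simp

theorem memLp_comp_equiv (A : V ≃L[ℝ] V) (f : Wave V) :
    MemLp (fun x => (Real.sqrt |LinearMap.det (A : V →ₗ[ℝ] V)| : ℂ) * f (A x)) 2
      (volume : Measure V) := by
  refine ⟨?_, ?_⟩
  · exact ((Lp.memLp f).1.comp_quasiMeasurePreserving
      (quasiMeasurePreserving_equiv A)).const_mul _
  · rw [eLpNorm_comp_equiv]
    exact (Lp.memLp f).2

/-- The isometry `f ↦ √|det A| f ∘ A` of `L²(V)`. -/
def compIsometry (A : V ≃L[ℝ] V) : Wave V →ₗᵢ[ℂ] Wave V where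
  toFun f := (memLp_comp_equiv A f).toLp _
  map_add' a b := by
    rw [← MemLp.toLp_add]
    apply (MemLp.toLp_eq_toLp_iff _ _).2
    filter_upwards [(quasiMeasurePreserving_equiv A).ae (Lp.coeFn_add a b)] with x hx
    simp only [Pi.add_apply] at hx ⊢
    rw [hx]; ring
  map_smul' c a := by
    rw [RingHom.id_apply, ← MemLp.toLp_const_smul]
    apply (MemLp.toLp_eq_toLp_iff _ _).2
    filter_upwards [(quasiMeasurePreserving_equiv A).ae (Lp.coeFn_smul c a)] with x hx
    simp only [Pi.smul_apply, smul_eq_mul] at hx ⊢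
    rw [hx]; ring
  norm_map' f := by
    change ‖(memLp_comp_equiv A f).toLp _‖ = ‖f‖
    rw [Lp.norm_toLp, eLpNorm_comp_equiv]
    rfl

theorem coeFn_compIsometry (A : V ≃L[ℝ] V) (f : Wave V) :
    (compIsometry A f : V → ℂ) =ᵐ[volume]
      fun x => (Real.sqrt |LinearMap.det (A : V →ₗ[ℝ] V)| : ℂ) * f (A x) :=
  MemLp.coeFn_toLp (memLp_comp_equiv A f)

theorem compIsometry_symm (A : V ≃L[ℝ] V) (f : Wave V) :
    compIsometry A (compIsometry A.symm f) = f := by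
  apply Lp.ext
  filter_upwards [coeFn_compIsometry A (compIsometry A.symm f),
    (quasiMeasurePreserving_equiv A).ae (coeFn_compIsometry A.symm f)] with x h1 h2
  rw [h1, h2, ← mul_assoc, ← Complex.ofReal_mul, ← Real.sqrt_mul (abs_nonneg _), ← abs_mul]
  have : LinearMap.det (A : V →ₗ[ℝ] V) * LinearMap.det (A.symm : V →ₗ[ℝ] V) = 1 := by
    rw [← LinearMap.det_comp]
    have : (A : V →ₗ[ℝ] V) ∘ₗ (A.symm : V →ₗ[ℝ] V) = LinearMap.id := by
      ext x; simp
    rw [this, LinearMap.det_id]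
  rw [this]
  simp

/-- The unitary `f ↦ √|det A| f ∘ A` of `L²(V)`. -/
def compUnitary (A : V ≃L[ℝ] V) : Wave V ≃ₗᵢ[ℂ] Wave V :=
  LinearIsometryEquiv.ofSurjective (compIsometry A) fun f =>
    ⟨compIsometry A.symm f, compIsometry_symm A f⟩

theorem coeFn_compUnitary (A : V ≃L[ℝ] V) (f : Wave V) :
    (compUnitary A f : V → ℂ) =ᵐ[volume]
      fun x => (Real.sqrt |LinearMap.det (A : V →ₗ[ℝ] V)| : ℂ) * f (A x) :=
  coeFn_compIsometry A f

theorem compUnitary_toLp (A : V ≃L[ℝ] V) (f : 𝓢(V, ℂ)) :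
    compUnitary A (f.toLp 2 volume) =
      ((Real.sqrt |LinearMap.det (A : V →ₗ[ℝ] V)| : ℂ) •
        SchwartzMap.compCLMOfContinuousLinearEquiv ℂ A f).toLp 2 volume := by
  apply Lp.ext
  filter_upwards [coeFn_compUnitary A (f.toLp 2 volume),
    (quasiMeasurePreserving_equiv A).ae (f.coeFn_toLp 2 volume),
    SchwartzMap.coeFn_toLp ((Real.sqrt |LinearMap.det (A : V →ₗ[ℝ] V)| : ℂ) •
        SchwartzMap.compCLMOfContinuousLinearEquiv ℂ A f) 2 volume] with x h1 h2 h3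
  rw [h1, h2, h3]
  simp

/-- A one-parameter group of linear changes of variables: `A (a + b) = A b ∘ A a` with generator
`B`, bounded for `|a| ≤ 1`, and scaling volume by `e^{2κa}`. -/
structure IsLinearFlow (A : ℝ → V ≃L[ℝ] V) (B : V →L[ℝ] V) (κ : ℝ) : Prop where
  add : ∀ a b x, A (a + b) x = A b (A a x)
  deriv : ∀ x a, HasDerivAt (fun a => A a x) (B (A a x)) a
  bound : ∃ M : ℝ, ∀ a, |a| ≤ 1 → ∀ x, ‖A a x‖ ≤ M * ‖x‖
  det : ∀ a, |LinearMap.det (A a : V →ₗ[ℝ] V)| = Real.exp (2 * κ * a)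

variable {A : ℝ → V ≃L[ℝ] V} {B : V →L[ℝ] V} {κ : ℝ}

omit [FiniteDimensional ℝ V] [MeasureSpace V] [BorelSpace V]
  [(volume : Measure V).IsAddHaarMeasure] in
theorem IsLinearFlow.sqrt_det (h : IsLinearFlow A B κ) (a : ℝ) :
    Real.sqrt |LinearMap.det (A a : V →ₗ[ℝ] V)| = Real.exp (κ * a) := by
  rw [h.det, Real.sqrt_eq_rpow, ← Real.exp_mul]
  congr 1
  ring

omit [FiniteDimensional ℝ V] [MeasureSpace V] [BorelSpace V]
  [(volume : Measure V).IsAddHaarMeasure] in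
theorem IsLinearFlow.zero_apply (h : IsLinearFlow A B κ) (x : V) : A 0 x = x := by
  have := h.add 0 0 x
  rw [add_zero] at this
  exact ((A 0).injective this).symm

omit [FiniteDimensional ℝ V] [MeasureSpace V] [BorelSpace V]
  [(volume : Measure V).IsAddHaarMeasure] in
/-- Along the flow, `e^{κa} f(A_a x)` has the derivative `e^{κa} (G f)(A_a x)`. -/
theorem IsLinearFlow.hasDerivAt_pullback (h : IsLinearFlow A B κ)
    {G : 𝓢(V, ℂ) →L[ℂ] 𝓢(V, ℂ)} (hG : ∀ (f : 𝓢(V, ℂ)) x, G f x = κ * f x + fderiv ℝ f x (B x))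
    (f : 𝓢(V, ℂ)) (x : V) (a : ℝ) :
    HasDerivAt (fun a : ℝ => (Real.exp (κ * a) : ℂ) * f (A a x))
      ((Real.exp (κ * a) : ℂ) * G f (A a x)) a := by
  have h1 : HasDerivAt (fun a : ℝ => f (A a x)) (fderiv ℝ f (A a x) (B (A a x))) a :=
    (f.hasFDerivAt (A a x)).comp_hasDerivAt a (h.deriv x a)
  have h2 : HasDerivAt (fun a : ℝ => (Real.exp (κ * a) : ℂ)) ((Real.exp (κ * a) * κ : ℝ) : ℂ) a := by
    have : HasDerivAt (fun a : ℝ => Real.exp (κ * a)) (Real.exp (κ * a) * κ) a := by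
      simpa using ((hasDerivAt_id a).const_mul κ).exp
    exact this.ofReal_comp
  refine (h2.mul h1).congr_deriv ?_
  rw [hG]
  push_cast
  ring

/-- A linear flow acts on Schwartz wavefunctions as a unitary group differentiable in `L²`; the
difference quotients are dominated by the mean value inequality and the decay of `G f`. -/
theorem IsLinearFlow.isUnitaryGroup (h : IsLinearFlow A B κ)
    {G : 𝓢(V, ℂ) →L[ℂ] 𝓢(V, ℂ)} (hG : ∀ (f : 𝓢(V, ℂ)) x, G f x = κ * f x + fderiv ℝ f x (B x)) :
    IsUnitaryGroup G (fun a => compUnitary (A a)) where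
  add a b ψ := by
    apply Lp.ext
    filter_upwards [coeFn_compUnitary (A (a + b)) ψ, coeFn_compUnitary (A a) (compUnitary (A b) ψ),
      (quasiMeasurePreserving_equiv (A a)).ae (coeFn_compUnitary (A b) ψ)] with x h1 h2 h3
    rw [h1, h2, h3, h.sqrt_det, h.sqrt_det, h.sqrt_det, h.add, mul_add, Real.exp_add]
    push_cast
    ring
  deriv f := by
    set g : ℝ → 𝓢(V, ℂ) := fun a =>
      (Real.exp (κ * a) : ℂ) • SchwartzMap.compCLMOfContinuousLinearEquiv ℂ (A a) f with hg
    have hgx : ∀ a x, g a x = (Real.exp (κ * a) : ℂ) * f (A a x) := fun a x => by simp [hg]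
    have hU : ∀ a : ℝ, compUnitary (A a) (f.toLp 2 volume) = (g a).toLp 2 volume := fun a => by
      rw [compUnitary_toLp, h.sqrt_det]
    simp only [hU]
    rw [hasDerivAt_iff_tendsto_slope_zero, tendsto_iff_norm_sub_tendsto_zero]
    have hq : ∀ t : ℝ, ‖t⁻¹ • ((g (0 + t)).toLp 2 volume - (g 0).toLp 2 volume) -
        (G f).toLp 2 volume‖ =
        (eLpNorm (fun x => (t : ℂ)⁻¹ * (g t x - f x) - G f x) 2 volume).toReal := by
      intro t
      rw [Lp.norm_def]
      congr 1
      apply eLpNorm_congr_ae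
      filter_upwards [Lp.coeFn_sub (t⁻¹ • ((g (0 + t)).toLp 2 volume - (g 0).toLp 2 volume))
        ((G f).toLp 2 volume), Lp.coeFn_smul t⁻¹ ((g (0 + t)).toLp 2 volume - (g 0).toLp 2 volume),
        Lp.coeFn_sub ((g (0 + t)).toLp 2 volume) ((g 0).toLp 2 volume),
        (g (0 + t)).coeFn_toLp 2 volume, (g 0).coeFn_toLp 2 volume, (G f).coeFn_toLp 2 volume]
        with x e1 e2 e3 e4 e5 e6
      rw [e1, Pi.sub_apply, e2, Pi.smul_apply, e3, Pi.sub_apply, e4, e5, e6, hgx 0, h.zero_apply]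
      simp
    simp only [hq]
    obtain ⟨M', hM'⟩ := h.bound
    -- The inverse of `A a` is `A (-a)`, so the flow distorts `1 + ‖x‖` by at most the factor `M`.
    set M := max M' 1 with hMdef
    have hM : ∀ a, |a| ≤ 1 → ∀ x, 1 + ‖x‖ ≤ M * (1 + ‖A a x‖) := by
      intro a ha x
      have e1 : x = A (-a) (A a x) := by rw [← h.add, add_neg_cancel, h.zero_apply]
      have e2 : ‖x‖ ≤ M' * ‖A a x‖ := by
        conv_lhs => rw [e1]
        exact hM' (-a) (by rwa [abs_neg]) _
      have e3 : M' * ‖A a x‖ ≤ M * ‖A a x‖ :=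
        mul_le_mul_of_nonneg_right (le_max_left _ _) (norm_nonneg _)
      have e4 : 1 ≤ M := le_max_right _ _
      nlinarith
    have hM1 : 1 ≤ M := le_max_right _ _
    obtain ⟨k, hk⟩ := Measure.HasTemperateGrowth.exists_eLpNorm_lt_top 2
      (inferInstance : (volume : Measure V).HasTemperateGrowth)
    obtain ⟨C, hC0, hC⟩ : ∃ C : ℝ, 0 ≤ C ∧ ∀ y, ‖G f y‖ ≤ C * (1 + ‖y‖) ^ (-k : ℝ) := by
      refine ⟨2 ^ k * (Finset.Iic (k, 0)).sup (fun m => SchwartzMap.seminorm ℂ m.1 m.2) (G f),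
        by positivity, fun y => ?_⟩
      · have := SchwartzMap.one_add_le_sup_seminorm_apply (𝕜 := ℂ) (m := (k, 0)) (k := k) (n := 0)
          le_rfl le_rfl (G f) y
        rw [norm_iteratedFDeriv_zero] at this
        have hp : 0 < (1 + ‖y‖) ^ k := by positivity
        rw [Real.rpow_neg (by positivity), Real.rpow_natCast, ← div_eq_mul_inv, le_div_iff₀ hp,
          mul_comm]
        exact this
    set D : V → ℝ := fun x => Real.exp |κ| * (C * (M ^ k * (1 + ‖x‖) ^ (-k : ℝ))) with hD
    have hDmem : MemLp D 2 volume := by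
      have : MemLp (fun x : V => (1 + ‖x‖) ^ (-k : ℝ)) 2 volume := by
        refine ⟨Continuous.aestronglyMeasurable ?_, hk⟩
        refine Continuous.rpow_const (by fun_prop) fun x => Or.inl ?_
        positivity
      exact ((this.const_mul _).const_mul _).const_mul _
    have hder : ∀ a, |a| ≤ 1 → ∀ x, ‖(Real.exp (κ * a) : ℂ) * G f (A a x)‖ ≤ D x := by
      intro a ha x
      rw [norm_mul, Complex.norm_real, Real.norm_of_nonneg (Real.exp_pos _).le]
      have e1 : κ * a ≤ |κ| := (le_abs_self _).trans (by
        rw [abs_mul]; exact mul_le_of_le_one_right (abs_nonneg _) ha)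
      refine mul_le_mul (Real.exp_le_exp.2 e1) ((hC _).trans ?_) (norm_nonneg _) (Real.exp_pos _).le
      refine mul_le_mul_of_nonneg_left ?_ hC0
      rw [Real.rpow_neg (by positivity), Real.rpow_neg (by positivity), Real.rpow_natCast,
        Real.rpow_natCast, ← div_eq_mul_inv, ← one_div, div_le_div_iff₀ (by positivity)
        (by positivity), one_mul, ← mul_pow]
      exact pow_le_pow_left₀ (by positivity) (hM a ha x) k
    have h0 : (0 : ENNReal) ≠ ⊤ := ENNReal.zero_ne_top
    have hlim : Tendsto (fun t : ℝ => eLpNorm (fun x => (t : ℂ)⁻¹ * (g t x - f x) - G f x) 2 volume)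
        (𝓝[≠] 0) (𝓝 0) := by
      refine tendsto_eLpNorm_two_of_dominated (B := fun x => D x + D x) ?_ (hDmem.add hDmem) ?_ ?_
      · refine Eventually.of_forall fun t => Continuous.aestronglyMeasurable ?_
        have := (g t).continuous
        have := f.continuous
        have := (G f).continuous
        fun_prop
      · have hev : ∀ᶠ t : ℝ in 𝓝[≠] 0, |t| ≤ 1 ∧ t ≠ 0 := by
          refine Filter.Eventually.and (Filter.Eventually.filter_mono nhdsWithin_le_nhds ?_)
            self_mem_nhdsWithin
          filter_upwards [Metric.closedBall_mem_nhds (0 : ℝ) one_pos] with t ht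
          simpa using ht
        filter_upwards [hev] with t ht
        refine Eventually.of_forall fun x => (norm_sub_le _ _).trans (add_le_add ?_ ?_)
        · -- Mean value inequality for the difference quotient.
          have hmv := (convex_Icc (-1 : ℝ) 1).norm_image_sub_le_of_norm_hasDerivWithin_le
            (f := fun a : ℝ => (Real.exp (κ * a) : ℂ) * f (A a x)) (C := D x)
            (fun a _ => (h.hasDerivAt_pullback hG f x a).hasDerivWithinAt)
            (fun a ha => hder a (abs_le.2 ha) x) (x := 0) (y := t)
            (Set.mem_Icc.2 (by norm_num)) (Set.mem_Icc.2 (abs_le.1 ht.1))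
          simp only [mul_zero, Real.exp_zero, Complex.ofReal_one, one_mul, h.zero_apply,
            sub_zero] at hmv
          rw [norm_mul, norm_inv, Complex.norm_real, hgx, inv_mul_le_iff₀ (norm_pos_iff.2 ht.2),
            mul_comm ‖t‖]
          exact hmv
        · have := hder 0 (by simp) x
          simpa [h.zero_apply] using this
      · refine Eventually.of_forall fun x => ?_
        have e := h.hasDerivAt_pullback hG f x 0
        rw [hasDerivAt_iff_tendsto_slope_zero] at e
        simp only [zero_add, mul_zero, Real.exp_zero, Complex.ofReal_one, one_mul,
          h.zero_apply] at e
        have e2 := e.sub_const (G f x)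
        rw [sub_self] at e2
        refine e2.congr fun t => ?_
        rw [hgx]
        simp
    have := (ENNReal.tendsto_toReal h0).comp hlim
    simpa [Function.comp_def] using this

theorem IsLinearFlow.unitaryExp_eq [SecondCountableTopology V] (h : IsLinearFlow A B κ)
    {G : 𝓢(V, ℂ) →L[ℂ] 𝓢(V, ℂ)} (hG : ∀ (f : 𝓢(V, ℂ)) x, G f x = κ * f x + fderiv ℝ f x (B x))
    (ψ : Wave V) : unitaryExp G ψ = compUnitary (A 1) ψ := by
  refine Phantm.unitaryExp_eq (h.isUnitaryGroup hG) Set.univ ?_ (fun f _ a => ?_) ψ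
  · refine Dense.mono Submodule.subset_span ?_
    rw [Set.image_univ]
    exact SchwartzMap.denseRange_toLpCLM ENNReal.ofNat_ne_top
  · exact ⟨_, compUnitary_toLp (A a) f⟩

end LinearFlow

/-! ### Canonical commutation relations on Schwartz space -/

section Commutators

variable {V : Type*} [NormedAddCommGroup V] [NormedSpace ℝ V]

/-- The derivative of Schwartz wavefunctions in the coordinate direction of a mode. -/
def opD (μ : Mode V) : 𝓢(V, ℂ) →L[ℂ] 𝓢(V, ℂ) := LineDeriv.lineDerivOpCLM ℂ 𝓢(V, ℂ) μ.dir

theorem opD_apply (μ : Mode V) (f : 𝓢(V, ℂ)) (x : V) : opD μ f x = fderiv ℝ f x μ.dir := rfl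

theorem opA_eq (μ : Mode V) : opA μ = ((Real.sqrt 2 : ℂ)⁻¹) • (opQ μ + opD μ) := by
  have : Complex.I • opP μ = opD μ := by
    rw [opP, smul_smul]
    simp [opD]
  rw [opA, this]

theorem opAd_eq (μ : Mode V) : opAd μ = ((Real.sqrt 2 : ℂ)⁻¹) • (opQ μ - opD μ) := by
  have : Complex.I • opP μ = opD μ := by
    rw [opP, smul_smul]
    simp [opD]
  rw [opAd, this]

/-- The product rule; the derivative of the coordinate is constant, and it is `0` or `1` for two modes
in standard position. -/
theorem opD_mul_opQ (μ ν : Mode V) :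
    opD μ * opQ ν = opQ ν * opD μ + ((ν.coord μ.dir : ℝ) : ℂ) • 1 := by
  ext f x
  change fderiv ℝ (opQ ν f) x μ.dir = opQ ν (opD μ f) x + ((ν.coord μ.dir : ℝ) : ℂ) * f x
  have e : (opQ ν f : V → ℂ) = fun x => ((ν.coord x : ℝ) : ℂ) * f x := funext (opQ_apply ν f)
  have h1 : HasFDerivAt (fun x : V => ((ν.coord x : ℝ) : ℂ)) (Complex.ofRealCLM.comp ν.coord) x :=
    (Complex.ofRealCLM.comp ν.coord).hasFDerivAt
  have h2 := (h1.mul (f.hasFDerivAt x)).fderiv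
  rw [e]
  refine (congrArg (fun L : V →L[ℝ] ℂ => L μ.dir) h2).trans ?_
  rw [opQ_apply, opD_apply]
  simp
  ring

theorem inv_sqrt_two_mul_self : ((Real.sqrt 2 : ℂ)⁻¹) * ((Real.sqrt 2 : ℂ)⁻¹) = 1 / 2 := by
  rw [← mul_inv, ← Complex.ofReal_mul, Real.mul_self_sqrt (by norm_num)]
  norm_num

/-- `a†² - a² = -(2Q∂ + 1)` in one mode. -/
theorem squeezing_generator :
    opAd oneMode ^ 2 - opA oneMode ^ 2 = -((2 : ℂ) • (opQ oneMode * opD oneMode) + 1) := by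
  have h := opD_mul_opQ oneMode oneMode
  have h1 : ((oneMode.coord oneMode.dir : ℝ) : ℂ) = 1 := by simp [oneMode]
  rw [h1, one_smul] at h
  rw [opAd_eq, opA_eq, smul_pow, smul_pow, ← smul_sub, sq ((Real.sqrt 2 : ℂ)⁻¹),
    inv_sqrt_two_mul_self]
  have e : (opQ oneMode - opD oneMode) ^ 2 - (opQ oneMode + opD oneMode) ^ 2 =
      -((4 : ℂ) • (opQ oneMode * opD oneMode) + (2 : ℂ) • 1) := by
    have : (opQ oneMode - opD oneMode) ^ 2 - (opQ oneMode + opD oneMode) ^ 2 =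
      -(2 • (opQ oneMode * opD oneMode) + 2 • (opD oneMode * opQ oneMode)) := by noncomm_ring
    rw [this, h]
    module
  rw [e]
  module

/-- `[a, a†] = 1` in one mode. -/
theorem opA_mul_opAd : opA oneMode * opAd oneMode = opAd oneMode * opA oneMode + 1 := by
  have h := opD_mul_opQ oneMode oneMode
  have h1 : ((oneMode.coord oneMode.dir : ℝ) : ℂ) = 1 := by simp [oneMode]
  rw [h1, one_smul] at h
  rw [opAd_eq, opA_eq, smul_mul_smul_comm, smul_mul_smul_comm, inv_sqrt_two_mul_self]
  have e : (opQ oneMode + opD oneMode) * (opQ oneMode - opD oneMode) =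
      (opQ oneMode - opD oneMode) * (opQ oneMode + opD oneMode) + (2 : ℂ) • 1 := by
    have : (opQ oneMode + opD oneMode) * (opQ oneMode - opD oneMode) =
      (opQ oneMode - opD oneMode) * (opQ oneMode + opD oneMode) +
      2 • (opD oneMode * opQ oneMode - opQ oneMode * opD oneMode) := by noncomm_ring
    rw [this, h]
    module
  rw [e]
  module

/-- `a₁a₂† - a₁†a₂ = Q₂∂₁ - Q₁∂₂`. -/
theorem beamsplitter_generator :
    opA mode1 * opAd mode2 - opAd mode1 * opA mode2 =
      opQ mode2 * opD mode1 - opQ mode1 * opD mode2 := by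
  have h := opD_mul_opQ mode1 mode2
  have h1 : ((mode2.coord mode1.dir : ℝ) : ℂ) = 0 := by simp [mode1, mode2]
  rw [h1, zero_smul, add_zero] at h
  rw [opAd_eq, opA_eq, opAd_eq, opA_eq, smul_mul_smul_comm, smul_mul_smul_comm,
    inv_sqrt_two_mul_self, ← smul_sub]
  have : (opQ mode1 + opD mode1) * (opQ mode2 - opD mode2) -
      (opQ mode1 - opD mode1) * (opQ mode2 + opD mode2) =
      2 • (opD mode1 * opQ mode2 - opQ mode1 * opD mode2) := by noncomm_ring
  rw [this, h]
  module

end Commutators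

/-! ### The squeezer is a dilation -/

/-- Multiplication of the real line by `c ≠ 0`. -/
def scaleEquiv (c : ℝ) (hc : c ≠ 0) : ℝ ≃L[ℝ] ℝ :=
  ContinuousLinearEquiv.unitsEquivAut ℝ (Units.mk0 c hc)

theorem scaleEquiv_apply (c : ℝ) (hc : c ≠ 0) (x : ℝ) : scaleEquiv c hc x = x * c := rfl

theorem det_scaleEquiv (c : ℝ) (hc : c ≠ 0) :
    LinearMap.det (scaleEquiv c hc : ℝ →ₗ[ℝ] ℝ) = c := by
  rw [LinearMap.det_ring]
  change (1 : ℝ) * c = c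
  rw [one_mul]

theorem isLinearFlow_scale (ρ : ℝ) :
    IsLinearFlow (fun a => scaleEquiv (Real.exp (-ρ * a)) (Real.exp_pos _).ne')
      ((-ρ) • ContinuousLinearMap.id ℝ ℝ) (-ρ / 2) where
  add a b x := by
    simp only [scaleEquiv_apply]
    rw [mul_add, Real.exp_add]
    ring
  deriv x a := by
    simp only [scaleEquiv_apply]
    have := (((hasDerivAt_id a).const_mul (-ρ)).exp).const_mul x
    refine this.congr_deriv ?_
    simp
    ring
  bound := by
    refine ⟨Real.exp |ρ|, fun a ha x => ?_⟩
    rw [scaleEquiv_apply, norm_mul, mul_comm]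
    refine mul_le_mul_of_nonneg_right ?_ (norm_nonneg _)
    rw [Real.norm_of_nonneg (Real.exp_pos _).le]
    refine Real.exp_le_exp.2 ((le_abs_self _).trans ?_)
    rw [abs_mul, abs_neg]
    exact mul_le_of_le_one_right (abs_nonneg _) ha
  det a := by
    rw [det_scaleEquiv, abs_of_pos (Real.exp_pos _)]
    congr 1
    ring

/-- The squeezer is the dilation `ψ ↦ e^{-ρ/2} ψ(e^{-ρ} x)`. -/
theorem coeFn_squeezer (ρ : ℝ) (ψ : Wave ℝ) :
    (squeezer ρ ψ : ℝ → ℂ) =ᵐ[volume]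
      fun x => (Real.exp (-ρ / 2) : ℂ) * ψ (x * Real.exp (-ρ)) := by
  have hG : ∀ (f : 𝓢(ℝ, ℂ)) x, (((ρ : ℂ) / 2) • (opAd oneMode ^ 2 - opA oneMode ^ 2)) f x =
      ((-ρ / 2 : ℝ) : ℂ) * f x + fderiv ℝ f x (((-ρ) • ContinuousLinearMap.id ℝ ℝ) x) := by
    intro f x
    rw [squeezing_generator]
    change (ρ : ℂ) / 2 * -(2 * opQ oneMode (opD oneMode f) x + f x) = _
    rw [opQ_apply, opD_apply]
    have e : fderiv ℝ f x (((-ρ) • ContinuousLinearMap.id ℝ ℝ) x) =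
        ((-ρ * x : ℝ) : ℂ) * fderiv ℝ f x 1 := by
      have : (((-ρ) • ContinuousLinearMap.id ℝ ℝ) x) = (-ρ * x) • (1 : ℝ) := by simp
      rw [this, map_smul, Complex.real_smul]
    rw [e]
    have e1 : oneMode.coord x = x := rfl
    have e2 : oneMode.dir = 1 := rfl
    rw [e1, e2]
    push_cast
    ring
  have h := isLinearFlow_scale ρ
  have : squeezer ρ ψ = _ := h.unitaryExp_eq hG ψ
  rw [this]
  filter_upwards [coeFn_compUnitary (scaleEquiv (Real.exp (-ρ * 1)) (Real.exp_pos _).ne') ψ]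
    with x hx
  rw [hx, h.sqrt_det 1, scaleEquiv_apply]
  simp

/-! ### The beamsplitter is a rotation -/

/-- The map `(u, v, z) ↦ (u cos φ + v sin φ, -u sin φ + v cos φ, z)`. -/
def rotLin (φ : ℝ) : R3 →ₗ[ℝ] R3 where
  toFun p := (p.1 * Real.cos φ + p.2.1 * Real.sin φ,
    -p.1 * Real.sin φ + p.2.1 * Real.cos φ, p.2.2)
  map_add' p q := by
    ext <;> simp <;> ring
  map_smul' c p := by
    ext <;> simp <;> ring

theorem rotLin_comp (φ χ : ℝ) : rotLin φ ∘ₗ rotLin χ = rotLin (φ + χ) := by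
  refine LinearMap.ext fun p => ?_
  simp only [rotLin, LinearMap.comp_apply, LinearMap.coe_mk, AddHom.coe_mk, Real.cos_add,
    Real.sin_add, Prod.mk.injEq, and_true]
  constructor <;> ring

theorem rotLin_zero : rotLin 0 = LinearMap.id := by
  refine LinearMap.ext fun p => ?_
  simp [rotLin]

/-- The rotation by the angle `φ` of the first two of three coordinates. -/
def rotEquiv (φ : ℝ) : R3 ≃L[ℝ] R3 :=
  (LinearEquiv.ofLinearMap (rotLin φ) (rotLin (-φ))
    (by rw [rotLin_comp, add_neg_cancel, rotLin_zero])
    (by rw [rotLin_comp, neg_add_cancel, rotLin_zero])).toContinuousLinearEquiv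

theorem rotEquiv_apply (φ : ℝ) (p : R3) : rotEquiv φ p =
    (p.1 * Real.cos φ + p.2.1 * Real.sin φ, -p.1 * Real.sin φ + p.2.1 * Real.cos φ, p.2.2) := rfl

theorem coe_rotEquiv (φ : ℝ) : (rotEquiv φ : R3 →ₗ[ℝ] R3) = rotLin φ := rfl

/-- A reflection conjugates the rotation by `φ` into its inverse, so its determinant is `±1`. -/
theorem abs_det_rotEquiv (φ : ℝ) : |LinearMap.det (rotEquiv φ : R3 →ₗ[ℝ] R3)| = 1 := by
  rw [coe_rotEquiv]
  have h1 : LinearMap.det (rotLin φ) * LinearMap.det (rotLin (-φ)) = 1 := by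
    rw [← LinearMap.det_comp, rotLin_comp, add_neg_cancel, rotLin_zero, LinearMap.det_id]
  let S : R3 ≃ₗ[ℝ] R3 := (LinearEquiv.neg ℝ).prodCongr (LinearEquiv.refl ℝ (ℝ × ℝ))
  have h2 : LinearMap.det (rotLin (-φ)) = LinearMap.det (rotLin φ) := by
    rw [← LinearMap.det_conj (rotLin φ) S]
    congr 1
    refine LinearMap.ext fun p => ?_
    change rotLin (-φ) p = S (rotLin φ (-p.1, p.2))
    simp [S, rotLin]
    ring
  rw [h2] at h1
  rcases mul_self_eq_one_iff.1 h1 with h | h <;> simp [h]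

theorem isLinearFlow_rot (θ : ℝ) :
    IsLinearFlow (fun a => rotEquiv (θ * a))
      (θ • ((mode2.coord.smulRight mode1.dir) - (mode1.coord.smulRight mode2.dir))) 0 where
  add a b x := by
    have := LinearMap.congr_fun (rotLin_comp (θ * b) (θ * a)) x
    rw [mul_add, add_comm]
    exact this.symm
  deriv x a := by
    have hc : HasDerivAt (fun a => Real.cos (θ * a)) (-Real.sin (θ * a) * θ) a := by
      simpa using ((hasDerivAt_id a).const_mul θ).cos
    have hs : HasDerivAt (fun a => Real.sin (θ * a)) (Real.cos (θ * a) * θ) a := by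
      simpa using ((hasDerivAt_id a).const_mul θ).sin
    have h := ((hc.const_mul x.1).add (hs.const_mul x.2.1)).prodMk
      (((hs.const_mul (-x.1)).add (hc.const_mul x.2.1)).prodMk (hasDerivAt_const a x.2.2))
    refine h.congr_deriv ?_
    simp [rotEquiv_apply, mode1, mode2]
    constructor <;> ring
  bound := by
    refine ⟨2, fun a _ x => ?_⟩
    have h1 : ‖x.1‖ ≤ ‖x‖ := norm_fst_le x
    have h2 : ‖x.2.1‖ ≤ ‖x‖ := (norm_fst_le x.2).trans (norm_snd_le x)
    have h3 : ‖x.2.2‖ ≤ ‖x‖ := (norm_snd_le x.2).trans (norm_snd_le x)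
    have hc : ‖Real.cos (θ * a)‖ ≤ 1 := Real.abs_cos_le_one _
    have hs : ‖Real.sin (θ * a)‖ ≤ 1 := Real.abs_sin_le_one _
    have hm : ∀ {p q : ℝ}, ‖p‖ ≤ ‖x‖ → ‖q‖ ≤ 1 → ‖p * q‖ ≤ ‖x‖ := fun hp hq => by
      rw [norm_mul]
      exact (mul_le_of_le_one_right (norm_nonneg _) hq).trans hp
    rw [rotEquiv_apply, Prod.norm_def, Prod.norm_def]
    refine max_le ?_ (max_le ?_ ?_)
    · exact (norm_add_le _ _).trans ((add_le_add (hm h1 hc) (hm h2 hs)).trans (two_mul _).ge)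
    · exact (norm_add_le _ _).trans
        ((add_le_add (hm (by rwa [norm_neg]) hs) (hm h2 hc)).trans (two_mul _).ge)
    · change ‖x.2.2‖ ≤ _
      linarith [norm_nonneg x]
  det a := by
    rw [abs_det_rotEquiv]
    simp

/-- The beamsplitter evaluates the wavefunction at rotated positions of the first two modes. -/
theorem coeFn_beamsplitter (θ : ℝ) (Φ : Wave R3) :
    (beamsplitter θ Φ : R3 → ℂ) =ᵐ[volume] fun p => Φ (rotEquiv θ p) := by
  have hG : ∀ (f : 𝓢(R3, ℂ)) x,
      ((θ : ℂ) • (opA mode1 * opAd mode2 - opAd mode1 * opA mode2)) f x =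
      ((0 : ℝ) : ℂ) * f x + fderiv ℝ f x
        ((θ • ((mode2.coord.smulRight mode1.dir) - (mode1.coord.smulRight mode2.dir))) x) := by
    intro f x
    rw [beamsplitter_generator]
    change (θ : ℂ) * (opQ mode2 (opD mode1 f) x - opQ mode1 (opD mode2 f) x) = _
    simp only [opQ_apply, opD_apply]
    change _ = _ + fderiv ℝ f x (θ • (mode2.coord x • mode1.dir - mode1.coord x • mode2.dir))
    simp only [map_smul, map_sub, Complex.real_smul]
    push_cast
    ring
  have h := isLinearFlow_rot θ
  have : beamsplitter θ Φ = _ := h.unitaryExp_eq hG Φ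
  rw [this]
  filter_upwards [coeFn_compUnitary (rotEquiv (θ * 1)) Φ] with x hx
  rw [hx, abs_det_rotEquiv, mul_one]
  simp

/-! ### The Fourier transform of integrable square-integrable functions -/

/-- On `L¹ ∩ L²` the Fourier transform of `L²` is given by the Fourier integral: both have the same
pairing with every Schwartz function. -/
theorem coeFn_fourier_of_integrable (g : Wave ℝ) (hg : Integrable g (volume : Measure ℝ)) :
    (Lp.fourierTransformₗᵢ ℝ ℂ g : ℝ → ℂ) =ᵐ[volume] 𝓕 (g : ℝ → ℂ) := by
  have hcont : Continuous (𝓕 (g : ℝ → ℂ)) :=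
    VectorFourier.fourierIntegral_continuous Real.continuous_fourierChar
      (by exact continuous_inner) hg
  refine ae_eq_of_integral_contDiff_smul_eq
    ((Lp.memLp (Lp.fourierTransformₗᵢ ℝ ℂ g)).locallyIntegrable (by norm_num))
    hcont.locallyIntegrable fun φ hφ hsupp => ?_
  have hφ' : ContDiff ℝ ((⊤ : ℕ∞) : WithTop ℕ∞) (fun x => (φ x : ℂ)) :=
    Complex.ofRealCLM.contDiff.comp hφ
  have hsupp' : HasCompactSupport (fun x => (φ x : ℂ)) := hsupp.comp_left Complex.ofReal_zero
  set h : 𝓢(ℝ, ℂ) := hsupp'.toSchwartzMap hφ' with hh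
  have hhx : ∀ x, h x = φ x := fun x => rfl
  have e1 : ∫ x, φ x • (Lp.fourierTransformₗᵢ ℝ ℂ g : ℝ → ℂ) x = ∫ x, 𝓕 h x • g x := by
    have := DFunLike.congr_fun (Lp.fourier_toTemperedDistribution_eq g) h
    rw [TemperedDistribution.fourier_apply, Lp.toTemperedDistribution_apply,
      Lp.toTemperedDistribution_apply] at this
    rw [this]
    rfl
  have e2 : ∫ x, 𝓕 h x • g x = ∫ x, h x • 𝓕 (g : ℝ → ℂ) x := by
    simpa using! VectorFourier.integral_fourierIntegral_smul_eq_flip (F := ℂ) (μ := volume)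
      (ν := volume) (f := h) (g := (g : ℝ → ℂ)) (L := innerₗ ℝ)
      Real.continuous_fourierChar continuous_inner h.integrable hg
  rw [e1, e2]
  refine integral_congr_ae (Eventually.of_forall fun x => ?_)
  simp only [hhx]
  rw [smul_eq_mul, Complex.real_smul]

/-! ### Hermite functions as Schwartz functions -/

theorem exists_bound_poly_mul_gaussian (p : Polynomial ℂ) :
    ∃ C : ℝ, ∀ x : ℝ, ‖p.eval (x : ℂ)‖ * Real.exp (-(x ^ 2 / 2)) ≤ C := by
  induction p using Polynomial.induction_on' with
  | add p q hp hq =>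
    obtain ⟨C, hC⟩ := hp
    obtain ⟨D, hD⟩ := hq
    refine ⟨C + D, fun x => ?_⟩
    rw [Polynomial.eval_add]
    refine le_trans ?_ (add_le_add (hC x) (hD x))
    rw [← add_mul]
    exact mul_le_mul_of_nonneg_right (norm_add_le _ _) (Real.exp_pos _).le
  | monomial k c =>
    refine ⟨‖c‖ * (1 + 2 ^ k * k.factorial), fun x => ?_⟩
    rw [Polynomial.eval_monomial, norm_mul, norm_pow, Complex.norm_real, mul_assoc]
    refine mul_le_mul_of_nonneg_left ?_ (norm_nonneg _)
    rw [Real.exp_neg, ← div_eq_mul_inv, div_le_iff₀ (Real.exp_pos _)]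
    have h1 : (x ^ 2 / 2) ^ k / k.factorial ≤ Real.exp (x ^ 2 / 2) :=
      Real.pow_div_factorial_le_exp _ (by positivity) k
    have h2 : 1 ≤ Real.exp (x ^ 2 / 2) := Real.one_le_exp (by positivity)
    have hk : (0 : ℝ) < k.factorial := by positivity
    rw [div_le_iff₀ hk, div_pow, div_le_iff₀ (by positivity)] at h1
    have h3 : ‖x‖ ^ k ≤ 1 + (x ^ 2) ^ k := by
      have : (x ^ 2) ^ k = (‖x‖ ^ k) ^ 2 := by
        rw [← pow_mul, ← pow_mul, mul_comm 2 k, mul_comm, pow_mul, ← sq_abs, ← pow_mul, mul_comm,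
          Real.norm_eq_abs]
      rw [this]
      nlinarith [sq_nonneg (‖x‖ ^ k - 1), sq_nonneg (‖x‖ ^ k)]
    nlinarith

/-- The real Gaussian `e^{-x²/2}` as a Schwartz function. -/
def realGaussian : 𝓢(ℝ, ℝ) where
  toFun x := Real.exp (-(x ^ 2 / 2))
  smooth' := by fun_prop
  decay' k n := by
    obtain ⟨C, hC⟩ := exists_bound_poly_mul_gaussian
      (Polynomial.X ^ k * ((Polynomial.hermite n).map (Int.castRingHom ℂ)))
    refine ⟨C, fun x => le_trans (le_of_eq ?_) (hC x)⟩
    rw [norm_iteratedFDeriv_eq_norm_iteratedDeriv, iteratedDeriv_eq_iterate,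
      Polynomial.deriv_gaussian_eq_hermite_mul_gaussian, norm_mul, norm_mul, norm_pow, norm_neg,
      norm_one, one_pow, one_mul, Real.norm_of_nonneg (Real.exp_pos _).le, Polynomial.eval_mul,
      norm_mul, Polynomial.eval_pow, Polynomial.eval_X, norm_pow, Complex.norm_real, ← mul_assoc]
    congr 2
    rw [Polynomial.eval_map, ← Complex.norm_real]
    congr 1
    have h1 := Polynomial.aeval_algebraMap_apply ℂ x (Polynomial.hermite n)
    rw [Complex.coe_algebraMap] at h1
    rw [← h1, Polynomial.aeval_def]
    rfl

/-- The `n`-photon wavefunctions as Schwartz functions, obtained from the vacuum by applying the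
creation operator. -/
def hermiteFun : ℕ → 𝓢(ℝ, ℂ)
  | 0 => (((Real.pi ^ (1 / 4 : ℝ) : ℝ) : ℂ)⁻¹) •
      SchwartzMap.postcompCLM (𝕜 := ℝ) Complex.ofRealCLM realGaussian
  | n + 1 => ((Real.sqrt (n + 1) : ℂ)⁻¹) • opAd oneMode (hermiteFun n)

theorem hermiteFun_zero_apply (x : ℝ) : hermiteFun 0 x =
    ((Real.pi ^ (1 / 4 : ℝ) : ℝ) : ℂ)⁻¹ * (Real.exp (-(x ^ 2 / 2)) : ℂ) := rfl

theorem opAd_oneMode_apply (f : 𝓢(ℝ, ℂ)) (x : ℝ) :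
    opAd oneMode f x = (Real.sqrt 2 : ℂ)⁻¹ * ((x : ℂ) * f x - deriv f x) := by
  rw [opAd_eq]
  change (Real.sqrt 2 : ℂ)⁻¹ * (opQ oneMode f x - opD oneMode f x) = _
  rw [opQ_apply, opD_apply]
  rfl

theorem opA_oneMode_apply (f : 𝓢(ℝ, ℂ)) (x : ℝ) :
    opA oneMode f x = (Real.sqrt 2 : ℂ)⁻¹ * ((x : ℂ) * f x + deriv f x) := by
  rw [opA_eq]
  change (Real.sqrt 2 : ℂ)⁻¹ * (opQ oneMode f x + opD oneMode f x) = _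
  rw [opQ_apply, opD_apply]
  rfl

theorem hasDerivAt_gaussian_mul_poly (c : ℂ) (p : Polynomial ℂ) (x : ℝ) :
    HasDerivAt (fun x : ℝ => c * (Real.exp (-x ^ 2 / 2) : ℂ) * p.eval (x : ℂ))
      (c * (Real.exp (-x ^ 2 / 2) : ℂ) * (-x * p.eval (x : ℂ) +
        (Polynomial.derivative p).eval (x : ℂ))) x := by
  have h1 : HasDerivAt (fun x : ℝ => Real.exp (-x ^ 2 / 2)) (Real.exp (-x ^ 2 / 2) * -x) x := by
    refine ((((hasDerivAt_id x).pow 2).neg.div_const 2).exp).congr_deriv ?_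
    simp
    ring
  have h2 : HasDerivAt (fun x : ℝ => p.eval (x : ℂ)) ((Polynomial.derivative p).eval (x : ℂ)) x :=
    (p.hasDerivAt (x : ℂ)).comp_ofReal
  refine ((h1.ofReal_comp.const_mul c).mul h2).congr_deriv ?_
  push_cast
  ring

/-- On `e^{-x²/2} Hₙ` the operator `x - d/dx` acts as the recursion `2xHₙ - Hₙ'`. -/
theorem coe_hermiteFun (n : ℕ) : (hermiteFun n : ℝ → ℂ) = fock n := by
  induction n with
  | zero =>
    funext x
    rw [hermiteFun_zero_apply]
    simp [fock, hermiteH, neg_div]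
  | succ n ih =>
    funext x
    change (Real.sqrt (n + 1) : ℂ)⁻¹ * opAd oneMode (hermiteFun n) x = _
    rw [opAd_oneMode_apply, ih]
    have hd : deriv (fock n) x = _ := (hasDerivAt_gaussian_mul_poly _ (hermiteH n) x).deriv
    rw [hd]
    have hn : Real.sqrt (2 ^ (n + 1) * (n + 1).factorial) =
        Real.sqrt (n + 1) * Real.sqrt 2 * Real.sqrt (2 ^ n * n.factorial) := by
      rw [← Real.sqrt_mul (by positivity), ← Real.sqrt_mul (by positivity), Nat.factorial_succ]
      congr 1
      push_cast
      ring
    simp only [fock, hn, hermiteH, Polynomial.eval_sub, Polynomial.eval_mul, Polynomial.eval_X,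
      Polynomial.eval_ofNat, Complex.ofReal_mul, mul_inv]
    ring

theorem opA_hermiteFun_zero : opA oneMode (hermiteFun 0) = 0 := by
  ext x
  rw [opA_oneMode_apply, coe_hermiteFun]
  have hd : deriv (fock 0) x = _ := (hasDerivAt_gaussian_mul_poly _ (hermiteH 0) x).deriv
  rw [hd]
  simp [fock, hermiteH]
  ring_nf

theorem sqrt_succ_ne_zero (n : ℕ) : (Real.sqrt (n + 1) : ℂ) ≠ 0 := by
  rw [Complex.ofReal_ne_zero]
  positivity

theorem sqrt_succ_mul_self (n : ℕ) :
    (Real.sqrt (n + 1) : ℂ) * (Real.sqrt (n + 1) : ℂ) = (n : ℂ) + 1 := by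
  rw [← Complex.ofReal_mul, Real.mul_self_sqrt (by positivity)]
  push_cast
  ring

theorem opAd_hermiteFun (n : ℕ) :
    opAd oneMode (hermiteFun n) = (Real.sqrt (n + 1) : ℂ) • hermiteFun (n + 1) := by
  change _ = (Real.sqrt (n + 1) : ℂ) • ((Real.sqrt (n + 1) : ℂ)⁻¹ • opAd oneMode (hermiteFun n))
  rw [smul_smul, mul_inv_cancel₀ (sqrt_succ_ne_zero n), one_smul]

theorem opA_opAd_apply (f : 𝓢(ℝ, ℂ)) :
    opA oneMode (opAd oneMode f) = opAd oneMode (opA oneMode f) + f :=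
  DFunLike.congr_fun opA_mul_opAd f

/-- The `n`-photon states are eigenvectors of the number operator `a†a`. -/
theorem number_hermiteFun (n : ℕ) :
    opAd oneMode (opA oneMode (hermiteFun n)) = (n : ℂ) • hermiteFun n := by
  induction n with
  | zero => rw [opA_hermiteFun_zero]; simp
  | succ n ih =>
    change opAd oneMode (opA oneMode ((Real.sqrt (n + 1) : ℂ)⁻¹ • opAd oneMode (hermiteFun n))) = _
    rw [map_smul, opA_opAd_apply, ih, map_smul, map_add, map_smul, opAd_hermiteFun]
    have e : ∀ c : ℂ, c ≠ 0 → c⁻¹ • ((n : ℂ) • c • hermiteFun (n + 1) + c • hermiteFun (n + 1)) =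
        ((n + 1 : ℕ) : ℂ) • hermiteFun (n + 1) := by
      intro c hc
      rw [smul_smul, ← add_smul, smul_smul]
      congr 1
      push_cast
      field_simp
    exact e _ (sqrt_succ_ne_zero n)

theorem opA_hermiteFun_succ (n : ℕ) :
    opA oneMode (hermiteFun (n + 1)) = (Real.sqrt (n + 1) : ℂ) • hermiteFun n := by
  change opA oneMode ((Real.sqrt (n + 1) : ℂ)⁻¹ • opAd oneMode (hermiteFun n)) = _
  have e : (n : ℂ) • hermiteFun n + hermiteFun n = ((n : ℂ) + 1) • hermiteFun n := by
    rw [add_smul, one_smul]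
  rw [map_smul, opA_opAd_apply, number_hermiteFun, e,
    ← sqrt_succ_mul_self, smul_smul, ← mul_assoc, inv_mul_cancel₀ (sqrt_succ_ne_zero n), one_mul]

/-! ### Orthonormality -/

/-- `a†` is the formal adjoint of `a`. -/
theorem inner_opA_left (f g : 𝓢(ℝ, ℂ)) :
    inner ℂ ((opA oneMode f).toLp 2 volume) (g.toLp 2 volume) =
      inner ℂ (f.toLp 2 volume) ((opAd oneMode g).toLp 2 volume) := by
  rw [SchwartzMap.inner_toL2_toL2_eq _ _ volume, SchwartzMap.inner_toL2_toL2_eq _ _ volume]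
  have hi1 : ∀ f g : 𝓢(ℝ, ℂ), Integrable (fun x => inner ℂ (f x) (g x)) (volume : Measure ℝ) :=
    fun f g => (L2.integrable_inner (𝕜 := ℂ) (f.toLp 2 volume) (g.toLp 2 volume)).congr (by
      filter_upwards [f.coeFn_toLp 2 volume, g.coeFn_toLp 2 volume] with x h1 h2
      rw [h1, h2])
  have hparts := SchwartzMap.integral_bilinear_lineDerivOp_right_eq_neg_left (μ := volume) f g
    ((ContinuousLinearMap.mul ℝ ℂ).comp Complex.conjCLE.toContinuousLinearMap) (1 : ℝ)
  have e1 : ∀ x, inner ℂ (opA oneMode f x) (g x) = (Real.sqrt 2 : ℂ)⁻¹ *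
      (inner ℂ (opQ oneMode f x) (g x) + inner ℂ (opD oneMode f x) (g x)) := by
    intro x
    rw [opA_eq]
    change inner ℂ ((Real.sqrt 2 : ℂ)⁻¹ • (opQ oneMode f x + opD oneMode f x)) (g x) = _
    rw [inner_smul_left, inner_add_left, map_inv₀, Complex.conj_ofReal]
  have e2 : ∀ x, inner ℂ (f x) (opAd oneMode g x) = (Real.sqrt 2 : ℂ)⁻¹ *
      (inner ℂ (opQ oneMode f x) (g x) - inner ℂ (f x) (opD oneMode g x)) := by
    intro x
    rw [opAd_eq]
    change inner ℂ (f x) ((Real.sqrt 2 : ℂ)⁻¹ • (opQ oneMode g x - opD oneMode g x)) = _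
    rw [inner_smul_right, inner_sub_right, opQ_apply, opQ_apply]
    simp
    ring
  simp only [e1, e2]
  rw [integral_const_mul, integral_const_mul, integral_add (hi1 _ _) (hi1 _ _),
    integral_sub (hi1 _ _) (hi1 _ _)]
  have e3 : ∫ x, inner ℂ (f x) (opD oneMode g x) = -∫ x, inner ℂ (opD oneMode f x) (g x) := by
    have i1 : ∀ f g : 𝓢(ℝ, ℂ), ∀ x, inner ℂ (f x) (g x) = starRingEnd ℂ (f x) * g x :=
      fun f g x => by rw [RCLike.inner_apply, mul_comm]
    simp only [i1]
    exact hparts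
  rw [e3]
  ring

theorem inner_hermiteFun_zero :
    inner ℂ ((hermiteFun 0).toLp 2 (volume : Measure ℝ)) ((hermiteFun 0).toLp 2 volume) = 1 := by
  rw [SchwartzMap.inner_toL2_toL2_eq _ _ volume]
  have h : ∀ x, inner ℂ (hermiteFun 0 x) (hermiteFun 0 x) =
      (((Real.pi ^ (1 / 2 : ℝ))⁻¹ * Real.exp (-1 * x ^ 2) : ℝ) : ℂ) := by
    intro x
    rw [RCLike.inner_apply, hermiteFun_zero_apply]
    simp only [map_mul, map_inv₀, Complex.conj_ofReal]
    rw [← Complex.ofReal_inv, ← Complex.ofReal_mul, ← Complex.ofReal_mul]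
    congr 1
    have h1 : Real.pi ^ (1 / 2 : ℝ) = Real.pi ^ (1 / 4 : ℝ) * Real.pi ^ (1 / 4 : ℝ) := by
      rw [← Real.rpow_add Real.pi_pos]; norm_num
    have h2 : Real.exp (-1 * x ^ 2) = Real.exp (-(x ^ 2 / 2)) * Real.exp (-(x ^ 2 / 2)) := by
      rw [← Real.exp_add]; congr 1; ring
    rw [h1, h2, mul_inv]
    ring
  simp only [h]
  rw [integral_complex_ofReal, integral_const_mul, integral_gaussian, div_one, ← Real.sqrt_eq_rpow,
    inv_mul_cancel₀ (by positivity)]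
  simp

theorem inner_number_left (f g : 𝓢(ℝ, ℂ)) :
    inner ℂ ((opAd oneMode (opA oneMode f)).toLp 2 volume) (g.toLp 2 volume) =
      inner ℂ (f.toLp 2 volume) ((opAd oneMode (opA oneMode g)).toLp 2 volume) := by
  rw [← inner_opA_left, ← inner_conj_symm, ← inner_opA_left, inner_conj_symm]

theorem toLp_smul (c : ℂ) (f : 𝓢(ℝ, ℂ)) :
    (c • f).toLp 2 (volume : Measure ℝ) = c • f.toLp 2 volume := rfl

theorem toLp_add (f g : 𝓢(ℝ, ℂ)) :
    (f + g).toLp 2 (volume : Measure ℝ) = f.toLp 2 volume + g.toLp 2 volume := rfl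

/-- The `n`-photon states are orthonormal: they are eigenvectors of the symmetric operator `a†a`
with distinct eigenvalues. -/
theorem orthonormal_hermiteFun :
    Orthonormal ℂ (fun n => (hermiteFun n).toLp 2 (volume : Measure ℝ)) := by
  have hself : ∀ n, inner ℂ ((hermiteFun n).toLp 2 (volume : Measure ℝ))
      ((hermiteFun n).toLp 2 volume) = 1 := by
    intro n
    induction n with
    | zero => exact inner_hermiteFun_zero
    | succ n ih =>
      have h := inner_opA_left (hermiteFun (n + 1)) (hermiteFun n)
      rw [opA_hermiteFun_succ, opAd_hermiteFun, toLp_smul, toLp_smul, inner_smul_left,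
        inner_smul_right, ih, Complex.conj_ofReal] at h
      exact (mul_left_cancel₀ (sqrt_succ_ne_zero n) h).symm
  rw [orthonormal_iff_ite]
  intro i j
  split_ifs with hij
  · rw [hij]; exact hself j
  · have h := inner_number_left (hermiteFun i) (hermiteFun j)
    rw [number_hermiteFun, number_hermiteFun, toLp_smul, toLp_smul, inner_smul_left,
      inner_smul_right] at h
    have h2 : ((i : ℂ) - j) * inner ℂ ((hermiteFun i).toLp 2 (volume : Measure ℝ))
        ((hermiteFun j).toLp 2 volume) = 0 := by
      rw [sub_mul, ← h]
      simp
    rcases mul_eq_zero.1 h2 with h3 | h3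
    · exact absurd (by exact_mod_cast sub_eq_zero.1 h3) hij
    · exact h3

/-! ### Completeness of the photon number states -/

/-- The state `|n⟩` as an element of `L²(ℝ)`. -/
def hermiteVec (n : ℕ) : Wave ℝ := (hermiteFun n).toLp 2 volume

theorem opQ_eq_smul : opQ oneMode = ((Real.sqrt 2 : ℂ)⁻¹) • (opA oneMode + opAd oneMode) := by
  rw [opA_eq, opAd_eq, ← smul_add, smul_smul, inv_sqrt_two_mul_self]
  module

/-- `x^k ψ₀` is a combination of photon number states, because `Q = (a + a†)/√2`. -/
theorem opQ_pow_mem_span (k : ℕ) :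
    ((opQ oneMode) ^ k) (hermiteFun 0) ∈ Submodule.span ℂ (Set.range hermiteFun) := by
  have hA : ∀ f ∈ Submodule.span ℂ (Set.range hermiteFun),
      opA oneMode f ∈ Submodule.span ℂ (Set.range hermiteFun) := by
    intro f hf
    induction hf using Submodule.span_induction with
    | mem f hf =>
      obtain ⟨n, rfl⟩ := hf
      cases n with
      | zero => rw [opA_hermiteFun_zero]; exact Submodule.zero_mem _
      | succ n =>
        rw [opA_hermiteFun_succ]
        exact Submodule.smul_mem _ _ (Submodule.subset_span ⟨n, rfl⟩)
    | zero => rw [map_zero]; exact Submodule.zero_mem _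
    | add f g _ _ hf hg => rw [map_add]; exact Submodule.add_mem _ hf hg
    | smul c f _ hf => rw [map_smul]; exact Submodule.smul_mem _ _ hf
  have hAd : ∀ f ∈ Submodule.span ℂ (Set.range hermiteFun),
      opAd oneMode f ∈ Submodule.span ℂ (Set.range hermiteFun) := by
    intro f hf
    induction hf using Submodule.span_induction with
    | mem f hf =>
      obtain ⟨n, rfl⟩ := hf
      rw [opAd_hermiteFun]
      exact Submodule.smul_mem _ _ (Submodule.subset_span ⟨n + 1, rfl⟩)
    | zero => rw [map_zero]; exact Submodule.zero_mem _
    | add f g _ _ hf hg => rw [map_add]; exact Submodule.add_mem _ hf hg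
    | smul c f _ hf => rw [map_smul]; exact Submodule.smul_mem _ _ hf
  induction k with
  | zero => exact Submodule.subset_span ⟨0, rfl⟩
  | succ k ih =>
    rw [pow_succ']
    change opQ oneMode (((opQ oneMode) ^ k) (hermiteFun 0)) ∈ _
    generalize ((opQ oneMode) ^ k) (hermiteFun 0) = f at ih ⊢
    rw [opQ_eq_smul]
    exact Submodule.smul_mem _ _ (Submodule.add_mem _ (hA _ ih) (hAd _ ih))

theorem opQ_pow_apply (k : ℕ) (f : 𝓢(ℝ, ℂ)) (x : ℝ) :
    ((opQ oneMode) ^ k) f x = (x : ℂ) ^ k * f x := by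
  induction k with
  | zero => simp
  | succ k ih =>
    rw [pow_succ']
    change opQ oneMode (((opQ oneMode) ^ k) f) x = _
    rw [opQ_apply, ih, pow_succ']
    change (x : ℂ) * _ = _
    ring

/-- If `g` is orthogonal to all photon number states, then all moments of `ψ₀ g` vanish. -/
theorem integral_pow_mul_of_orthogonal (g : Wave ℝ)
    (hg : ∀ n, inner ℂ (hermiteVec n) g = 0) (k : ℕ) :
    ∫ x : ℝ, (x : ℂ) ^ k * (hermiteFun 0 x * g x) = 0 := by
  have h0 : ∀ f ∈ Submodule.span ℂ (Set.range hermiteFun),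
      inner ℂ (f.toLp 2 (volume : Measure ℝ)) g = 0 := by
    intro f hf
    induction hf using Submodule.span_induction with
    | mem f hf =>
      obtain ⟨n, rfl⟩ := hf
      exact hg n
    | zero =>
      have : (0 : 𝓢(ℝ, ℂ)).toLp 2 (volume : Measure ℝ) = 0 :=
        map_zero (SchwartzMap.toLpCLM ℂ (E := ℝ) ℂ 2 volume)
      rw [this, inner_zero_left]
    | add f g' _ _ hf hg' => rw [toLp_add, inner_add_left, hf, hg', add_zero]
    | smul c f _ hf => rw [toLp_smul, inner_smul_left, hf, mul_zero]
  have h1 := h0 _ (opQ_pow_mem_span k)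
  rw [L2.inner_def] at h1
  rw [← h1]
  refine integral_congr_ae ?_
  filter_upwards [(((opQ oneMode) ^ k) (hermiteFun 0)).coeFn_toLp 2 volume] with x hx
  rw [hx, opQ_pow_apply, RCLike.inner_apply, hermiteFun_zero_apply]
  simp only [map_mul, map_pow, map_inv₀, Complex.conj_ofReal]
  ring

theorem integrable_exp_mul_gaussian (g : Wave ℝ) (c : ℝ) :
    Integrable (fun x : ℝ => Real.exp (c * |x|) * ‖hermiteFun 0 x * g x‖) volume := by
  have hm : MemLp (fun x : ℝ => Real.exp (-(1 / 4) * x ^ 2)) 2 volume := by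
    have hc : Continuous (fun x : ℝ => Real.exp (-(1 / 4) * x ^ 2)) := by fun_prop
    rw [memLp_two_iff_integrable_sq hc.aestronglyMeasurable]
    refine (integrable_exp_neg_mul_sq (b := 1 / 2) (by norm_num)).congr
      (Eventually.of_forall fun x => ?_)
    change Real.exp _ = Real.exp _ ^ 2
    rw [← Real.exp_nat_mul]
    congr 1
    push_cast
    ring
  have hi := (hm.integrable_mul (Lp.memLp g).norm).const_mul
    (‖((Real.pi ^ (1 / 4 : ℝ) : ℝ) : ℂ)⁻¹‖ * Real.exp (c ^ 2))
  refine hi.mono' ?_ (Eventually.of_forall fun x => ?_)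
  · have h1 := (hermiteFun 0).continuous
    have h2 : Continuous (fun x : ℝ => Real.exp (c * |x|)) := by fun_prop
    exact h2.aestronglyMeasurable.mul (h1.aestronglyMeasurable.mul (Lp.memLp g).1).norm
  · rw [Real.norm_of_nonneg (by positivity), norm_mul, hermiteFun_zero_apply, norm_mul,
      Complex.norm_real, Real.norm_of_nonneg (Real.exp_pos _).le, Pi.mul_apply]
    have he : Real.exp (c * |x|) * Real.exp (-(x ^ 2 / 2)) ≤
        Real.exp (c ^ 2) * Real.exp (-(1 / 4) * x ^ 2) := by
      rw [← Real.exp_add, ← Real.exp_add, Real.exp_le_exp]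
      nlinarith [sq_nonneg (c - |x| / 2), sq_abs x]
    have hK := norm_nonneg (((Real.pi ^ (1 / 4 : ℝ) : ℝ) : ℂ)⁻¹)
    calc _ = ‖((Real.pi ^ (1 / 4 : ℝ) : ℝ) : ℂ)⁻¹‖ *
          (Real.exp (c * |x|) * Real.exp (-(x ^ 2 / 2))) * ‖g x‖ := by ring
      _ ≤ ‖((Real.pi ^ (1 / 4 : ℝ) : ℝ) : ℂ)⁻¹‖ *
          (Real.exp (c ^ 2) * Real.exp (-(1 / 4) * x ^ 2)) * ‖g x‖ := by gcongr
      _ = _ := by ring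

/-- If `g` is orthogonal to all photon number states, then the Fourier transform of `ψ₀ g` vanishes:
its power series has the vanishing moments of `ψ₀ g` as coefficients. -/
theorem fourier_eq_zero_of_orthogonal (g : Wave ℝ)
    (hg : ∀ n, inner ℂ (hermiteVec n) g = 0) (w : ℝ) :
    𝓕 (fun x : ℝ => hermiteFun 0 x * g x) w = 0 := by
  rw [Real.fourier_real_eq_integral_exp_smul]
  have hmeas : AEStronglyMeasurable (fun x : ℝ => hermiteFun 0 x * g x) volume :=
    (hermiteFun 0).continuous.aestronglyMeasurable.mul (Lp.memLp g).1
  set z : ℝ → ℂ := fun x => ((-2 * Real.pi * x * w : ℝ) : ℂ) * Complex.I with hz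
  have hzn : ∀ x, ‖z x‖ = 2 * Real.pi * |w| * |x| := by
    intro x
    simp only [hz]
    rw [norm_mul, Complex.norm_I, mul_one, Complex.norm_real, Real.norm_eq_abs, abs_mul, abs_mul,
      abs_mul, abs_neg, abs_two, abs_of_pos Real.pi_pos]
    ring
  have hsum : ∀ x : ℝ, HasSum (fun k : ℕ => z x ^ k / k.factorial * (hermiteFun 0 x * g x))
      (Complex.exp (z x) • (hermiteFun 0 x * g x)) := by
    intro x
    have := NormedSpace.expSeries_div_hasSum_exp (z x)
    rw [← Complex.exp_eq_exp_ℂ] at this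
    exact this.mul_right _
  have hbsum : ∀ x : ℝ, HasSum (fun k : ℕ => ‖z x‖ ^ k / k.factorial * ‖hermiteFun 0 x * g x‖)
      (Real.exp (2 * Real.pi * |w| * |x|) * ‖hermiteFun 0 x * g x‖) := by
    intro x
    have := NormedSpace.expSeries_div_hasSum_exp (‖z x‖)
    rw [← Real.exp_eq_exp_ℝ] at this
    rw [← hzn]
    exact this.mul_right _
  have key := hasSum_integral_of_dominated_convergence (μ := volume)
    (F := fun (k : ℕ) (x : ℝ) => z x ^ k / k.factorial * (hermiteFun 0 x * g x))
    (f := fun x => Complex.exp (z x) • (hermiteFun 0 x * g x))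
    (fun k x => ‖z x‖ ^ k / k.factorial * ‖hermiteFun 0 x * g x‖) ?_ ?_ ?_ ?_ ?_
  · have h0 : ∀ k : ℕ, ∫ x : ℝ, z x ^ k / k.factorial * (hermiteFun 0 x * g x) = 0 := by
      intro k
      have : ∀ x : ℝ, z x ^ k / k.factorial * (hermiteFun 0 x * g x) =
          (((-2 * Real.pi * w : ℝ) : ℂ) * Complex.I) ^ k / k.factorial *
            ((x : ℂ) ^ k * (hermiteFun 0 x * g x)) := by
        intro x
        have : z x = (((-2 * Real.pi * w : ℝ) : ℂ) * Complex.I) * x := by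
          simp only [hz]; push_cast; ring
        rw [this, mul_pow]
        ring
      simp only [this]
      rw [integral_const_mul, integral_pow_mul_of_orthogonal g hg, mul_zero]
    simp only [h0] at key
    exact key.unique hasSum_zero
  · intro k
    have : Continuous z := by fun_prop
    exact (((this.pow k).div_const _).aestronglyMeasurable).mul hmeas
  · intro k
    refine Eventually.of_forall fun x => le_of_eq ?_
    rw [norm_mul, norm_div, norm_pow, Complex.norm_natCast]
  · exact Eventually.of_forall fun x => (hbsum x).summable
  · refine (integrable_exp_mul_gaussian g (2 * Real.pi * |w|)).congr
      (Eventually.of_forall fun x => ?_)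
    exact (hbsum x).tsum_eq.symm
  · exact Eventually.of_forall hsum

/-- Completeness: `ψ₀ g` has a vanishing Fourier transform, and `ψ₀` has no zeros. -/
theorem eq_zero_of_orthogonal (g : Wave ℝ) (hg : ∀ n, inner ℂ (hermiteVec n) g = 0) : g = 0 := by
  obtain ⟨C, hC⟩ := exists_bound_poly_mul_gaussian
    (Polynomial.C (((Real.pi ^ (1 / 4 : ℝ) : ℝ) : ℂ)⁻¹))
  have hC' : ∀ x, ‖hermiteFun 0 x‖ ≤ C := by
    intro x
    have := hC x
    rwa [Polynomial.eval_C, ← Real.norm_of_nonneg (Real.exp_pos (-(x ^ 2 / 2))).le,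
      ← Complex.norm_real, ← norm_mul] at this
  set G := mulOp (hermiteFun 0) (hermiteFun 0).continuous.aestronglyMeasurable C hC' g with hG
  have hGx : (G : ℝ → ℂ) =ᵐ[volume] fun x => hermiteFun 0 x * g x := coeFn_mulOp _ _ _ _ g
  have hint : Integrable (G : ℝ → ℂ) volume := by
    have h1 : Integrable (fun x : ℝ => hermiteFun 0 x * g x) volume :=
      ((hermiteFun 0).memLp 2 volume).integrable_mul (Lp.memLp g)
    exact h1.congr hGx.symm
  have hF : (𝓕 (G : ℝ → ℂ)) = fun _ => 0 := by
    funext w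
    rw [← fourier_eq_zero_of_orthogonal g hg w, Real.fourier_real_eq_integral_exp_smul,
      Real.fourier_real_eq_integral_exp_smul]
    refine integral_congr_ae ?_
    filter_upwards [hGx] with x hx
    rw [hx]
  have hG0 : G = 0 := by
    apply (Lp.fourierTransformₗᵢ ℝ ℂ).injective
    rw [map_zero]
    apply Lp.ext
    filter_upwards [coeFn_fourier_of_integrable G hint, Lp.coeFn_zero ℂ 2 (volume : Measure ℝ)]
      with x h1 h2
    rw [h1, h2, hF]
    rfl
  apply Lp.ext
  rw [hG0] at hGx
  filter_upwards [hGx, Lp.coeFn_zero ℂ 2 (volume : Measure ℝ)] with x h1 h2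
  rw [h2] at h1 ⊢
  have hne : hermiteFun 0 x ≠ 0 := by
    rw [hermiteFun_zero_apply]
    refine mul_ne_zero (inv_ne_zero ?_) ?_
    · rw [Complex.ofReal_ne_zero]; positivity
    · rw [Complex.ofReal_ne_zero]; positivity
  exact (mul_eq_zero.1 h1.symm).resolve_left hne

theorem span_hermiteVec_orthogonal : (Submodule.span ℂ (Set.range hermiteVec))ᗮ = ⊥ := by
  rw [Submodule.eq_bot_iff]
  intro g hg
  refine eq_zero_of_orthogonal g fun n => ?_
  exact (Submodule.mem_orthogonal _ _).1 hg _ (Submodule.subset_span ⟨n, rfl⟩)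

/-- The Hilbert basis of photon number states. -/
def hermiteBasis : HilbertBasis ℕ ℂ (Wave ℝ) :=
  HilbertBasis.mkOfOrthogonalEqBot (v := hermiteVec) orthonormal_hermiteFun
    span_hermiteVec_orthogonal

theorem coe_hermiteBasis : (hermiteBasis : ℕ → Wave ℝ) = hermiteVec :=
  HilbertBasis.coe_mkOfOrthogonalEqBot _ _

/-! ### The rotation group -/

theorem hermiteBasis_ext {f g : Wave ℝ}
    (h : ∀ n, inner ℂ (hermiteVec n) f = inner ℂ (hermiteVec n) g) : f = g := by
  rw [← sub_eq_zero]
  refine eq_zero_of_orthogonal _ fun n => ?_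
  rw [inner_sub_right, h, sub_self]

theorem norm_phase (φ : ℝ) (n : ℕ) : ‖Complex.exp (Complex.I * (φ * n : ℝ))‖ = 1 := by
  rw [mul_comm, Complex.norm_exp_ofReal_mul_I]

theorem conj_phase_mul (φ : ℝ) (n : ℕ) :
    starRingEnd ℂ (Complex.exp (Complex.I * (φ * n : ℝ))) *
      Complex.exp (Complex.I * (φ * n : ℝ)) = 1 := by
  rw [RCLike.conj_mul, norm_phase]
  simp

/-- The photon number states with the phases `e^{iφn}`. -/
def phasedVec (φ : ℝ) (n : ℕ) : Wave ℝ := Complex.exp (Complex.I * (φ * n : ℝ)) • hermiteVec n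

theorem orthonormal_phasedVec (φ : ℝ) : Orthonormal ℂ (phasedVec φ) := by
  have ho : Orthonormal ℂ hermiteVec := orthonormal_hermiteFun
  refine ⟨fun n => ?_, fun i j hij => ?_⟩
  · rw [phasedVec, norm_smul, norm_phase, one_mul]
    exact ho.1 n
  · change inner ℂ (_ • hermiteVec i) (_ • hermiteVec j) = 0
    rw [inner_smul_left, inner_smul_right, ho.2 hij, mul_zero, mul_zero]

theorem span_phasedVec_orthogonal (φ : ℝ) :
    (Submodule.span ℂ (Set.range (phasedVec φ)))ᗮ = ⊥ := by
  rw [Submodule.eq_bot_iff]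
  intro g hg
  refine eq_zero_of_orthogonal g fun n => ?_
  have h := (Submodule.mem_orthogonal _ _).1 hg _ (Submodule.subset_span ⟨n, rfl⟩)
  rw [phasedVec, inner_smul_left] at h
  refine (mul_eq_zero.1 h).resolve_left ?_
  exact (map_ne_zero (starRingEnd ℂ)).2 (Complex.exp_ne_zero _)

/-- The unitary which multiplies the state `|n⟩` by `e^{iφn}`, as a change of Hilbert basis. -/
def phaseUnitary (φ : ℝ) : Wave ℝ ≃ₗᵢ[ℂ] Wave ℝ :=
  hermiteBasis.repr.trans (HilbertBasis.mkOfOrthogonalEqBot (orthonormal_phasedVec φ)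
    (span_phasedVec_orthogonal φ)).repr.symm

theorem phaseUnitary_hermiteVec (φ : ℝ) (n : ℕ) : phaseUnitary φ (hermiteVec n) =
    Complex.exp (Complex.I * (φ * n : ℝ)) • hermiteVec n := by
  classical
  have h1 : hermiteVec n = hermiteBasis n := by rw [coe_hermiteBasis]
  conv_lhs => rw [h1]
  rw [phaseUnitary, LinearIsometryEquiv.trans_apply, HilbertBasis.repr_self,
    HilbertBasis.repr_symm_single, HilbertBasis.coe_mkOfOrthogonalEqBot, phasedVec]

theorem inner_phaseUnitary (φ : ℝ) (n : ℕ) (f : Wave ℝ) :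
    inner ℂ (hermiteVec n) (phaseUnitary φ f) =
      Complex.exp (Complex.I * (φ * n : ℝ)) * inner ℂ (hermiteVec n) f := by
  rw [← (phaseUnitary φ).inner_map_map (hermiteVec n) f, phaseUnitary_hermiteVec, inner_smul_left,
    ← mul_assoc, mul_comm (Complex.exp _), conj_phase_mul, one_mul]

/-- Parseval's identity for the photon number basis. -/
theorem hasSum_norm_sq_inner (f : Wave ℝ) :
    HasSum (fun n => ‖inner ℂ (hermiteVec n) f‖ ^ 2) (‖f‖ ^ 2) := by
  have h := hermiteBasis.hasSum_inner_mul_inner f f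
  rw [coe_hermiteBasis, inner_self_eq_norm_sq_to_K] at h
  have h2 := (Complex.hasSum_iff _ _).1 h |>.1
  convert! h2 using 1
  · funext n
    rw [← inner_conj_symm f, RCLike.conj_mul]
    norm_cast
  · norm_cast

/-- `φ ↦ e^{iφn}` on the state `|n⟩` is the unitary group with generator `i a†a`. On a Schwartz
wavefunction the coefficients `n⟨n|f⟩` of `a†a f` are square-summable and dominate the difference
quotients. -/
theorem isUnitaryGroup_phase (φ : ℝ) :
    IsUnitaryGroup ((Complex.I * (φ : ℂ)) • (opAd oneMode * opA oneMode))
      (fun a => phaseUnitary (φ * a)) where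
  add a b ψ := by
    refine hermiteBasis_ext fun n => ?_
    rw [inner_phaseUnitary, inner_phaseUnitary, inner_phaseUnitary, ← mul_assoc, ← Complex.exp_add]
    congr 2
    push_cast
    ring
  deriv f := by
    set y : Wave ℝ := (((Complex.I * (φ : ℂ)) • (opAd oneMode * opA oneMode)) f).toLp 2 volume
      with hy
    set ψ : Wave ℝ := f.toLp 2 volume with hψ
    have hyn : ∀ n, inner ℂ (hermiteVec n) y =
        Complex.I * ((φ * n : ℝ) : ℂ) * inner ℂ (hermiteVec n) ψ := by
      intro n
      have e : y = (Complex.I * (φ : ℂ)) • (opAd oneMode (opA oneMode f)).toLp 2 volume := rfl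
      have h := inner_number_left (hermiteFun n) f
      rw [number_hermiteFun, toLp_smul, inner_smul_left] at h
      rw [e, inner_smul_right, hermiteVec, ← h, Complex.conj_natCast]
      push_cast
      ring
    rw [hasDerivAt_iff_tendsto_slope_zero, tendsto_iff_norm_sub_tendsto_zero]
    have h0 : phaseUnitary (φ * 0) ψ = ψ := by
      refine hermiteBasis_ext fun n => ?_
      rw [inner_phaseUnitary]
      simp
    have hcoef : ∀ (t : ℝ) (n : ℕ), inner ℂ (hermiteVec n)
        (t⁻¹ • (phaseUnitary (φ * (0 + t)) ψ - phaseUnitary (φ * 0) ψ) - y) =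
        ((t : ℂ)⁻¹ * (Complex.exp (Complex.I * (φ * t * n : ℝ)) - 1) -
          Complex.I * ((φ * n : ℝ) : ℂ)) * inner ℂ (hermiteVec n) ψ := by
      intro t n
      have e : ∀ v : Wave ℝ, t⁻¹ • v = ((t : ℂ)⁻¹) • v := fun v => by
        rw [← Complex.ofReal_inv]; exact RCLike.real_smul_eq_coe_smul (K := ℂ) _ _
      rw [e, h0, inner_sub_right, inner_smul_right, inner_sub_right, inner_phaseUnitary, hyn,
        zero_add]
      ring
    have hnorm : ∀ t : ℝ, ‖t⁻¹ • (phaseUnitary (φ * (0 + t)) ψ - phaseUnitary (φ * 0) ψ) - y‖ ^ 2 =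
        ∑' n : ℕ, ‖((t : ℂ)⁻¹ * (Complex.exp (Complex.I * (φ * t * n : ℝ)) - 1) -
          Complex.I * ((φ * n : ℝ) : ℂ)) * inner ℂ (hermiteVec n) ψ‖ ^ 2 := by
      intro t
      rw [← (hasSum_norm_sq_inner _).tsum_eq]
      simp only [hcoef]
    have hlim : Tendsto (fun t : ℝ => ∑' n : ℕ, ‖((t : ℂ)⁻¹ *
        (Complex.exp (Complex.I * (φ * t * n : ℝ)) - 1) -
          Complex.I * ((φ * n : ℝ) : ℂ)) * inner ℂ (hermiteVec n) ψ‖ ^ 2) (𝓝[≠] 0)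
        (𝓝 (∑' _ : ℕ, (0 : ℝ))) := by
      refine tendsto_tsum_of_dominated_convergence
        (bound := fun n => 4 * ‖inner ℂ (hermiteVec n) y‖ ^ 2)
        ((hasSum_norm_sq_inner y).summable.mul_left 4) (fun n => ?_) ?_
      · have hd : HasDerivAt (fun t : ℝ => Complex.exp (Complex.I * (φ * t * n : ℝ)))
            (Complex.I * ((φ * n : ℝ) : ℂ)) 0 := by
          have h1 : HasDerivAt (fun t : ℝ => Complex.I * ((φ * t * n : ℝ) : ℂ))
              (Complex.I * ((φ * n : ℝ) : ℂ)) 0 := by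
            have : HasDerivAt (fun t : ℝ => φ * t * n) (φ * n) 0 := by
              simpa using ((hasDerivAt_id (0 : ℝ)).const_mul φ).mul_const (n : ℝ)
            exact this.ofReal_comp.const_mul _
          simpa using h1.cexp
        rw [hasDerivAt_iff_tendsto_slope_zero] at hd
        have h2 := (((hd.sub_const (Complex.I * ((φ * n : ℝ) : ℂ))).mul_const
          (inner ℂ (hermiteVec n) ψ)).norm).pow 2
        rw [sub_self, zero_mul, norm_zero, zero_pow two_ne_zero] at h2
        refine h2.congr fun t => ?_
        rw [zero_add, Complex.real_smul]
        simp
      · filter_upwards [self_mem_nhdsWithin] with t ht n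
        have ht' : (0 : ℝ) < ‖t‖ := norm_pos_iff.2 ht
        rw [norm_pow, norm_norm, hyn, norm_mul, norm_mul]
        have h1 : ‖(t : ℂ)⁻¹ * (Complex.exp (Complex.I * (φ * t * n : ℝ)) - 1)‖ ≤
            ‖Complex.I * ((φ * n : ℝ) : ℂ)‖ := by
          rw [norm_mul, norm_inv, Complex.norm_real, inv_mul_le_iff₀ ht', norm_mul, Complex.norm_I,
            one_mul, Complex.norm_real]
          refine (Real.norm_exp_I_mul_ofReal_sub_one_le).trans (le_of_eq ?_)
          rw [← norm_mul]
          congr 1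
          ring
        have h2 := (norm_sub_le ((t : ℂ)⁻¹ * (Complex.exp (Complex.I * (φ * t * n : ℝ)) - 1))
          (Complex.I * ((φ * n : ℝ) : ℂ))).trans (add_le_add h1 le_rfl)
        have h3 := mul_le_mul_of_nonneg_right h2 (norm_nonneg (inner ℂ (hermiteVec n) ψ))
        calc _ ≤ ((‖Complex.I * ((φ * n : ℝ) : ℂ)‖ + ‖Complex.I * ((φ * n : ℝ) : ℂ)‖) *
              ‖inner ℂ (hermiteVec n) ψ‖) ^ 2 := pow_le_pow_left₀ (by positivity) h3 2
          _ = _ := by ring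
    rw [tsum_zero] at hlim
    have h3 := hlim.sqrt
    rw [Real.sqrt_zero] at h3
    refine h3.congr fun t => ?_
    rw [← hnorm, Real.sqrt_sq (norm_nonneg _)]

theorem span_hermiteVec_dense : Dense (Submodule.span ℂ (Set.range hermiteVec) : Set (Wave ℝ)) := by
  have h := hermiteBasis.dense_span
  rw [coe_hermiteBasis] at h
  exact Submodule.dense_iff_topologicalClosure_eq_top.2 h

theorem rotation_apply (φ : ℝ) (ψ : Wave ℝ) : rotation φ ψ = phaseUnitary φ ψ := by
  have h := unitaryExp_eq (isUnitaryGroup_phase φ) (Set.range hermiteFun) ?_ ?_ ψ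
  · rw [mul_one] at h
    exact h
  · rw [← Set.range_comp]
    exact span_hermiteVec_dense
  · rintro _ ⟨n, rfl⟩ a
    refine ⟨Complex.exp (Complex.I * (φ * a * n : ℝ)) • hermiteFun n, ?_⟩
    rw [toLp_smul]
    exact phaseUnitary_hermiteVec (φ * a) n

/-! ### The rotation by `π/2` is the Fourier transform -/

theorem neg_inv_two_pi_ne_zero : -(2 * Real.pi)⁻¹ ≠ 0 := by
  have := Real.pi_pos
  exact neg_ne_zero.2 (inv_ne_zero (by positivity))

/-- The unitary Fourier transform with kernel `(2π)^{-1/2} e^{ixz}`. -/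
def quarterTurn : Wave ℝ →L[ℂ] Wave ℝ :=
  ((compUnitary (scaleEquiv (-(2 * Real.pi)⁻¹) neg_inv_two_pi_ne_zero)).toContinuousLinearEquiv :
    Wave ℝ →L[ℂ] Wave ℝ) ∘L
    ((Lp.fourierTransformₗᵢ ℝ ℂ).toContinuousLinearEquiv : Wave ℝ →L[ℂ] Wave ℝ)

theorem sqrt_abs_det_scale :
    Real.sqrt |LinearMap.det (scaleEquiv (-(2 * Real.pi)⁻¹) neg_inv_two_pi_ne_zero : ℝ →ₗ[ℝ] ℝ)| =
      (Real.sqrt (2 * Real.pi))⁻¹ := by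
  rw [det_scaleEquiv, abs_neg, abs_of_pos (by positivity), Real.sqrt_inv]

theorem coeFn_quarterTurn (g : Wave ℝ) :
    (quarterTurn g : ℝ → ℂ) =ᵐ[volume] fun z => ((Real.sqrt (2 * Real.pi) : ℝ) : ℂ)⁻¹ *
      (Lp.fourierTransformₗᵢ ℝ ℂ g : ℝ → ℂ) (z * -(2 * Real.pi)⁻¹) := by
  have h := coeFn_compUnitary (scaleEquiv (-(2 * Real.pi)⁻¹) neg_inv_two_pi_ne_zero)
    (Lp.fourierTransformₗᵢ ℝ ℂ g)
  rw [sqrt_abs_det_scale, Complex.ofReal_inv] at h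
  exact h

/-- The Schwartz space version of `quarterTurn`. -/
def quarterTurnS (f : 𝓢(ℝ, ℂ)) : 𝓢(ℝ, ℂ) :=
  (((Real.sqrt (2 * Real.pi))⁻¹ : ℝ) : ℂ) • SchwartzMap.compCLMOfContinuousLinearEquiv ℂ
    (scaleEquiv (-(2 * Real.pi)⁻¹) neg_inv_two_pi_ne_zero) (𝓕 f)

theorem quarterTurn_toLp (f : 𝓢(ℝ, ℂ)) :
    quarterTurn (f.toLp 2 volume) = (quarterTurnS f).toLp 2 volume := by
  have h := compUnitary_toLp (scaleEquiv (-(2 * Real.pi)⁻¹) neg_inv_two_pi_ne_zero) (𝓕 f)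
  rw [sqrt_abs_det_scale] at h
  have h2 : Lp.fourierTransformₗᵢ ℝ ℂ (f.toLp 2 volume) = (𝓕 f).toLp 2 volume :=
    SchwartzMap.toLp_fourier_eq f
  rw [← h2] at h
  exact h

theorem quarterTurnS_apply (f : 𝓢(ℝ, ℂ)) (z : ℝ) : quarterTurnS f z =
    (((Real.sqrt (2 * Real.pi))⁻¹ : ℝ) : ℂ) * 𝓕 f (z * -(2 * Real.pi)⁻¹) := rfl

/-- The Fourier transform conjugates `a†` into `i a†`. -/
theorem quarterTurnS_opAd (f : 𝓢(ℝ, ℂ)) :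
    quarterTurnS (opAd oneMode f) = Complex.I • opAd oneMode (quarterTurnS f) := by
  have hπ : (Real.pi : ℂ) ≠ 0 := Complex.ofReal_ne_zero.2 Real.pi_ne_zero
  ext z
  have hsm : SchwartzMap.smulLeftCLM ℂ (inner ℝ · (1 : ℝ)) f = opQ oneMode f := by
    ext x
    have hg : (inner ℝ · (1 : ℝ)).HasTemperateGrowth := by fun_prop
    rw [SchwartzMap.smulLeftCLM_apply_apply hg, opQ_apply]
    simp [oneMode]
  have hQ : ∀ w, 𝓕 (opQ oneMode f) w = -(2 * Real.pi * Complex.I)⁻¹ * deriv (𝓕 f : 𝓢(ℝ, ℂ)) w := by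
    intro w
    have h := SchwartzMap.lineDerivOp_fourier_eq f (1 : ℝ)
    rw [hsm, FourierTransform.fourier_smul] at h
    have h' := DFunLike.congr_fun h w
    have h2 : deriv (𝓕 f : 𝓢(ℝ, ℂ)) w = -(2 * Real.pi * Complex.I) * 𝓕 (opQ oneMode f) w := h'
    rw [h2]
    have := Complex.I_ne_zero
    field_simp
  have hD : ∀ w, 𝓕 (opD oneMode f) w = 2 * Real.pi * Complex.I * (w * 𝓕 f w) := by
    intro w
    have h := DFunLike.congr_fun (SchwartzMap.fourier_lineDerivOp_eq f (1 : ℝ)) w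
    have hg : (inner ℝ · (1 : ℝ)).HasTemperateGrowth := by fun_prop
    rw [smul_apply, SchwartzMap.smulLeftCLM_apply_apply hg] at h
    refine h.trans ?_
    simp
  have hT : deriv (quarterTurnS f) z = (((Real.sqrt (2 * Real.pi))⁻¹ : ℝ) : ℂ) *
      (-(2 * Real.pi : ℂ)⁻¹ * deriv (𝓕 f : 𝓢(ℝ, ℂ)) (z * -(2 * Real.pi)⁻¹)) := by
    have h1 : HasDerivAt (fun z : ℝ => z * -(2 * Real.pi)⁻¹) (-(2 * Real.pi)⁻¹) z := by
      simpa using (hasDerivAt_id z).mul_const (-(2 * Real.pi)⁻¹)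
    have h2 := ((𝓕 f).hasDerivAt (z * -(2 * Real.pi)⁻¹)).scomp z h1
    have h3 := (h2.const_mul (((Real.sqrt (2 * Real.pi))⁻¹ : ℝ) : ℂ)).deriv
    refine (Eq.trans ?_ h3).trans ?_
    · rfl
    · rw [Complex.real_smul]
      push_cast
      rfl
  have hA : 𝓕 (opAd oneMode f) = (Real.sqrt 2 : ℂ)⁻¹ •
      (𝓕 (opQ oneMode f) - 𝓕 (opD oneMode f)) := by
    rw [opAd_eq]
    change FourierTransform.fourierCLM ℂ 𝓢(ℝ, ℂ) _ =
      _ • (FourierTransform.fourierCLM ℂ 𝓢(ℝ, ℂ) _ - FourierTransform.fourierCLM ℂ 𝓢(ℝ, ℂ) _)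
    rw [← map_sub, ← map_smul]
    rfl
  rw [quarterTurnS_apply, hA]
  change _ * ((Real.sqrt 2 : ℂ)⁻¹ * ((𝓕 (opQ oneMode f) : 𝓢(ℝ, ℂ)) _ -
    (𝓕 (opD oneMode f) : 𝓢(ℝ, ℂ)) _)) =
    Complex.I * opAd oneMode (quarterTurnS f) z
  rw [opAd_oneMode_apply, hT, hQ, hD, quarterTurnS_apply]
  push_cast
  field_simp
  ring_nf
  simp only [Complex.I_sq]
  ring

theorem quarterTurnS_hermiteFun_zero : quarterTurnS (hermiteFun 0) = hermiteFun 0 := by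
  ext z
  rw [quarterTurnS_apply]
  have hπ := Real.pi_pos
  have hb : 0 < ((2 * Real.pi : ℂ)⁻¹).re := by
    have : ((2 * Real.pi : ℂ)⁻¹) = (((2 * Real.pi)⁻¹ : ℝ) : ℂ) := by push_cast; rfl
    rw [this, Complex.ofReal_re]
    positivity
  have hg := fourier_gaussian_pi hb
  have h1 : (hermiteFun 0 : ℝ → ℂ) = ((((Real.pi ^ (1 / 4 : ℝ) : ℝ) : ℂ)⁻¹)) •
      (fun x : ℝ => Complex.exp (-Real.pi * (2 * Real.pi : ℂ)⁻¹ * x ^ 2)) := by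
    funext x
    rw [hermiteFun_zero_apply, Pi.smul_apply, smul_eq_mul, Complex.ofReal_exp]
    congr 2
    have : (Real.pi : ℂ) ≠ 0 := Complex.ofReal_ne_zero.2 hπ.ne'
    push_cast
    field_simp
  have h2 : 𝓕 (hermiteFun 0 : ℝ → ℂ) = (((Real.pi ^ (1 / 4 : ℝ) : ℝ) : ℂ)⁻¹) •
      𝓕 (fun x : ℝ => Complex.exp (-Real.pi * (2 * Real.pi : ℂ)⁻¹ * x ^ 2)) := by
    rw [h1]
    exact VectorFourier.fourierIntegral_const_smul _ _ _ _ _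
  rw [SchwartzMap.fourier_coe, h2, hg, Pi.smul_apply, smul_eq_mul, hermiteFun_zero_apply]
  have h3 : ((2 * Real.pi : ℂ)⁻¹) ^ (1 / 2 : ℂ) = (((Real.sqrt (2 * Real.pi))⁻¹ : ℝ) : ℂ) := by
    have e : ((2 * Real.pi : ℂ)⁻¹) = (((2 * Real.pi)⁻¹ : ℝ) : ℂ) := by push_cast; rfl
    have e2 : (1 / 2 : ℂ) = ((1 / 2 : ℝ) : ℂ) := by push_cast; rfl
    rw [e, e2, ← Complex.ofReal_cpow (by positivity), ← Real.sqrt_eq_rpow, Real.sqrt_inv]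
  rw [h3]
  have h4 : (((Real.sqrt (2 * Real.pi))⁻¹ : ℝ) : ℂ) ≠ 0 := by
    rw [Complex.ofReal_ne_zero]; positivity
  have h5 : Complex.exp (-Real.pi / (2 * Real.pi : ℂ)⁻¹ * ((z * -(2 * Real.pi)⁻¹ : ℝ) : ℂ) ^ 2) =
      (Real.exp (-(z ^ 2 / 2)) : ℂ) := by
    rw [Complex.ofReal_exp]
    congr 1
    have : (Real.pi : ℂ) ≠ 0 := Complex.ofReal_ne_zero.2 hπ.ne'
    push_cast
    field_simp
  rw [h5]
  field_simp

theorem quarterTurnS_hermiteFun (n : ℕ) :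
    quarterTurnS (hermiteFun n) = Complex.I ^ n • hermiteFun n := by
  induction n with
  | zero => rw [quarterTurnS_hermiteFun_zero, pow_zero, one_smul]
  | succ n ih =>
    have hlin : ∀ (c : ℂ) (f : 𝓢(ℝ, ℂ)), quarterTurnS (c • f) = c • quarterTurnS f := by
      intro c f
      rw [quarterTurnS, quarterTurnS, FourierTransform.fourier_smul, map_smul, smul_comm]
    change quarterTurnS ((Real.sqrt (n + 1) : ℂ)⁻¹ • opAd oneMode (hermiteFun n)) =
      _ • ((Real.sqrt (n + 1) : ℂ)⁻¹ • opAd oneMode (hermiteFun n))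
    rw [hlin, quarterTurnS_opAd, ih, map_smul, smul_smul Complex.I, ← pow_succ', smul_comm]

/-- Both sides multiply `|n⟩` by `iⁿ`. -/
theorem rotation_pi_div_two : rotation (Real.pi / 2) = quarterTurn := by
  refine ContinuousLinearMap.ext_on span_hermiteVec_dense ?_
  rintro _ ⟨n, rfl⟩
  rw [rotation_apply, phaseUnitary_hermiteVec, hermiteVec, quarterTurn_toLp,
    quarterTurnS_hermiteFun, toLp_smul]
  congr 1
  have : Complex.I * ((Real.pi / 2 * n : ℝ) : ℂ) = n * (Real.pi / 2 * Complex.I) := by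
    push_cast; ring
  rw [this, Complex.exp_nat_mul, Complex.exp_pi_div_two_mul_I]

/-- On `L¹ ∩ L²` the rotation by `π/2` is given by the integral `(2π)^{-1/2} ∫ e^{ixz} g(x) dx`. -/
theorem coeFn_rotation_pi_div_two (g : Wave ℝ) (hg : Integrable g (volume : Measure ℝ)) :
    (rotation (Real.pi / 2) g : ℝ → ℂ) =ᵐ[volume] fun z => ((Real.sqrt (2 * Real.pi) : ℝ) : ℂ)⁻¹ *
      ∫ x : ℝ, Complex.exp (Complex.I * x * z) * g x := by
  rw [rotation_pi_div_two]
  have hq := (quasiMeasurePreserving_equiv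
    (scaleEquiv (-(2 * Real.pi)⁻¹) neg_inv_two_pi_ne_zero)).ae (coeFn_fourier_of_integrable g hg)
  filter_upwards [coeFn_quarterTurn g, hq] with z h1 h2
  rw [scaleEquiv_apply] at h2
  rw [h1, h2, Real.fourier_real_eq_integral_exp_smul]
  congr 1
  refine integral_congr_ae (Eventually.of_forall fun x => ?_)
  simp only [smul_eq_mul]
  congr 2
  have : (Real.pi : ℂ) ≠ 0 := Complex.ofReal_ne_zero.2 Real.pi_ne_zero
  push_cast
  field_simp

/-! ### Coefficients of exponentials of quadratic polynomials -/

/-- The sequence with exponential generating function `exp (a w + b w²)`. -/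
def expSeq (a b : ℂ) : ℕ → ℂ
  | 0 => 1
  | 1 => a
  | n + 2 => a * expSeq a b (n + 1) + 2 * b * (n + 1) * expSeq a b n

theorem expSeq_succ (a b : ℂ) (n : ℕ) :
    expSeq a b (n + 1) = a * expSeq a b n + 2 * b * n * expSeq a b (n - 1) := by
  cases n with
  | zero => simp [expSeq]
  | succ n =>
    rw [expSeq]
    simp

theorem eq_expSeq {a b : ℂ} {u : ℕ → ℂ} (h0 : u 0 = 1)
    (h : ∀ n, u (n + 1) = a * u n + 2 * b * n * u (n - 1)) (n : ℕ) : u n = expSeq a b n := by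
  induction n using Nat.strong_induction_on with
  | _ n ih =>
    cases n with
    | zero => rw [h0, expSeq]
    | succ n =>
      rw [h, expSeq_succ, ih n (Nat.lt_succ_self n), ih (n - 1) (by omega)]

theorem pow_mul_expSeq (c a b : ℂ) (n : ℕ) :
    c ^ n * expSeq a b n = expSeq (c * a) (c ^ 2 * b) n := by
  refine eq_expSeq (u := fun n => c ^ n * expSeq a b n) (by simp [expSeq]) (fun n => ?_) n
  rw [expSeq_succ]
  cases n with
  | zero => simp; ring
  | succ n =>
    simp only [Nat.add_sub_cancel]
    ring

/-- The power series `exp (a w + b w²)`. -/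
def expSer (a b : ℂ) : PowerSeries ℂ := PowerSeries.mk fun n => expSeq a b n / n.factorial

/-- The differential equation `E' = (a + 2bw) E` of `E = exp (a w + b w²)`. -/
theorem derivative_expSer (a b : ℂ) : PowerSeries.derivative ℂ (expSer a b) =
    (PowerSeries.C a + PowerSeries.C (2 * b) * PowerSeries.X) * expSer a b := by
  ext n
  have hf : ∀ n : ℕ, (n.factorial : ℂ) ≠ 0 := fun n => Nat.cast_ne_zero.2 n.factorial_ne_zero
  have hn : ∀ n : ℕ, (n : ℂ) + 1 ≠ 0 := fun n => Nat.cast_add_one_ne_zero n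
  rw [PowerSeries.coeff_derivative, add_mul, map_add, mul_assoc,
    PowerSeries.coeff_C_mul,
    PowerSeries.coeff_C_mul]
  cases n with
  | zero =>
    rw [PowerSeries.coeff_zero_X_mul]
    simp [expSer, expSeq]
  | succ n =>
    rw [PowerSeries.coeff_succ_X_mul]
    simp only [expSer, PowerSeries.coeff_mk]
    have h1 := hf n
    have h2 := hn n
    have h3 : (n : ℂ) + 1 + 1 ≠ 0 := by exact_mod_cast hn (n + 1)
    rw [expSeq_succ, Nat.factorial_succ (n + 1), Nat.factorial_succ n]
    push_cast
    field_simp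

/-- The product satisfies the differential equation which determines the right-hand side. -/
theorem expSer_mul (a b a' b' : ℂ) : expSer a b * expSer a' b' = expSer (a + a') (b + b') := by
  set F := expSer a b * expSer a' b' with hF
  have hder : PowerSeries.derivative ℂ F =
      (PowerSeries.C (a + a') + PowerSeries.C (2 * (b + b')) * PowerSeries.X) * F := by
    rw [hF, Derivation.leibniz, derivative_expSer, derivative_expSer]
    simp only [smul_eq_mul, map_add, mul_add, add_mul]
    ring
  have hF0 : PowerSeries.coeff 0 F = 1 := by
    rw [hF, PowerSeries.coeff_mul]
    simp [expSer, expSeq]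
  have hf : ∀ n : ℕ, (n.factorial : ℂ) ≠ 0 := fun n => Nat.cast_ne_zero.2 n.factorial_ne_zero
  have hu : ∀ n, n.factorial * PowerSeries.coeff n F = expSeq (a + a') (b + b') n := by
    refine eq_expSeq (u := fun n => n.factorial * PowerSeries.coeff n F) (by simp [hF0])
      (fun n => ?_)
    have h := congrArg (PowerSeries.coeff n) hder
    rw [PowerSeries.coeff_derivative, add_mul, map_add, mul_assoc,
      PowerSeries.coeff_C_mul, PowerSeries.coeff_C_mul] at h
    cases n with
    | zero =>
      rw [PowerSeries.coeff_zero_X_mul] at h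
      simp at h ⊢
      exact h
    | succ n =>
      rw [PowerSeries.coeff_succ_X_mul] at h
      simp only [Nat.add_sub_cancel]
      rw [Nat.factorial_succ (n + 1), Nat.factorial_succ n]
      push_cast at h ⊢
      linear_combination ((n : ℂ) + 1) * n.factorial * h
  ext n
  rw [expSer, PowerSeries.coeff_mk, ← hu n, mul_div_cancel_left₀ _ (hf n)]

/-- The binomial convolution of two such sequences. -/
theorem sum_choose_expSeq (a b a' b' : ℂ) (n : ℕ) :
    ∑ k ∈ Finset.range (n + 1), (n.choose k : ℂ) * expSeq a b k * expSeq a' b' (n - k) =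
      expSeq (a + a') (b + b') n := by
  have hf : ∀ n : ℕ, (n.factorial : ℂ) ≠ 0 := fun n => Nat.cast_ne_zero.2 n.factorial_ne_zero
  have h := congrArg (PowerSeries.coeff n) (expSer_mul a b a' b')
  rw [PowerSeries.coeff_mul, Finset.Nat.sum_antidiagonal_eq_sum_range_succ_mk] at h
  simp only [expSer, PowerSeries.coeff_mk] at h
  rw [eq_div_iff (hf n), Finset.sum_mul] at h
  rw [← h]
  refine Finset.sum_congr rfl fun k hk => ?_
  have hk' : k ≤ n := Nat.lt_succ_iff.1 (Finset.mem_range.1 hk)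
  rw [Nat.cast_choose ℂ hk']
  have h1 := hf k
  have h2 := hf (n - k)
  field_simp

theorem expSeq_zero_even_odd (b : ℂ) (j : ℕ) :
    expSeq 0 b (2 * j) = (2 * j).factorial / j.factorial * b ^ j ∧ expSeq 0 b (2 * j + 1) = 0 := by
  induction j with
  | zero => simp [expSeq]
  | succ j ih =>
    have hj : (j.factorial : ℂ) ≠ 0 := Nat.cast_ne_zero.2 j.factorial_ne_zero
    have hj1 : (j : ℂ) + 1 ≠ 0 := Nat.cast_add_one_ne_zero j
    have e1 : expSeq 0 b (2 * (j + 1)) =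
        (2 * (j + 1)).factorial / (j + 1).factorial * b ^ (j + 1) := by
      have : 2 * (j + 1) = 2 * j + 1 + 1 := by ring
      rw [this, expSeq_succ, Nat.add_sub_cancel, ih.1, Nat.factorial_succ (2 * j + 1),
        Nat.factorial_succ (2 * j), Nat.factorial_succ j]
      push_cast
      field_simp
      ring
    refine ⟨e1, ?_⟩
    rw [expSeq_succ]
    have h2 : 2 * (j + 1) - 1 = 2 * j + 1 := by omega
    rw [h2, ih.2]
    ring

/-- Convolution with `expSeq 0 b`, which is supported on the even indices. -/
theorem sum_choose_even (a b c : ℂ) (N : ℕ) :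
    ∑ j ∈ Finset.range (N / 2 + 1), (N.choose (2 * j) : ℂ) *
      ((2 * j).factorial / j.factorial * b ^ j) * expSeq a c (N - 2 * j) =
      expSeq a (b + c) N := by
  have h := sum_choose_expSeq 0 b a c N
  rw [zero_add] at h
  rw [← h]
  have hinj : Set.InjOn (fun j : ℕ => 2 * j) (Finset.range (N / 2 + 1)) := by
    intro i _ j _ hij
    simp only at hij
    omega
  symm
  rw [← Finset.sum_subset (s₁ := (Finset.range (N / 2 + 1)).image fun j => 2 * j),
    Finset.sum_image hinj]
  · exact Finset.sum_congr rfl fun j _ => by rw [(expSeq_zero_even_odd b j).1]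
  · intro i hi
    obtain ⟨j, hj, rfl⟩ := Finset.mem_image.1 hi
    rw [Finset.mem_range] at hj ⊢
    omega
  · intro i hi hni
    rcases Nat.even_or_odd' i with ⟨j, rfl | rfl⟩
    · refine absurd (Finset.mem_image.2 ⟨j, ?_, rfl⟩) hni
      rw [Finset.mem_range] at hi ⊢
      omega
    · rw [(expSeq_zero_even_odd b j).2, mul_zero, zero_mul]

/-! ### Hermite polynomials -/

theorem derivative_hermiteH_succ (n : ℕ) : Polynomial.derivative (hermiteH (n + 1)) =
    2 * ((n : Polynomial ℂ) + 1) * hermiteH n := by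
  induction n with
  | zero =>
    simp [hermiteH]
  | succ n ih =>
    have e : hermiteH (n + 2) = 2 * Polynomial.X * hermiteH (n + 1) -
      Polynomial.derivative (hermiteH (n + 1)) := rfl
    have e1 : hermiteH (n + 1) = 2 * Polynomial.X * hermiteH n -
      Polynomial.derivative (hermiteH n) := rfl
    rw [e, ih]
    simp only [Polynomial.derivative_sub, Polynomial.derivative_mul, Polynomial.derivative_ofNat,
      Polynomial.derivative_X, ih, Polynomial.derivative_add, Polynomial.derivative_natCast,
      Polynomial.derivative_one]
    push_cast
    linear_combination (-2 * (n : Polynomial ℂ) - 2) * e1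

theorem derivative_hermiteH (n : ℕ) : Polynomial.derivative (hermiteH n) =
    2 * (n : Polynomial ℂ) * hermiteH (n - 1) := by
  cases n with
  | zero => simp [hermiteH]
  | succ n =>
    rw [derivative_hermiteH_succ]
    push_cast
    rfl

theorem hermiteH_succ_eval (n : ℕ) (x : ℂ) : (hermiteH (n + 1)).eval x =
    2 * x * (hermiteH n).eval x - 2 * n * (hermiteH (n - 1)).eval x := by
  rw [hermiteH, derivative_hermiteH]
  simp

theorem hermiteH_eval (n : ℕ) (x : ℂ) : (hermiteH n).eval x = expSeq (2 * x) (-1) n := by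
  refine eq_expSeq (u := fun n => (hermiteH n).eval x) (by simp [hermiteH]) (fun n => ?_) n
  rw [hermiteH_succ_eval]
  ring

/-- `Hₙ` has degree at most `n` and the leading coefficient `2ⁿ`. -/
theorem hermiteH_coeff (n : ℕ) :
    (hermiteH n).coeff n = 2 ^ n ∧ ∀ k, n < k → (hermiteH n).coeff k = 0 := by
  induction n with
  | zero =>
    refine ⟨by simp [hermiteH], fun k hk => ?_⟩
    rw [hermiteH, Polynomial.coeff_one, if_neg hk.ne']
  | succ n ih =>
    have e : ∀ k, (hermiteH (n + 1)).coeff (k + 1) =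
        2 * (hermiteH n).coeff k - (hermiteH n).coeff (k + 2) * (k + 2) := by
      intro k
      rw [hermiteH, Polynomial.coeff_sub, mul_assoc, Polynomial.coeff_ofNat_mul,
        Polynomial.coeff_X_mul, Polynomial.coeff_derivative]
      push_cast
      ring
    refine ⟨?_, fun k hk => ?_⟩
    · rw [e, ih.1, ih.2 (n + 2) (by omega)]
      ring
    · obtain ⟨k, rfl⟩ : ∃ j, k = j + 1 := ⟨k - 1, by omega⟩
      rw [e, ih.2 k (by omega), ih.2 (k + 2) (by omega)]
      ring

/-! ### The polynomial part of `fₙ` -/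

/-- Only the term `k = n`, `j = 0` of the double sum reaches the degree `n`. -/
theorem natDegree_fnPoly (θ : ℝ) (n : ℕ) (m : ℝ) (hr : Real.sin θ ≠ 0) :
    (fnPoly θ n m).natDegree = n := by
  have hA : (0 : ℝ) < 1 + Real.cos θ ^ 2 := by positivity
  have hcoeff : ∀ (s : ℂ) (c : ℂ) (k N : ℕ), k < N → (Polynomial.C c * (hermiteH k).comp
      (Polynomial.C s * Polynomial.X)).coeff N = 0 := by
    intro s c k N hk
    rw [Polynomial.coeff_C_mul, Polynomial.comp_C_mul_X_coeff, (hermiteH_coeff k).2 N hk]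
    simp
  refine Polynomial.natDegree_eq_of_le_of_coeff_ne_zero ?_ ?_
  · rw [Polynomial.natDegree_le_iff_coeff_eq_zero]
    intro N hN
    rw [fnPoly, Polynomial.coeff_C_mul, Polynomial.finsetSum_coeff]
    refine mul_eq_zero_of_right _ (Finset.sum_eq_zero fun k hk => ?_)
    rw [Polynomial.finsetSum_coeff]
    refine Finset.sum_eq_zero fun j _ => hcoeff _ _ _ _ ?_
    have := Finset.mem_range.1 hk
    omega
  · rw [fnPoly, Polynomial.coeff_C_mul, Polynomial.finsetSum_coeff, Finset.sum_range_succ]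
    refine mul_ne_zero ?_ ?_
    · refine div_ne_zero (mul_ne_zero (pow_ne_zero _ Complex.I_ne_zero) ?_) ?_
      · rw [Complex.ofReal_ne_zero]; positivity
      · rw [Complex.ofReal_ne_zero]; positivity
    · rw [Finset.sum_eq_zero, zero_add]
      · simp only [Nat.sub_self, Nat.zero_div, zero_add, Finset.sum_range_one]
        rw [Polynomial.coeff_C_mul, Polynomial.comp_C_mul_X_coeff, (hermiteH_coeff n).1]
        have h1 : (Real.sqrt ((1 + Real.cos θ ^ 2) / 2) : ℂ) ≠ 0 := by
          rw [Complex.ofReal_ne_zero]; positivity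
        have h2 : ((-(Real.sqrt 2 * Real.sin θ) / (1 + Real.cos θ ^ 2) : ℝ) : ℂ) ≠ 0 := by
          rw [Complex.ofReal_ne_zero]
          exact div_ne_zero (neg_ne_zero.2 (mul_ne_zero (by positivity) hr)) hA.ne'
        have h3 : (-Complex.I) ≠ 0 := neg_ne_zero.2 Complex.I_ne_zero
        refine mul_ne_zero (mul_ne_zero (mul_ne_zero (mul_ne_zero ?_ (pow_ne_zero _ h1))
          (pow_ne_zero _ h3)) ?_) (mul_ne_zero (pow_ne_zero _ two_ne_zero) (pow_ne_zero _ h2))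
        · simp
        · simp [hermiteH]
      · intro k hk
        rw [Polynomial.finsetSum_coeff]
        exact Finset.sum_eq_zero fun j _ => hcoeff _ _ _ _ (Finset.mem_range.1 hk)

/-! ### Gaussian integrals of Hermite polynomials -/

theorem integrable_gaussian_mul_poly {A : ℝ} (hA : 1 ≤ A) (B : ℂ) (p : Polynomial ℂ) :
    Integrable (fun y : ℝ => Complex.exp (-(A / 2 : ℂ) * y ^ 2 + B * y + 0) * p.eval (y : ℂ))
      volume := by
  obtain ⟨C, hC⟩ := exists_bound_poly_mul_gaussian
    (p.comp (Polynomial.C (Real.sqrt 2 : ℂ) * Polynomial.X))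
  -- Half of the Gaussian decay absorbs the polynomial.
  have hC' : ∀ y : ℝ, ‖p.eval (y : ℂ)‖ * Real.exp (-(y ^ 2 / 4)) ≤ C := by
    intro y
    have h2 : Real.sqrt 2 ≠ 0 := by positivity
    have := hC (y / Real.sqrt 2)
    rw [Polynomial.eval_comp, Polynomial.eval_mul, Polynomial.eval_C, Polynomial.eval_X,
      ← Complex.ofReal_mul, mul_div_cancel₀ _ h2, div_pow, Real.sq_sqrt (by norm_num)] at this
    convert this using 3
    ring
  have hb : (-(A / 4 : ℂ)).re < 0 := by
    have : (-(A / 4 : ℂ)) = ((-(A / 4) : ℝ) : ℂ) := by push_cast; rfl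
    rw [this, Complex.ofReal_re]
    linarith
  have hi := (integrable_cexp_quadratic' hb B 0).norm.const_mul C
  refine hi.mono' ?_ (Eventually.of_forall fun y => ?_)
  · refine Continuous.aestronglyMeasurable ?_
    have := p.continuous.comp Complex.continuous_ofReal
    fun_prop
  · have e : Complex.exp (-(A / 2 : ℂ) * y ^ 2 + B * y + 0) =
        (Real.exp (-(A * y ^ 2 / 4)) : ℂ) * Complex.exp (-(A / 4 : ℂ) * y ^ 2 + B * y + 0) := by
      rw [Complex.ofReal_exp, ← Complex.exp_add]
      congr 1
      push_cast
      ring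
    rw [e, norm_mul, norm_mul, Complex.norm_real, Real.norm_of_nonneg (Real.exp_pos _).le]
    have h1 : Real.exp (-(A * y ^ 2 / 4)) ≤ Real.exp (-(y ^ 2 / 4)) := by
      rw [Real.exp_le_exp]
      nlinarith [sq_nonneg y]
    calc _ = ‖p.eval (y : ℂ)‖ * Real.exp (-(A * y ^ 2 / 4)) *
          ‖Complex.exp (-(A / 4 : ℂ) * y ^ 2 + B * y + 0)‖ := by ring
      _ ≤ ‖p.eval (y : ℂ)‖ * Real.exp (-(y ^ 2 / 4)) *
          ‖Complex.exp (-(A / 4 : ℂ) * y ^ 2 + B * y + 0)‖ := by gcongr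
      _ ≤ _ := mul_le_mul_of_nonneg_right (hC' y) (norm_nonneg _)

/-- Integration by parts against the Gaussian `exp (-Ay²/2 + By)`. -/
theorem integral_gaussian_mul_deriv {A : ℝ} (hA : 1 ≤ A) (B : ℂ) (p : Polynomial ℂ) :
    ∫ y : ℝ, Complex.exp (-(A / 2 : ℂ) * y ^ 2 + B * y + 0) *
      ((Polynomial.C B - Polynomial.C (A : ℂ) * Polynomial.X) * p +
        Polynomial.derivative p).eval (y : ℂ) = 0 := by
  refine integral_eq_zero_of_hasDerivAt_of_integrable
    (f := fun y : ℝ => Complex.exp (-(A / 2 : ℂ) * y ^ 2 + B * y + 0) * p.eval (y : ℂ))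
    (fun y => ?_) (integrable_gaussian_mul_poly hA B _) (integrable_gaussian_mul_poly hA B p)
  have h1 : HasDerivAt (fun y : ℂ => Complex.exp (-(A / 2 : ℂ) * y ^ 2 + B * y + 0))
      (Complex.exp (-(A / 2 : ℂ) * y ^ 2 + B * y + 0) * (-(A / 2 : ℂ) * (2 * y) + B)) (y : ℂ) := by
    have h := ((((hasDerivAt_id (y : ℂ)).pow 2).const_mul (-(A / 2 : ℂ))).add
      ((hasDerivAt_id (y : ℂ)).const_mul B)).add_const 0
    refine h.cexp.congr_deriv ?_
    simp
  refine ((h1.mul (p.hasDerivAt (y : ℂ))).comp_ofReal).congr_deriv ?_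
  simp
  ring

/-- The integral of `Hₙ(ty - c)` against `exp (-Ay²/2 + By)`: integration by parts turns the
recursion of the Hermite polynomials into a recursion with shifted parameters. -/
theorem integral_gaussian_mul_hermiteH {A : ℝ} (hA : 1 ≤ A) (B t c : ℂ) (n : ℕ) :
    ∫ y : ℝ, Complex.exp (-(A / 2 : ℂ) * y ^ 2 + B * y + 0) * (hermiteH n).eval (t * y - c) =
      (∫ y : ℝ, Complex.exp (-(A / 2 : ℂ) * y ^ 2 + B * y + 0)) *
        expSeq (2 * t * B / A - 2 * c) (2 * t ^ 2 / A - 1) n := by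
  have hA0 : (A : ℂ) ≠ 0 := by
    rw [Complex.ofReal_ne_zero]; linarith
  set L : Polynomial ℂ := Polynomial.C t * Polynomial.X - Polynomial.C c with hL
  set J : Polynomial ℂ → ℂ := fun p =>
    ∫ y : ℝ, Complex.exp (-(A / 2 : ℂ) * y ^ 2 + B * y + 0) * p.eval (y : ℂ) with hJ
  have hJadd : ∀ p q, J (p + q) = J p + J q := by
    intro p q
    simp only [hJ, Polynomial.eval_add, mul_add]
    exact integral_add (integrable_gaussian_mul_poly hA B p) (integrable_gaussian_mul_poly hA B q)
  have hJsmul : ∀ (a : ℂ) p, J (Polynomial.C a * p) = a * J p := by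
    intro a p
    simp only [hJ, Polynomial.eval_mul, Polynomial.eval_C]
    rw [← integral_const_mul]
    congr 1
    funext y
    ring
  have hparts : ∀ p, B * J p + J (Polynomial.derivative p) = A * J (Polynomial.X * p) := by
    intro p
    have h : J ((Polynomial.C B - Polynomial.C (A : ℂ) * Polynomial.X) * p +
        Polynomial.derivative p) = 0 := integral_gaussian_mul_deriv hA B p
    have e : (Polynomial.C B - Polynomial.C (A : ℂ) * Polynomial.X) * p + Polynomial.derivative p =
        Polynomial.C B * p + (Polynomial.C (-(A : ℂ)) * (Polynomial.X * p) +
          Polynomial.derivative p) := by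
      rw [Polynomial.C_neg]; ring
    rw [e, hJadd, hJadd, hJsmul, hJsmul] at h
    linear_combination h
  set u : ℕ → ℂ := fun n => J ((hermiteH n).comp L) with hu
  have hC2 : Polynomial.C (2 : ℂ) = 2 := map_ofNat Polynomial.C 2
  have hder : ∀ n, Polynomial.derivative ((hermiteH n).comp L) =
      Polynomial.C (2 * n * t) * ((hermiteH (n - 1)).comp L) := by
    intro n
    rw [Polynomial.derivative_comp, derivative_hermiteH]
    have h1 : Polynomial.derivative L = Polynomial.C t := by simp [hL]
    rw [h1]
    simp [hC2]
    ring
  have hrec : ∀ n, u (n + 1) = (2 * t * B / A - 2 * c) * u n +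
      2 * (2 * t ^ 2 / A - 1) * n * u (n - 1) := by
    intro n
    have e : (hermiteH (n + 1)).comp L = Polynomial.C (2 * t) *
        (Polynomial.X * (hermiteH n).comp L) + (Polynomial.C (-2 * c) * (hermiteH n).comp L +
          Polynomial.C (-2 * n : ℂ) * (hermiteH (n - 1)).comp L) := by
      have e0 : hermiteH (n + 1) = 2 * Polynomial.X * hermiteH n -
        2 * (n : Polynomial ℂ) * hermiteH (n - 1) := by rw [hermiteH, derivative_hermiteH]
      rw [e0]
      simp [hL, hC2]
      ring
    have h1 := hparts ((hermiteH n).comp L)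
    rw [hder, hJsmul] at h1
    have h2 : u (n + 1) = 2 * t * J (Polynomial.X * (hermiteH n).comp L) +
        (-2 * c * u n + -2 * n * u (n - 1)) := by
      simp only [hu]
      rw [e, hJadd, hJadd, hJsmul, hJsmul, hJsmul]
    have h3 : J (Polynomial.X * (hermiteH n).comp L) =
        (B * u n + 2 * n * t * u (n - 1)) / A := by
      rw [eq_div_iff hA0, mul_comm, ← h1]
    rw [h2, h3]
    field_simp
    ring
  have hall : ∀ n, u n = u 0 * expSeq (2 * t * B / A - 2 * c) (2 * t ^ 2 / A - 1) n := by
    intro n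
    induction n using Nat.strong_induction_on with
    | _ n ih =>
      cases n with
      | zero => simp [expSeq]
      | succ n =>
        rw [hrec, expSeq_succ, ih n (Nat.lt_succ_self n), ih (n - 1) (by omega)]
        ring
  have h0 : u 0 = ∫ y : ℝ, Complex.exp (-(A / 2 : ℂ) * y ^ 2 + B * y + 0) := by
    simp [hu, hJ, hermiteH]
  have hn := hall n
  rw [h0] at hn
  rw [← hn]
  simp [hu, hJ, hL, Polynomial.eval_comp]

/-! ### The closed form of `fₙ` -/

/-- The double sum in `fₙ'` collapses: the inner sum convolves `expSeq 0 (r²/2)` with the rescaled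
Hermite values at `-mr/√(1 + t²)`, the outer sum convolves the result with the rescaled Hermite
values at `-√2 r x/(1 + t²)`. -/
theorem eval_fnPoly (θ : ℝ) (n : ℕ) (m x : ℝ) : (fnPoly θ n m).eval (x : ℂ) =
    (Real.exp (-(m ^ 2 * Real.sin θ ^ 2) / (2 * (1 + Real.cos θ ^ 2))) : ℂ) *
      (Real.sqrt (2 / (1 + Real.cos θ ^ 2)) / Real.sqrt (2 ^ n * n.factorial) : ℝ) *
      expSeq (-2 * Real.sin θ * x / (1 + Real.cos θ ^ 2) -
        2 * Complex.I * Real.cos θ * m * Real.sin θ / (1 + Real.cos θ ^ 2))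
        (2 * Real.cos θ ^ 2 / (1 + Real.cos θ ^ 2) - 1) n := by
  set t : ℝ := Real.cos θ with ht
  set r : ℝ := Real.sin θ with hr
  set A : ℝ := 1 + t ^ 2 with hA
  have hApos : 0 < A := by positivity
  set q : ℂ := (Real.sqrt A : ℂ) with hq
  have hq0 : q ≠ 0 := by rw [hq, Complex.ofReal_ne_zero]; positivity
  have hq2 : q ^ 2 = (A : ℂ) := by rw [hq, ← Complex.ofReal_pow, Real.sq_sqrt hApos.le]
  have hAc : (A : ℂ) = 1 + (t : ℂ) ^ 2 := by rw [hA]; push_cast; rfl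
  have hA0 : (A : ℂ) ≠ 0 := Complex.ofReal_ne_zero.2 hApos.ne'
  have hrt : (r : ℂ) ^ 2 + (t : ℂ) ^ 2 = 1 := by
    rw [← Complex.ofReal_pow, ← Complex.ofReal_pow, ← Complex.ofReal_add, hr, ht,
      Real.sin_sq_add_cos_sq, Complex.ofReal_one]
  set κ : ℂ := (Real.sqrt (A / 2) : ℂ) * -Complex.I with hκ
  set X : ℂ := ((-(Real.sqrt 2 * r) / A : ℝ) : ℂ) * x with hX
  set Y : ℂ := ((-(m * r) / Real.sqrt A : ℝ) : ℂ) with hY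
  have hs2 : (Real.sqrt 2 : ℂ) ≠ 0 := by rw [Complex.ofReal_ne_zero]; positivity
  have hs22 : (Real.sqrt 2 : ℂ) ^ 2 = 2 := by
    rw [← Complex.ofReal_pow, Real.sq_sqrt (by norm_num)]; push_cast; rfl
  have hκ' : κ = q / Real.sqrt 2 * -Complex.I := by
    rw [hκ, Real.sqrt_div hApos.le, Complex.ofReal_div]
  have hinner : ∀ k ∈ Finset.range (n + 1), ∑ j ∈ Finset.range ((n - k) / 2 + 1),
      ((n.choose k : ℂ) * ((n - k).choose (2 * j) : ℂ) *
          (((2 * j).factorial : ℂ) * (r : ℂ) ^ (2 * j) / (2 ^ j * (j.factorial : ℂ))) *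
          (t : ℂ) ^ (n - k - 2 * j) * (Real.sqrt (A / 2) : ℂ) ^ k * (-Complex.I) ^ k *
          (hermiteH (n - k - 2 * j)).eval Y) * (hermiteH k).eval X =
      (n.choose k : ℂ) * expSeq (κ * (2 * X)) (κ ^ 2 * -1) k *
        expSeq (t * (2 * Y)) ((r : ℂ) ^ 2 / 2 + (t : ℂ) ^ 2 * -1) (n - k) := by
    intro k _
    rw [← sum_choose_even, Finset.mul_sum]
    refine Finset.sum_congr rfl fun j _ => ?_
    rw [← pow_mul_expSeq, ← pow_mul_expSeq, hermiteH_eval, hermiteH_eval, hκ, mul_pow, div_pow,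
      ← pow_mul (r : ℂ)]
    have hj : (j.factorial : ℂ) ≠ 0 := Nat.cast_ne_zero.2 j.factorial_ne_zero
    field_simp
  have hsum : (∑ k ∈ Finset.range (n + 1), ∑ j ∈ Finset.range ((n - k) / 2 + 1),
      ((n.choose k : ℂ) * ((n - k).choose (2 * j) : ℂ) *
          (((2 * j).factorial : ℂ) * (r : ℂ) ^ (2 * j) / (2 ^ j * (j.factorial : ℂ))) *
          (t : ℂ) ^ (n - k - 2 * j) * (Real.sqrt (A / 2) : ℂ) ^ k * (-Complex.I) ^ k *
          (hermiteH (n - k - 2 * j)).eval Y) * (hermiteH k).eval X) =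
      expSeq (κ * (2 * X) + t * (2 * Y)) (κ ^ 2 * -1 + ((r : ℂ) ^ 2 / 2 + (t : ℂ) ^ 2 * -1)) n := by
    rw [Finset.sum_congr rfl hinner, sum_choose_expSeq]
  have heval : (fnPoly θ n m).eval (x : ℂ) = Complex.I ^ n *
      (Real.exp (-(m ^ 2 * r ^ 2) / (2 * A)) : ℂ) /
      (Real.sqrt ((2 : ℝ) ^ ((n : ℤ) - 1) * n.factorial * A ^ (n + 1)) : ℂ) *
      expSeq (κ * (2 * X) + t * (2 * Y))
        (κ ^ 2 * -1 + ((r : ℂ) ^ 2 / 2 + (t : ℂ) ^ 2 * -1)) n := by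
    rw [← hsum, fnPoly]
    simp only [Polynomial.eval_mul, Polynomial.eval_C, Polynomial.eval_finsetSum,
      Polynomial.eval_comp, Polynomial.eval_X]
    rfl
  have hden : Real.sqrt ((2 : ℝ) ^ ((n : ℤ) - 1) * n.factorial * A ^ (n + 1)) =
      Real.sqrt (2 ^ n * n.factorial) * Real.sqrt A ^ n * (Real.sqrt (2 / A))⁻¹ := by
    have e : (2 : ℝ) ^ ((n : ℤ) - 1) * n.factorial * A ^ (n + 1) =
        2 ^ n * n.factorial * A ^ n * (A / 2) := by
      rw [zpow_sub₀ two_ne_zero, zpow_natCast, zpow_one]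
      ring
    have hpow : Real.sqrt (A ^ n) = Real.sqrt A ^ n :=
      (Real.sqrt_eq_iff_mul_self_eq (by positivity) (by positivity)).2
        (by rw [← mul_pow, Real.mul_self_sqrt hApos.le])
    rw [e, Real.sqrt_mul (by positivity), Real.sqrt_mul (by positivity), hpow, ← Real.sqrt_inv,
      inv_div]
  have hscale : (Complex.I / q) ^ n * expSeq (κ * (2 * X) + t * (2 * Y))
        (κ ^ 2 * -1 + ((r : ℂ) ^ 2 / 2 + (t : ℂ) ^ 2 * -1)) n =
      expSeq (-2 * r * x / (1 + (t : ℂ) ^ 2) - 2 * Complex.I * t * m * r / (1 + (t : ℂ) ^ 2))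
        (2 * (t : ℂ) ^ 2 / (1 + (t : ℂ) ^ 2) - 1) n := by
    rw [pow_mul_expSeq]
    congr 1
    · rw [hκ', hX, hY, ← hAc]
      push_cast
      rw [← hq, ← hq2]
      field_simp
      ring_nf
      simp only [Complex.I_sq]
      ring
    · rw [div_pow, Complex.I_sq, hκ', mul_pow, div_pow, hs22, hq2, neg_sq, Complex.I_sq, ← hAc]
      field_simp
      rw [hAc]
      linear_combination (-1 : ℂ) * hrt
  rw [heval, hden, ← hscale]
  push_cast
  rw [← hq]
  have h1 : (Real.sqrt (2 / A) : ℂ) ≠ 0 := by rw [Complex.ofReal_ne_zero]; positivity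
  have h2 : (Real.sqrt (2 ^ n * n.factorial) : ℂ) ≠ 0 := by
    rw [Complex.ofReal_ne_zero]; positivity
  rw [div_pow]
  field_simp

theorem exists_bound_fock (n : ℕ) : ∃ C : ℝ, ∀ x, ‖fock n x‖ ≤ C := by
  rw [← coe_hermiteFun]
  exact ⟨_, SchwartzMap.norm_le_seminorm ℂ (hermiteFun n)⟩

theorem fock_zero_apply (x : ℝ) :
    fock 0 x = ((Real.pi ^ (1 / 4 : ℝ) : ℝ) : ℂ)⁻¹ * (Real.exp (-x ^ 2 / 2) : ℂ) := by
  simp [fock, hermiteH]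

/-- `fₙ(x) = e^{-imσx} e^{-r²x²/(2(1+t²))} fₙ'(x)`: the integral is Gaussian, and the recursions in
`n` of the two sides agree. -/
theorem fn_eq (θ : ℝ) (n : ℕ) (m x : ℝ) : fn θ n m x =
    Complex.exp (-Complex.I * m * sigma θ * x) *
      (Real.exp (-(x ^ 2 * Real.sin θ ^ 2) / (2 * (1 + Real.cos θ ^ 2))) : ℂ) *
      (fnPoly θ n m).eval (x : ℂ) := by
  rw [eval_fnPoly, fn, sigma]
  have hrt : Real.sin θ ^ 2 = 1 - Real.cos θ ^ 2 := Real.sin_sq θ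
  set t : ℝ := Real.cos θ with ht
  set r : ℝ := Real.sin θ with hr
  set A : ℝ := 1 + t ^ 2 with hA
  have hA1 : 1 ≤ A := by rw [hA]; nlinarith [sq_nonneg t]
  have hApos : 0 < A := by linarith
  have hA0 : (A : ℂ) ≠ 0 := Complex.ofReal_ne_zero.2 hApos.ne'
  have hAc : (1 : ℂ) + (t : ℂ) ^ 2 = A := by rw [hA]; push_cast; rfl
  -- The integrand is `Hₙ(ty - rx)` times a Gaussian with exponent `-Ay²/2 + By`.
  set B : ℂ := t * r * x - Complex.I * m * r with hB
  set N : ℝ := Real.sqrt (2 ^ n * n.factorial) with hN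
  have hpi : ((Real.pi ^ (1 / 4 : ℝ) : ℝ) : ℂ)⁻¹ * ((Real.pi ^ (1 / 4 : ℝ) : ℝ) : ℂ)⁻¹ =
      ((Real.sqrt Real.pi : ℝ) : ℂ)⁻¹ := by
    rw [← mul_inv, ← Complex.ofReal_mul, ← Real.rpow_add Real.pi_pos, Real.sqrt_eq_rpow]
    norm_num
  obtain ⟨X₁, hX₁⟩ : ∃ X : ℂ, X = 
      Complex.exp (-(r ^ 2 * x ^ 2 / 2 : ℂ) - Complex.I * m * t * x) := ⟨_, rfl⟩
  have hint : ∀ y : ℝ, fock n (t * y - r * x) * fock 0 y *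
      Complex.exp (-Complex.I * m * (t * x + r * y)) =
      ((Real.sqrt Real.pi : ℝ) : ℂ)⁻¹ * (N : ℂ)⁻¹ *
        X₁ *
        (Complex.exp (-(A / 2 : ℂ) * y ^ 2 + B * y + 0) *
          (hermiteH n).eval ((t : ℂ) * y - r * x)) := by
    intro y
    rw [fock_zero_apply, fock, ← hpi, hX₁]
    have e : ((Real.exp (-(t * y - r * x) ^ 2 / 2) : ℝ) : ℂ) * ((Real.exp (-y ^ 2 / 2) : ℝ) : ℂ) *
        Complex.exp (-Complex.I * m * (t * x + r * y)) =
        Complex.exp (-(r ^ 2 * x ^ 2 / 2 : ℂ) - Complex.I * m * t * x) *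
          Complex.exp (-(A / 2 : ℂ) * y ^ 2 + B * y + 0) := by
      rw [Complex.ofReal_exp, Complex.ofReal_exp, ← Complex.exp_add, ← Complex.exp_add,
        ← Complex.exp_add]
      congr 1
      rw [← hAc, hB]
      push_cast
      ring
    have e2 : (((t * y - r * x : ℝ)) : ℂ) = (t : ℂ) * y - r * x := by push_cast; rfl
    rw [e2, Complex.ofReal_mul, mul_inv]
    linear_combination (((Real.pi ^ (1 / 4 : ℝ) : ℝ) : ℂ)⁻¹ * (N : ℂ)⁻¹ *
      ((Real.pi ^ (1 / 4 : ℝ) : ℝ) : ℂ)⁻¹ * (hermiteH n).eval ((t : ℂ) * y - r * x)) * e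
  simp only [hint]
  rw [integral_const_mul, integral_gaussian_mul_hermiteH hA1]
  have hb : (-(A / 2 : ℂ)).re < 0 := by
    have : (-(A / 2 : ℂ)) = ((-(A / 2) : ℝ) : ℂ) := by push_cast; rfl
    rw [this, Complex.ofReal_re]
    linarith
  rw [integral_cexp_quadratic hb]
  have hZ : (Real.pi / - -(A / 2 : ℂ)) ^ (1 / 2 : ℂ) =
      ((Real.sqrt Real.pi * Real.sqrt (2 / A) : ℝ) : ℂ) := by
    have e : (Real.pi / - -(A / 2 : ℂ)) = ((Real.pi * (2 / A) : ℝ) : ℂ) := by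
      push_cast; field_simp
    have e2 : (1 / 2 : ℂ) = ((1 / 2 : ℝ) : ℂ) := by push_cast; rfl
    rw [e, e2, ← Complex.ofReal_cpow (by positivity), ← Real.sqrt_eq_rpow,
      Real.sqrt_mul Real.pi_pos.le]
  rw [hZ]
  have hexp : X₁ *
      Complex.exp (0 - B ^ 2 / (4 * -(A / 2 : ℂ))) =
      Complex.exp (-Complex.I * m * ((2 * t / A : ℝ) : ℂ) * x) *
      ((Real.exp (-(x ^ 2 * r ^ 2) / (2 * A)) : ℝ) : ℂ) *
      ((Real.exp (-(m ^ 2 * r ^ 2) / (2 * A)) : ℝ) : ℂ) := by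
    rw [hX₁, Complex.ofReal_exp, Complex.ofReal_exp, ← Complex.exp_add, ← Complex.exp_add,
      ← Complex.exp_add]
    congr 1
    have hrc : (r : ℂ) ^ 2 = 1 - (t : ℂ) ^ 2 := by rw [← Complex.ofReal_pow, hrt]; push_cast; rfl
    have hB2 : B ^ 2 = (r : ℂ) ^ 2 * (t ^ 2 * x ^ 2 - 2 * Complex.I * m * t * x - m ^ 2) := by
      rw [hB]
      linear_combination (m : ℂ) ^ 2 * r ^ 2 * Complex.I_sq
    push_cast
    rw [hB2]
    field_simp
    rw [← hAc, hrc]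
    ring
  have hseq : expSeq (2 * t * B / A - 2 * (r * x)) (2 * (t : ℂ) ^ 2 / A - 1) n =
      expSeq (-2 * r * x / (1 + (t : ℂ) ^ 2) - 2 * Complex.I * t * m * r / (1 + (t : ℂ) ^ 2))
        (2 * (t : ℂ) ^ 2 / (1 + (t : ℂ) ^ 2) - 1) n := by
    rw [hAc]
    congr 1
    rw [hB]
    field_simp
    rw [← hAc]
    ring
  rw [hseq]
  have hpi0 : ((Real.sqrt Real.pi : ℝ) : ℂ) ≠ 0 := by
    rw [Complex.ofReal_ne_zero]; have := Real.pi_pos; positivity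
  have hN0 : (N : ℂ) ≠ 0 := by rw [Complex.ofReal_ne_zero]; positivity
  generalize expSeq _ _ n = E
  have hcancel : ((Real.sqrt Real.pi : ℝ) : ℂ)⁻¹ * ((Real.sqrt Real.pi : ℝ) : ℂ) = 1 :=
    inv_mul_cancel₀ hpi0
  rw [Complex.ofReal_mul (Real.sqrt Real.pi), Complex.ofReal_div (Real.sqrt (2 / A)) N]
  generalize Complex.exp (0 - B ^ 2 / (4 * -(A / 2 : ℂ))) = X₂ at hexp ⊢
  generalize Complex.exp (-Complex.I * m * ((2 * t / A : ℝ) : ℂ) * x) = X₃ at hexp ⊢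
  generalize Real.exp (-(x ^ 2 * r ^ 2) / (2 * A)) = X₄ at hexp ⊢
  generalize Real.exp (-(m ^ 2 * r ^ 2) / (2 * A)) = X₅ at hexp ⊢
  generalize Real.sqrt (2 / A) = W
  linear_combination ((N : ℂ)⁻¹ * (W : ℂ) * E) * hexp + ((N : ℂ)⁻¹ * (W : ℂ) * E * (X₁ * X₂)) * hcancel

/-! ### The truncations of `fₙ` -/

theorem norm_phase_mul (m : ℝ) (s : ℝ) : ‖Complex.exp (-Complex.I * m * s)‖ = 1 := by
  have : -Complex.I * m * s = ((-(m * s) : ℝ) : ℂ) * Complex.I := by push_cast; ring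
  rw [this, Complex.norm_exp_ofReal_mul_I]

theorem integrable_fock_zero : Integrable (fock 0) volume := by
  rw [← coe_hermiteFun]
  exact (hermiteFun 0).integrable

theorem continuous_fock (n : ℕ) : Continuous (fock n) := by
  rw [← coe_hermiteFun]
  exact (hermiteFun n).continuous

theorem memLp_fock (n : ℕ) : MemLp (fock n) 2 (volume : Measure ℝ) := by
  rw [← coe_hermiteFun]
  exact (hermiteFun n).memLp 2 volume

/-- The restriction of the integral `fₙ(x)` to those `y` with `tx + ry ∈ S`; the circuit produces
`S = [-L, L]` before the limit. -/
def fnCut (θ : ℝ) (n : ℕ) (m : ℝ) (S : Set ℝ) (x : ℝ) : ℂ :=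
  ∫ y : ℝ, S.indicator 1 (Real.cos θ * x + Real.sin θ * y) *
    (fock n (Real.cos θ * y - Real.sin θ * x) * fock 0 y *
      Complex.exp (-Complex.I * m * (Real.cos θ * x + Real.sin θ * y)))

theorem fnCut_univ (θ : ℝ) (n : ℕ) (m x : ℝ) : fnCut θ n m Set.univ x = fn θ n m x := by
  simp [fnCut, fn]

theorem exists_bound_fnCut_integrand (θ : ℝ) (n : ℕ) (m : ℝ) : ∃ C : ℝ, ∀ (S : Set ℝ) (x y : ℝ),
    ‖S.indicator (1 : ℝ → ℂ) (Real.cos θ * x + Real.sin θ * y) *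
    (fock n (Real.cos θ * y - Real.sin θ * x) * fock 0 y *
      Complex.exp (-Complex.I * m * (Real.cos θ * x + Real.sin θ * y)))‖ ≤ C * ‖fock 0 y‖ := by
  obtain ⟨C, hC⟩ := exists_bound_fock n
  refine ⟨C, fun S x y => ?_⟩
  have h1 : ‖S.indicator (1 : ℝ → ℂ) (Real.cos θ * x + Real.sin θ * y)‖ ≤ 1 :=
    (norm_indicator_le_norm_self _ _).trans (by simp)
  have h2 := norm_phase_mul m (Real.cos θ * x + Real.sin θ * y)
  push_cast at h2
  rw [norm_mul, norm_mul, norm_mul]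
  push_cast
  rw [h2, mul_one]
  calc _ ≤ 1 * (C * ‖fock 0 y‖) :=
        mul_le_mul h1 (mul_le_mul_of_nonneg_right (hC _) (norm_nonneg _))
          (by positivity) zero_le_one
    _ = _ := one_mul _

theorem exists_bound_fnCut (θ : ℝ) (n : ℕ) (m : ℝ) :
    ∃ C : ℝ, ∀ (S : Set ℝ) (x : ℝ), ‖fnCut θ n m S x‖ ≤ C := by
  obtain ⟨C, hC⟩ := exists_bound_fnCut_integrand θ n m
  refine ⟨∫ y : ℝ, C * ‖fock 0 y‖, fun S x => ?_⟩
  exact norm_integral_le_of_norm_le (integrable_fock_zero.norm.const_mul C)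
    (Eventually.of_forall fun y => hC S x y)

theorem stronglyMeasurable_fnCut (θ : ℝ) (n : ℕ) (m : ℝ) {S : Set ℝ} (hS : MeasurableSet S) :
    StronglyMeasurable (fnCut θ n m S) := by
  refine StronglyMeasurable.integral_prod_right (f := fun x y => _) ?_
  have h1 : Measurable (S.indicator (1 : ℝ → ℂ)) := measurable_one.indicator hS
  have h2 : Measurable (fock n) := (continuous_fock n).measurable
  have h3 : Measurable (fock 0) := (continuous_fock 0).measurable
  refine Measurable.stronglyMeasurable ?_
  simp only [Function.uncurry_def]
  fun_prop

theorem tendsto_fnCut (θ : ℝ) (n : ℕ) (m x : ℝ) :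
    Tendsto (fun L : ℝ => fnCut θ n m (Set.Icc (-L) L) x) atTop (𝓝 (fn θ n m x)) := by
  obtain ⟨C, hC⟩ := exists_bound_fnCut_integrand θ n m
  refine tendsto_integral_filter_of_dominated_convergence (fun y => C * ‖fock 0 y‖) ?_ ?_
    (integrable_fock_zero.norm.const_mul C) ?_
  · refine Eventually.of_forall fun L => ?_
    have h1 : Measurable ((Set.Icc (-L) L).indicator (1 : ℝ → ℂ)) :=
      measurable_one.indicator measurableSet_Icc
    have h2 : Measurable (fock n) := (continuous_fock n).measurable
    have h3 : Measurable (fock 0) := (continuous_fock 0).measurable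
    refine Measurable.aestronglyMeasurable ?_
    fun_prop
  · exact Eventually.of_forall fun L => Eventually.of_forall fun y => hC _ x y
  · refine Eventually.of_forall fun y => ?_
    refine tendsto_const_nhds.congr' ?_
    filter_upwards [eventually_ge_atTop |Real.cos θ * x + Real.sin θ * y|] with L hL
    rw [Set.indicator_of_mem (Set.mem_Icc.2 (abs_le.1 hL))]
    simp

/-! ### Modulation and translation under the Fourier transform -/

/-- The translation `f ↦ f(· + c)` of `L²(ℝ)`. -/
def translate (c : ℝ) : Wave ℝ →L[ℂ] Wave ℝ :=
  (Lp.compMeasurePreservingₗᵢ ℂ (fun x : ℝ => x + c)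
    (measurePreserving_add_right volume c)).toContinuousLinearMap

theorem coeFn_translate (c : ℝ) (f : Wave ℝ) :
    (translate c f : ℝ → ℂ) =ᵐ[volume] fun x => f (x + c) :=
  Lp.coeFn_compMeasurePreserving f (measurePreserving_add_right volume c)

/-- The modulation `f ↦ e^{-icx} f`. -/
def modulate (c : ℝ) : Wave ℝ →L[ℂ] Wave ℝ :=
  mulOp (fun x => Complex.exp (-Complex.I * c * x))
    (Continuous.aestronglyMeasurable (by fun_prop)) 1 fun x => (norm_phase_mul c x).le

theorem coeFn_modulate (c : ℝ) (f : Wave ℝ) :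
    (modulate c f : ℝ → ℂ) =ᵐ[volume] fun x => Complex.exp (-Complex.I * c * x) * f x :=
  coeFn_mulOp _ _ _ _ f

theorem eq_of_eq_on_schwartz {A B : Wave ℝ →L[ℂ] Wave ℝ}
    (h : ∀ f : 𝓢(ℝ, ℂ), A (f.toLp 2 volume) = B (f.toLp 2 volume)) : A = B := by
  have hd : DenseRange (fun f : 𝓢(ℝ, ℂ) => (f.toLp 2 volume : Wave ℝ)) :=
    SchwartzMap.denseRange_toLpCLM ENNReal.ofNat_ne_top
  exact DFunLike.coe_injective (hd.equalizer A.continuous B.continuous (funext h))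

/-- The Fourier transform on `L²(ℝ)` as a bounded operator. -/
def fourierOp : Wave ℝ →L[ℂ] Wave ℝ :=
  ((Lp.fourierTransformₗᵢ ℝ ℂ).toContinuousLinearEquiv : Wave ℝ →L[ℂ] Wave ℝ)

theorem integrable_toLp (f : 𝓢(ℝ, ℂ)) : Integrable (f.toLp 2 volume : ℝ → ℂ) volume :=
  f.integrable.congr (f.coeFn_toLp 2 volume).symm

theorem fourier_congr_ae {f g : ℝ → ℂ} (h : f =ᵐ[volume] g) : 𝓕 f = 𝓕 g := by
  funext k
  rw [Real.fourier_real_eq_integral_exp_smul, Real.fourier_real_eq_integral_exp_smul]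
  refine integral_congr_ae ?_
  filter_upwards [h] with x hx
  rw [hx]

/-- `𝓕(e^{-icx} f)(k) = (𝓕 f)(k + c/2π)`. -/
theorem fourierOp_modulate (c : ℝ) (f : Wave ℝ) :
    fourierOp (modulate c f) = translate (c * (2 * Real.pi)⁻¹) (fourierOp f) := by
  suffices h : fourierOp ∘L modulate c = translate (c * (2 * Real.pi)⁻¹) ∘L fourierOp from
    DFunLike.congr_fun h f
  refine eq_of_eq_on_schwartz fun f => ?_
  have hf := integrable_toLp f
  have hm : Integrable (modulate c (f.toLp 2 volume)) volume := by
    refine Integrable.congr ?_ (coeFn_modulate c _).symm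
    refine hf.norm.mono' ((Continuous.aestronglyMeasurable (by fun_prop)).mul hf.1)
      (Eventually.of_forall fun x => ?_)
    rw [norm_mul, norm_phase_mul, one_mul]
  apply Lp.ext
  have h2 := (measurePreserving_add_right volume (c * (2 * Real.pi)⁻¹)).quasiMeasurePreserving.ae
    (coeFn_fourier_of_integrable _ hf)
  filter_upwards [coeFn_fourier_of_integrable _ hm, coeFn_translate (c * (2 * Real.pi)⁻¹)
    (fourierOp (f.toLp 2 volume)), h2] with k h1 h3 h2
  refine h1.trans (Eq.trans ?_ (h2.symm.trans h3.symm))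
  rw [fourier_congr_ae (coeFn_modulate c _), Real.fourier_real_eq_integral_exp_smul,
    Real.fourier_real_eq_integral_exp_smul]
  congr 1
  funext x
  rw [smul_eq_mul, smul_eq_mul, ← mul_assoc, ← Complex.exp_add]
  congr 2
  have : (Real.pi : ℂ) ≠ 0 := Complex.ofReal_ne_zero.2 Real.pi_ne_zero
  push_cast
  field_simp
  ring

/-- `𝓕(f(· - c))(k) = e^{-2πikc} (𝓕 f)(k)`. -/
theorem fourierOp_translate (c : ℝ) (f : Wave ℝ) :
    fourierOp (translate (-c) f) = modulate (2 * Real.pi * c) (fourierOp f) := by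
  suffices h : fourierOp ∘L translate (-c) = modulate (2 * Real.pi * c) ∘L fourierOp from
    DFunLike.congr_fun h f
  refine eq_of_eq_on_schwartz fun f => ?_
  have hf := integrable_toLp f
  have hm : Integrable (translate (-c) (f.toLp 2 volume)) volume :=
    (hf.comp_add_right (-c)).congr (coeFn_translate (-c) _).symm
  apply Lp.ext
  filter_upwards [coeFn_fourier_of_integrable _ hm, coeFn_fourier_of_integrable _ hf,
    coeFn_modulate (2 * Real.pi * c) (fourierOp (f.toLp 2 volume))] with k h1 h2 h3
  refine h1.trans (Eq.trans ?_ h3.symm)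
  have h2' : (fourierOp (f.toLp 2 volume) : ℝ → ℂ) k = 𝓕 (f.toLp 2 volume : ℝ → ℂ) k := h2
  rw [h2', fourier_congr_ae (coeFn_translate (-c) _), Real.fourier_real_eq_integral_exp_smul,
    Real.fourier_real_eq_integral_exp_smul, ← integral_const_mul,
    ← integral_add_right_eq_self _ c]
  simp only [smul_eq_mul]
  congr 1
  funext x
  rw [← mul_assoc, ← Complex.exp_add, add_neg_cancel_right]
  congr 2
  push_cast
  ring

/-! ### The Kraus operator -/

theorem norm_exp_neg_div_le_one {a b : ℝ} (ha : 0 ≤ a) (hb : 0 ≤ b) :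
    ‖(Real.exp (-a / b) : ℂ)‖ ≤ 1 := by
  rw [Complex.norm_real, Real.norm_of_nonneg (Real.exp_pos _).le]
  refine Real.exp_le_one_iff.2 ?_
  rw [neg_div, neg_nonpos]
  positivity

/-- The damping factor `e^{-x²/(2s²)}`. -/
def dampingFun (s : ℝ) (x : ℝ) : ℂ := (Real.exp (-x ^ 2 / (2 * s ^ 2)) : ℂ)

theorem norm_dampingFun_le (s x : ℝ) : ‖dampingFun s x‖ ≤ 1 := by
  exact norm_exp_neg_div_le_one (by positivity) (by positivity)

theorem aestronglyMeasurable_dampingFun (s : ℝ) : AEStronglyMeasurable (dampingFun s) volume := by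
  refine Continuous.aestronglyMeasurable ?_
  unfold dampingFun
  fun_prop

theorem exists_bound_fn (θ : ℝ) (n : ℕ) (m : ℝ) : ∃ C : ℝ, ∀ x, ‖fn θ n m x‖ ≤ C := by
  obtain ⟨C, hC⟩ := exists_bound_fnCut θ n m
  exact ⟨C, fun x => by rw [← fnCut_univ]; exact hC _ x⟩

theorem aestronglyMeasurable_fn (θ : ℝ) (n : ℕ) (m : ℝ) :
    AEStronglyMeasurable (fn θ n m) volume := by
  have h := (stronglyMeasurable_fnCut θ n m MeasurableSet.univ).aestronglyMeasurable (μ := volume)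
  rwa [show fnCut θ n m Set.univ = fn θ n m from funext (fnCut_univ θ n m)] at h

/-- Multiplication by `fₙ`. -/
def fnOp (θ : ℝ) (n : ℕ) (m : ℝ) : Wave ℝ →L[ℂ] Wave ℝ :=
  mulOp (fn θ n m) (aestronglyMeasurable_fn θ n m) _ (exists_bound_fn θ n m).choose_spec

/-- Multiplication by the damping factor `e^{-x²/(2s²)}`. -/
def dampingOp (s : ℝ) : Wave ℝ →L[ℂ] Wave ℝ :=
  mulOp (dampingFun s) (aestronglyMeasurable_dampingFun s) 1 (norm_dampingFun_le s)

/-- The Kraus operator `π^{1/4} √(2/s) e^{-Q²/2s²} R(π/2) fₙ(Q)` as a bounded operator. -/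
def krausOp (θ r' : ℝ) (n : ℕ) (m : ℝ) : Wave ℝ →L[ℂ] Wave ℝ :=
  prefactor (Real.exp r') •
    (dampingOp (Real.exp r') ∘L rotation (Real.pi / 2) ∘L fnOp θ n m)

theorem total_krausOp (θ r' : ℝ) (n : ℕ) (m : ℝ) :
    total (krausOp θ r' n m) = krausForm θ r' n m := by
  refine LinearPMap.eq_of_eq_graph (Submodule.ext fun p => ?_)
  rw [mem_graph_total, krausForm, mem_graph_smul]
  simp only [mem_graph_prodOp, mem_graph_total, mem_graph_funQ]
  constructor
  · intro h
    exact ⟨dampingOp (Real.exp r') (rotation (Real.pi / 2) (fnOp θ n m p.1)),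
      ⟨_, ⟨fnOp θ n m p.1, (coeFn_mulOp _ _ _ _ _).symm, rfl⟩, (coeFn_mulOp _ _ _ _ _).symm⟩, h⟩
  · rintro ⟨χ₃, ⟨χ₂, ⟨χ₁, h1, h2⟩, h3⟩, h4⟩
    have e1 : χ₁ = fnOp θ n m p.1 := Lp.ext (h1.symm.trans (coeFn_mulOp _ _ _ _ _).symm)
    subst e1
    subst h2
    rw [← h4]
    change prefactor _ • dampingOp _ _ = _
    congr 1
    exact Lp.ext ((coeFn_mulOp _ _ _ _ _).trans h3)

/-- The identity `e^{-Q²/2s²} R(π/2) e^{-icQ} = X(c) R(π/2) e^{-(P-c)²/2s²}`, with the right-hand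
side written out as a chain of Fourier transforms and multiplications: `R(π/2)` turns the modulation
`e^{-icQ}` into the translation `X(c)` and functions of `P` into functions of `Q`. -/
theorem damping_rotation_modulate (s c : ℝ) {χ χ₄ χ₅ χ₈ χ₉ : Wave ℝ}
    (h4 : (fun k : ℝ => (Real.exp (-(2 * Real.pi * k - c) ^ 2 / (2 * s ^ 2)) : ℂ) *
      fourierOp χ k) =ᵐ[volume] χ₄)
    (h5 : fourierOp χ₅ = χ₄)
    (h8 : (fun k : ℝ => Complex.exp (-Complex.I * ((2 * Real.pi * k : ℝ) : ℂ) * c) *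
      fourierOp (rotation (Real.pi / 2) χ₅) k) =ᵐ[volume] χ₈)
    (h9 : fourierOp χ₉ = χ₈) :
    (fun x => dampingFun s x * rotation (Real.pi / 2) (modulate c χ) x) =ᵐ[volume] χ₉ := by
  have hπ : Real.pi ≠ 0 := Real.pi_ne_zero
  -- `X(c)` is the translation by `c`.
  have e9 : χ₉ = translate (-c) (rotation (Real.pi / 2) χ₅) := by
    refine (Lp.fourierTransformₗᵢ ℝ ℂ).injective ?_
    refine h9.trans ((Lp.ext ?_ : fourierOp (translate (-c) _) = χ₈).symm)
    rw [fourierOp_translate]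
    refine (coeFn_modulate _ _).trans (EventuallyEq.trans (Eventually.of_forall fun k => ?_) h8)
    simp only
    congr 2
    push_cast
    ring
  rw [e9]
  set q : ℝ ≃L[ℝ] ℝ := scaleEquiv (-(2 * Real.pi)⁻¹) neg_inv_two_pi_ne_zero with hq
  have hsub := (measurePreserving_add_right (volume : Measure ℝ) (-c)).quasiMeasurePreserving
  have h4' := hsub.ae ((quasiMeasurePreserving_equiv q).ae h4)
  have h5' := hsub.ae (coeFn_quarterTurn χ₅)
  have hm := (quasiMeasurePreserving_equiv q).ae
    (coeFn_translate (c * (2 * Real.pi)⁻¹) (fourierOp χ))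
  rw [rotation_pi_div_two]
  filter_upwards [h4', h5', hm, coeFn_quarterTurn (modulate c χ),
    coeFn_translate (-c) (quarterTurn χ₅)] with x h4' h5' hm h6 h7
  rw [hq, scaleEquiv_apply] at h4' hm
  have hm' : (Lp.fourierTransformₗᵢ ℝ ℂ (modulate c χ) : ℝ → ℂ) (x * -(2 * Real.pi)⁻¹) =
      (fourierOp χ : ℝ → ℂ) ((x + -c) * -(2 * Real.pi)⁻¹) := by
    refine Eq.trans ?_ (hm.trans ?_)
    · rw [← fourierOp_modulate]; rfl
    · congr 1; ring
  have h5e : (Lp.fourierTransformₗᵢ ℝ ℂ χ₅ : ℝ → ℂ) = (χ₄ : ℝ → ℂ) := by rw [← h5]; rfl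
  rw [h7, h5', h6, hm', h5e, ← h4', dampingFun]
  have earg : -(2 * Real.pi * ((x + -c) * -(2 * Real.pi)⁻¹) - c) ^ 2 = -x ^ 2 := by
    field_simp
    ring
  rw [earg]
  ring

/-- By the closed form of `fₙ`, multiplication by `fₙ` is multiplication by `fₙ'` and the Gaussian,
followed by the modulation `e^{-imσx}`. -/
theorem krausDisplacedForm_le (θ r' : ℝ) (n : ℕ) (m : ℝ) :
    krausDisplacedForm θ r' n m ≤ total (krausOp θ r' n m) := by
  rw [total_krausOp]
  refine LinearPMap.le_of_le_graph fun p => ?_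
  rw [krausDisplacedForm, krausForm, mem_graph_smul, mem_graph_smul]
  simp only [mem_graph_prodOp, mem_graph_total, mem_graph_funQ, funP, shiftX]
  rintro ⟨χ₉, ⟨χ₆, ⟨χ₅, ⟨χ₂, ⟨χ₁, h1, h2⟩, χ₄, ⟨χ₃, h3, h4⟩, h5⟩, h6⟩, χ₈, ⟨χ₇, h7, h8⟩, h9⟩, hp⟩
  subst h3
  subst h6
  subst h7
  have h5' : fourierOp χ₅ = χ₄ := by
    rw [← h5]; exact (Lp.fourierTransformₗᵢ ℝ ℂ).apply_symm_apply χ₄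
  have h9' : fourierOp χ₉ = χ₈ := by
    rw [← h9]; exact (Lp.fourierTransformₗᵢ ℝ ℂ).apply_symm_apply χ₈
  have hmod : (fun x => fn θ n m x * p.1 x) =ᵐ[volume] modulate (m * sigma θ) χ₂ := by
    filter_upwards [coeFn_modulate (m * sigma θ) χ₂, h1, h2] with x e1 e2 e3
    rw [e1, ← e3, ← e2, fn_eq]
    push_cast
    ring_nf
  refine ⟨χ₉, ⟨_, ⟨_, hmod, rfl⟩, ?_⟩, hp⟩
  exact damping_rotation_modulate (Real.exp r') (m * sigma θ) h4 h5' h8 h9'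

theorem exists_bounded_mul {g : ℝ → ℂ} (hg : Continuous g) (hb : ∀ x, ‖g x‖ ≤ 1) (f : Wave ℝ) :
    ∃ χ : Wave ℝ, (fun x => g x * f x) =ᵐ[volume] χ :=
  ⟨_, (MemLp.coeFn_toLp (memLp_bounded_mul hg.aestronglyMeasurable hb f)).symm⟩

theorem exists_polynomial_mul_schwartz (p : Polynomial ℂ) (f : 𝓢(ℝ, ℂ)) :
    ∃ g : 𝓢(ℝ, ℂ), ∀ x : ℝ, g x = p.eval (x : ℂ) * f x := by
  induction p using Polynomial.induction_on' with
  | add p q hp hq =>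
    obtain ⟨a, ha⟩ := hp
    obtain ⟨b, hb⟩ := hq
    refine ⟨a + b, fun x => ?_⟩
    rw [add_apply, ha, hb, Polynomial.eval_add, add_mul]
  | monomial k a =>
    induction k with
    | zero => exact ⟨a • f, fun x => by simp⟩
    | succ k ih =>
      obtain ⟨g, hg⟩ := ih
      refine ⟨opQ oneMode g, fun x => ?_⟩
      rw [opQ_apply, hg, Polynomial.eval_monomial, Polynomial.eval_monomial]
      simp only [oneMode, ContinuousLinearMap.id_apply]
      ring

/-- The domain of the displaced form contains Schwartz space. -/
theorem dense_domain_krausDisplacedForm (θ r' : ℝ) (n : ℕ) (m : ℝ) :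
    Dense ((krausDisplacedForm θ r' n m).domain : Set (Wave ℝ)) := by
  have hd : DenseRange (fun f : 𝓢(ℝ, ℂ) => (f.toLp 2 volume : Wave ℝ)) :=
    SchwartzMap.denseRange_toLpCLM ENNReal.ofNat_ne_top
  refine Dense.mono ?_ hd
  rintro _ ⟨f, rfl⟩
  obtain ⟨g, hg⟩ := exists_polynomial_mul_schwartz (fnPoly θ n m) f
  have h1 : (fun x : ℝ => (fnPoly θ n m).eval (x : ℂ) * (f.toLp 2 volume : Wave ℝ) x) =ᵐ[volume]
      (g.toLp 2 volume : Wave ℝ) := by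
    filter_upwards [f.coeFn_toLp 2 volume, g.coeFn_toLp 2 volume] with x e1 e2
    rw [e1, e2, hg]
  obtain ⟨χ₂, h2⟩ := exists_bounded_mul (g := fun x : ℝ =>
    (Real.exp (-(x ^ 2 * Real.sin θ ^ 2) / (2 * (1 + Real.cos θ ^ 2))) : ℂ)) (by fun_prop)
    (fun x => norm_exp_neg_div_le_one (by positivity) (by positivity)) (g.toLp 2 volume)
  obtain ⟨χ₄, h4⟩ := exists_bounded_mul (g := fun k : ℝ =>
    (Real.exp (-(2 * Real.pi * k - m * sigma θ) ^ 2 / (2 * Real.exp r' ^ 2)) : ℂ)) (by fun_prop)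
    (fun x => norm_exp_neg_div_le_one (by positivity) (by positivity)) (fourierOp χ₂)
  obtain ⟨χ₈, h8⟩ := exists_bounded_mul (g := fun k : ℝ =>
    Complex.exp (-Complex.I * ((2 * Real.pi * k : ℝ) : ℂ) * ((m * sigma θ : ℝ) : ℂ)))
    (by fun_prop) (fun k => (norm_phase_mul _ _).le) (fourierOp (rotation (Real.pi / 2)
      ((Lp.fourierTransformₗᵢ ℝ ℂ).symm χ₄)))
  have hgraph : (f.toLp 2 volume, prefactor (Real.exp r') •
      (Lp.fourierTransformₗᵢ ℝ ℂ).symm χ₈) ∈ (krausDisplacedForm θ r' n m).graph := by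
    rw [krausDisplacedForm, mem_graph_smul]
    simp only [mem_graph_prodOp, mem_graph_total, mem_graph_funQ, funP, shiftX]
    exact ⟨_, ⟨_, ⟨_, ⟨χ₂, ⟨g.toLp 2 volume, h1, h2⟩, χ₄, ⟨_, rfl, h4⟩, rfl⟩, rfl⟩,
      χ₈, ⟨_, rfl, h8⟩, rfl⟩, rfl⟩
  exact LinearPMap.mem_domain_of_mem_graph hgraph

/-! ### Rotation of the position plane of two modes -/

/-- The rotation `(x, y) ↦ (tx + ry, ty - rx)` of the plane, with `t = cos θ` and `r = sin θ`. -/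
def planeRotation (θ : ℝ) : ℝ × ℝ ≃ᵐ ℝ × ℝ where
  toFun p := (Real.cos θ * p.1 + Real.sin θ * p.2, Real.cos θ * p.2 - Real.sin θ * p.1)
  invFun p := (Real.cos θ * p.1 - Real.sin θ * p.2, Real.cos θ * p.2 + Real.sin θ * p.1)
  left_inv p := by
    have := Real.sin_sq_add_cos_sq θ
    ext
    · simp only; linear_combination p.1 * this
    · simp only; linear_combination p.2 * this
  right_inv p := by
    have := Real.sin_sq_add_cos_sq θ
    ext
    · simp only; linear_combination p.1 * this
    · simp only; linear_combination p.2 * this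
  measurable_toFun := by
    change Measurable fun p : ℝ × ℝ =>
      (Real.cos θ * p.1 + Real.sin θ * p.2, Real.cos θ * p.2 - Real.sin θ * p.1)
    fun_prop
  measurable_invFun := by
    change Measurable fun p : ℝ × ℝ =>
      (Real.cos θ * p.1 - Real.sin θ * p.2, Real.cos θ * p.2 + Real.sin θ * p.1)
    fun_prop

theorem planeRotation_apply (θ x y : ℝ) : planeRotation θ (x, y) =
    (Real.cos θ * x + Real.sin θ * y, Real.cos θ * y - Real.sin θ * x) := rfl

/-- In the complex plane the rotation is multiplication by `e^{-iθ}`. -/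
theorem measurePreserving_planeRotation (θ : ℝ) :
    MeasurePreserving (planeRotation θ) (volume : Measure (ℝ × ℝ)) volume := by
  have h := (Complex.volume_preserving_equiv_real_prod.comp
    (_root_.rotation (Circle.exp (-θ))).measurePreserving).comp
    Complex.volume_preserving_equiv_real_prod.symm
  have he : (planeRotation θ : ℝ × ℝ → ℝ × ℝ) = (Complex.measurableEquivRealProd ∘
      _root_.rotation (Circle.exp (-θ))) ∘ Complex.measurableEquivRealProd.symm := ?_
  · rw [he]
    exact h
  funext p
  obtain ⟨x, y⟩ := p
  have e : Complex.measurableEquivRealProd.symm (x, y) = ⟨x, y⟩ := rfl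
  simp only [Function.comp_apply, e, _root_.rotation_apply, Circle.coe_exp]
  rw [planeRotation_apply, Complex.measurableEquivRealProd_apply, Complex.exp_mul_I,
    ← Complex.ofReal_cos, ← Complex.ofReal_sin, Real.cos_neg, Real.sin_neg]
  generalize Real.cos θ = t
  generalize Real.sin θ = r
  ext
  · simp
  · simp; ring

/-! ### The detection integral -/

theorem conj_fock (n : ℕ) (x : ℝ) : starRingEnd ℂ (fock n x) = fock n x := by
  have h : ∀ (n : ℕ) (x : ℝ), starRingEnd ℂ ((hermiteH n).eval (x : ℂ)) = (hermiteH n).eval (x : ℂ)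
      := by
    intro n x
    have hmap : ∀ n, (hermiteH n).map (starRingEnd ℂ) = hermiteH n := by
      intro n
      induction n with
      | zero => simp [hermiteH]
      | succ n ih => simp [hermiteH, ← Polynomial.derivative_map, ih]
    rw [← Polynomial.eval_map_apply, hmap, Complex.conj_ofReal]
  rw [fock, map_mul, map_mul, h, map_inv₀, Complex.conj_ofReal, Complex.conj_ofReal]

theorem memLp_prod_mul {a b : ℝ → ℂ} (ha : MemLp a 2 (volume : Measure ℝ))
    (hb : MemLp b 2 (volume : Measure ℝ)) :
    MemLp (fun p : ℝ × ℝ => a p.1 * b p.2) 2 (volume : Measure (ℝ × ℝ)) := by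
  have hm : AEStronglyMeasurable (fun p : ℝ × ℝ => a p.1 * b p.2)
      ((volume : Measure ℝ).prod (volume : Measure ℝ)) :=
    (ha.1.comp_fst).mul (hb.1.comp_snd)
  rw [Measure.volume_eq_prod, memLp_two_iff_integrable_sq_norm hm]
  refine (((memLp_two_iff_integrable_sq_norm ha.1).1 ha).mul_prod
    ((memLp_two_iff_integrable_sq_norm hb.1).1 hb)).congr (Eventually.of_forall fun p => ?_)
  simp [mul_pow]

/-- The integrand of the detection integral in the coordinates `x`, `y` before the beamsplitter. -/
def detectionFun (θ : ℝ) (n : ℕ) (m : ℝ) (S : Set ℝ) (ψ : ℝ → ℂ) (z : ℝ) (p : ℝ × ℝ) : ℂ :=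
  Complex.exp (Complex.I * p.1 * z) *
    (S.indicator 1 (Real.cos θ * p.1 + Real.sin θ * p.2) *
      (fock n (Real.cos θ * p.2 - Real.sin θ * p.1) * fock 0 p.2 *
        Complex.exp (-Complex.I * m * (Real.cos θ * p.1 + Real.sin θ * p.2))) * ψ p.1)

/-- Up to phases the integrand is a product of two square-integrable functions: one of the
coordinates after the beamsplitter and one of those before it. -/
theorem integrable_detectionFun (θ : ℝ) (n : ℕ) (m : ℝ) {S : Set ℝ} (hS : MeasurableSet S)
    (hS' : volume S ≠ ⊤) (ψ : Wave ℝ) (z : ℝ) :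
    Integrable (detectionFun θ n m S ψ z) (volume : Measure (ℝ × ℝ)) := by
  have hA := (memLp_prod_mul (memLp_indicator_const 2 hS (1 : ℂ) (Or.inr hS'))
    (memLp_fock n)).comp_measurePreserving (measurePreserving_planeRotation θ)
  have hB := memLp_prod_mul (Lp.memLp ψ) (memLp_fock 0)
  have hAB := hA.integrable_mul hB
  have hphase : Continuous fun p : ℝ × ℝ => Complex.exp (Complex.I * p.1 * z) *
      Complex.exp (-Complex.I * m * (Real.cos θ * p.1 + Real.sin θ * p.2)) := by fun_prop
  refine (hAB.norm.mono' (hphase.aestronglyMeasurable.mul hAB.1)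
    (Eventually.of_forall fun p => ?_)).congr (Eventually.of_forall fun p => ?_)
  · have h1 : ‖Complex.exp (Complex.I * p.1 * z)‖ = 1 := by
      have : Complex.I * p.1 * z = ((p.1 * z : ℝ) : ℂ) * Complex.I := by push_cast; ring
      rw [this, Complex.norm_exp_ofReal_mul_I]
    have h2 := norm_phase_mul m (Real.cos θ * p.1 + Real.sin θ * p.2)
    rw [Complex.ofReal_add, Complex.ofReal_mul, Complex.ofReal_mul] at h2
    rw [Pi.mul_apply, norm_mul, norm_mul, h1, h2, one_mul, one_mul]
  · simp only [Pi.mul_apply, Function.comp_apply, detectionFun]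
    change _ * _ * (S.indicator 1 (Real.cos θ * p.1 + Real.sin θ * p.2) *
      fock n (Real.cos θ * p.2 - Real.sin θ * p.1) * (ψ p.1 * fock 0 p.2)) = _
    ring

theorem integral_detectionFun (θ : ℝ) (n : ℕ) (m : ℝ) (S : Set ℝ) (ψ : ℝ → ℂ) (z x : ℝ) :
    ∫ y, detectionFun θ n m S ψ z (x, y) =
      Complex.exp (Complex.I * x * z) * (fnCut θ n m S x * ψ x) := by
  simp only [detectionFun, fnCut]
  rw [integral_const_mul, integral_mul_const]

theorem integrable_fnCut_mul (θ : ℝ) (n : ℕ) (m : ℝ) {S : Set ℝ} (hS : MeasurableSet S)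
    (hS' : volume S ≠ ⊤) (ψ : Wave ℝ) : Integrable (fun x => fnCut θ n m S x * ψ x) volume := by
  refine (integrable_detectionFun θ n m hS hS' ψ 0).integral_prod_left.congr
    (Eventually.of_forall fun x => ?_)
  simp [integral_detectionFun]

/-- The detection integral after the beamsplitter, evaluated in the coordinates before it. -/
theorem integral_detection (θ : ℝ) (n : ℕ) (m : ℝ) {S : Set ℝ} (hS : MeasurableSet S)
    (hS' : volume S ≠ ⊤) (ψ : Wave ℝ) (z : ℝ) :
    ∫ v in S, Complex.exp (-Complex.I * m * v) * ∫ u, starRingEnd ℂ (fock n u) *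
      (Complex.exp (Complex.I * (-u * Real.sin θ + v * Real.cos θ : ℝ) * z) *
        (fock 0 (u * Real.cos θ + v * Real.sin θ) * ψ (-u * Real.sin θ + v * Real.cos θ))) =
    ∫ x : ℝ, Complex.exp (Complex.I * x * z) * (fnCut θ n m S x * ψ x) := by
  have hmp := (measurePreserving_planeRotation θ).symm
  have hint := integrable_detectionFun θ n m hS hS' ψ z
  have hint' : Integrable (detectionFun θ n m S ψ z ∘ (planeRotation θ).symm)
      (volume : Measure (ℝ × ℝ)) :=
    (hmp.integrable_comp_emb (planeRotation θ).symm.measurableEmbedding).2 hint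
  have hright : ∫ p, detectionFun θ n m S ψ z p =
      ∫ x : ℝ, Complex.exp (Complex.I * x * z) * (fnCut θ n m S x * ψ x) := by
    rw [Measure.volume_eq_prod, integral_prod _ hint]
    simp only [integral_detectionFun]
  rw [← hright, ← hmp.integral_comp', ← integral_indicator hS]
  change _ = ∫ p, (detectionFun θ n m S ψ z ∘ (planeRotation θ).symm) p
  rw [Measure.volume_eq_prod, integral_prod _ hint']
  congr 1
  funext v
  have hvu : ∀ u, detectionFun θ n m S ψ z ((planeRotation θ).symm (v, u)) =
      S.indicator 1 v * (Complex.exp (-Complex.I * m * v) * (starRingEnd ℂ (fock n u) *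
      (Complex.exp (Complex.I * (-u * Real.sin θ + v * Real.cos θ : ℝ) * z) *
      (fock 0 (u * Real.cos θ + v * Real.sin θ) * ψ (-u * Real.sin θ + v * Real.cos θ))))) := by
    intro u
    have h1 := (planeRotation θ).apply_symm_apply (v, u)
    have hx : ((planeRotation θ).symm (v, u)).1 = -u * Real.sin θ + v * Real.cos θ := by
      change Real.cos θ * v - Real.sin θ * u = _
      ring
    have hy : ((planeRotation θ).symm (v, u)).2 = u * Real.cos θ + v * Real.sin θ := by
      change Real.cos θ * u + Real.sin θ * v = _
      ring
    generalize (planeRotation θ).symm (v, u) = q at h1 hx hy ⊢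
    obtain ⟨x, y⟩ := q
    rw [planeRotation_apply, Prod.mk.injEq] at h1
    simp only at hx hy
    rw [detectionFun, ← hx, ← hy, conj_fock, ← h1.1, ← h1.2]
    push_cast
    ring
  simp only [Function.comp_apply, hvu]
  rw [integral_const_mul, integral_const_mul]
  by_cases hv : v ∈ S <;> simp [hv]

/-! ### The output of the circuit -/

/-- The wavefunction of the squeezed vacuum `S(r')|0⟩`. -/
def squeezedVacuum (r' z : ℝ) : ℂ := (Real.exp (-r' / 2) : ℂ) * fock 0 (z * Real.exp (-r'))

theorem coeFn_squeezer_vacuum (r' : ℝ) :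
    (squeezer r' vacuum : ℝ → ℂ) =ᵐ[volume] squeezedVacuum r' := by
  have h := (quasiMeasurePreserving_equiv (scaleEquiv (Real.exp (-r')) (Real.exp_pos _).ne')).ae
    fock_zero_memLp.coeFn_toLp
  filter_upwards [coeFn_squeezer r' vacuum, h] with z h1 h2
  rw [scaleEquiv_apply] at h2
  rw [h1, vacuum, h2, squeezedVacuum]

/-- The state before detection: the factors in the two upper modes are evaluated at rotated
positions. -/
theorem coeFn_stateBeforeDetection (θ r' : ℝ) (ψ : Wave ℝ) :
    (stateBeforeDetection θ r' ψ : R3 → ℂ) =ᵐ[volume] fun p => squeezedVacuum r' p.2.2 *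
      (Complex.exp (Complex.I * (-p.1 * Real.sin θ + p.2.1 * Real.cos θ : ℝ) * p.2.2) *
        (fock 0 (p.1 * Real.cos θ + p.2.1 * Real.sin θ) *
          ψ (-p.1 * Real.sin θ + p.2.1 * Real.cos θ))) := by
  have hvac : ∀ᵐ p : R3 ∂volume, (vacuum : ℝ → ℂ) p.1 = fock 0 p.1 :=
    (Measure.quasiMeasurePreserving_fst (μ := (volume : Measure ℝ))
      (ν := (volume : Measure (ℝ × ℝ)))).ae fock_zero_memLp.coeFn_toLp
  have hsq : ∀ᵐ p : R3 ∂volume, (squeezer r' vacuum : ℝ → ℂ) p.2.2 = squeezedVacuum r' p.2.2 :=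
    ((Measure.quasiMeasurePreserving_snd (μ := (volume : Measure ℝ))
      (ν := (volume : Measure ℝ))).comp
      (Measure.quasiMeasurePreserving_snd (μ := (volume : Measure ℝ))
      (ν := (volume : Measure (ℝ × ℝ))))).ae (coeFn_squeezer_vacuum r')
  have hin : ∀ᵐ p : R3 ∂volume, (controlZ (tensor3 vacuum ψ (squeezer r' vacuum)) : R3 → ℂ) p =
      Complex.exp (Complex.I * p.2.1 * p.2.2) *
        (fock 0 p.1 * (ψ p.2.1 * squeezedVacuum r' p.2.2)) := by
    filter_upwards [hvac, hsq, (memLp_phase (tensor3 vacuum ψ (squeezer r' vacuum))).coeFn_toLp,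
      (memLp_tensor3 vacuum ψ (squeezer r' vacuum)).coeFn_toLp] with p h1 h2 h3 h4
    rw [controlZ, h3, tensor3, h4, h1, h2]
  filter_upwards [coeFn_beamsplitter θ (controlZ (tensor3 vacuum ψ (squeezer r' vacuum))),
    (quasiMeasurePreserving_equiv (rotEquiv θ)).ae hin] with p h1 h2
  rw [stateBeforeDetection, h1, h2, rotEquiv_apply]
  ring

/-- Almost everywhere in three variables implies almost everywhere in the first variable, for
almost every value of the other two. -/
theorem ae_ae_ae_of_ae {p : R3 → Prop} (h : ∀ᵐ q ∂(volume : Measure R3), p q) :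
    ∀ᵐ z : ℝ, ∀ᵐ v : ℝ, ∀ᵐ u : ℝ, p (u, v, z) := by
  have h1 : Measure.QuasiMeasurePreserving
      (fun q : (ℝ × ℝ) × ℝ => ((q.2, q.1.2, q.1.1) : R3))
      (((volume : Measure ℝ).prod volume).prod volume) volume := by
    have a := (Measure.measurePreserving_swap (μ := (volume : Measure ℝ))
      (ν := (volume : Measure ℝ)))
    have b := ((MeasurePreserving.id (volume : Measure ℝ)).prod a).comp
      (Measure.measurePreserving_swap (μ := ((volume : Measure ℝ).prod (volume : Measure ℝ)))
      (ν := (volume : Measure ℝ)))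
    exact b.quasiMeasurePreserving
  filter_upwards [Measure.ae_ae_of_ae_prod (Measure.ae_ae_of_ae_prod (h1.ae h))] with z hz
  exact hz

/-- Multiplication by the wavefunction of the squeezed vacuum. -/
def squeezedVacuumOp (r' : ℝ) : Wave ℝ →L[ℂ] Wave ℝ :=
  mulOp (squeezedVacuum r')
    (((continuous_fock 0).comp (continuous_mul_const (Real.exp (-r')))).const_mul
      (Real.exp (-r' / 2) : ℂ)).aestronglyMeasurable
    (Real.exp (-r' / 2) * (exists_bound_fock 0).choose) (fun z => by
      rw [squeezedVacuum, norm_mul, Complex.norm_real, Real.norm_of_nonneg (Real.exp_pos _).le]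
      exact mul_le_mul_of_nonneg_left ((exists_bound_fock 0).choose_spec _) (Real.exp_pos _).le)

/-- Multiplication by the truncation of `fₙ` to `|v| ≤ L`. -/
def fnCutOp (θ : ℝ) (n : ℕ) (m L : ℝ) : Wave ℝ →L[ℂ] Wave ℝ :=
  mulOp (fnCut θ n m (Set.Icc (-L) L))
    (stronglyMeasurable_fnCut θ n m measurableSet_Icc).aestronglyMeasurable _
    ((exists_bound_fnCut θ n m).choose_spec _)

/-- The cut-off projection is the squeezed vacuum times `R(π/2)` of the input multiplied by the
truncation of `fₙ`. -/
theorem cutoffProjection_ae (θ r' : ℝ) (n : ℕ) (m L : ℝ) (ψ : Wave ℝ) :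
    cutoffProjection n m L (stateBeforeDetection θ r' ψ) =ᵐ[volume]
      squeezedVacuumOp r' (rotation (Real.pi / 2) (fnCutOp θ n m L ψ)) := by
  have hcoe := coeFn_mulOp (fnCut θ n m (Set.Icc (-L) L))
    (stronglyMeasurable_fnCut θ n m measurableSet_Icc).aestronglyMeasurable _
    ((exists_bound_fnCut θ n m).choose_spec _) ψ
  have hfin : volume (Set.Icc (-L) L) ≠ ⊤ := measure_Icc_lt_top.ne
  have hint : Integrable (fnCutOp θ n m L ψ : ℝ → ℂ) volume :=
    (integrable_fnCut_mul θ n m measurableSet_Icc hfin ψ).congr hcoe.symm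
  filter_upwards [ae_ae_ae_of_ae (coeFn_stateBeforeDetection θ r' ψ),
    coeFn_mulOp (squeezedVacuum r') _ _ _ (rotation (Real.pi / 2) (fnCutOp θ n m L ψ)),
    coeFn_rotation_pi_div_two _ hint] with z h1 h2 h3
  refine Eq.trans ?_ h2.symm
  have hinner : ∀ᵐ v : ℝ, ∫ u, starRingEnd ℂ (fock n u) *
      (stateBeforeDetection θ r' ψ : R3 → ℂ) (u, v, z) =
      squeezedVacuum r' z * ∫ u, starRingEnd ℂ (fock n u) *
      (Complex.exp (Complex.I * (-u * Real.sin θ + v * Real.cos θ : ℝ) * z) *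
        (fock 0 (u * Real.cos θ + v * Real.sin θ) * ψ (-u * Real.sin θ + v * Real.cos θ))) := by
    filter_upwards [h1] with v hv
    rw [← integral_const_mul]
    refine integral_congr_ae ?_
    filter_upwards [hv] with u hu
    rw [hu]
    ring
  have houter : ∫ v in Set.Icc (-L) L, Complex.exp (-Complex.I * m * v) *
      ∫ u, starRingEnd ℂ (fock n u) * (stateBeforeDetection θ r' ψ : R3 → ℂ) (u, v, z) =
      squeezedVacuum r' z * ∫ v in Set.Icc (-L) L, Complex.exp (-Complex.I * m * v) *
      ∫ u, starRingEnd ℂ (fock n u) *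
      (Complex.exp (Complex.I * (-u * Real.sin θ + v * Real.cos θ : ℝ) * z) *
        (fock 0 (u * Real.cos θ + v * Real.sin θ) * ψ (-u * Real.sin θ + v * Real.cos θ))) := by
    rw [← integral_const_mul]
    refine integral_congr_ae (ae_restrict_of_ae ?_)
    filter_upwards [hinner] with v hv
    rw [hv]
    ring
  have hlast : ∫ x : ℝ, Complex.exp (Complex.I * x * z) *
      (fnCut θ n m (Set.Icc (-L) L) x * ψ x) =
      ∫ x : ℝ, Complex.exp (Complex.I * x * z) * fnCutOp θ n m L ψ x := by
    refine integral_congr_ae ?_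
    filter_upwards [hcoe] with x hx
    rw [fnCutOp, hx]
  rw [h3, cutoffProjection, houter, integral_detection θ n m measurableSet_Icc hfin ψ z, hlast]
  ring

theorem tendsto_fnCutOp (θ : ℝ) (n : ℕ) (m : ℝ) (ψ : Wave ℝ) :
    Tendsto (fun L => fnCutOp θ n m L ψ) atTop (𝓝 (fnOp θ n m ψ)) := by
  rw [Lp.tendsto_Lp_iff_tendsto_eLpNorm']
  obtain ⟨C, hC⟩ := exists_bound_fnCut θ n m
  have hdiff : ∀ L, (fnCutOp θ n m L ψ : ℝ → ℂ) - (fnOp θ n m ψ : ℝ → ℂ) =ᵐ[volume]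
      fun x => (fnCut θ n m (Set.Icc (-L) L) x - fn θ n m x) * ψ x := by
    intro L
    filter_upwards [coeFn_mulOp (fnCut θ n m (Set.Icc (-L) L))
      (stronglyMeasurable_fnCut θ n m measurableSet_Icc).aestronglyMeasurable _
      ((exists_bound_fnCut θ n m).choose_spec _) ψ, coeFn_mulOp (fn θ n m)
      (aestronglyMeasurable_fn θ n m) _ (exists_bound_fn θ n m).choose_spec ψ] with x h1 h2
    rw [Pi.sub_apply, fnCutOp, fnOp, h1, h2]
    ring
  refine (tendsto_eLpNorm_two_of_dominated
    (F := fun L x => (fnCut θ n m (Set.Icc (-L) L) x - fn θ n m x) * ψ x)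
    (B := fun x => (C + C) * ‖ψ x‖) (Eventually.of_forall fun L => ?_)
    ((Lp.memLp ψ).norm.const_mul _) (Eventually.of_forall fun L => ?_)
    (Eventually.of_forall fun x => ?_)).congr fun L => (eLpNorm_congr_ae (hdiff L)).symm
  · exact ((stronglyMeasurable_fnCut θ n m measurableSet_Icc).aestronglyMeasurable.sub
      (aestronglyMeasurable_fn θ n m)).mul (Lp.memLp ψ).1
  · refine Eventually.of_forall fun x => ?_
    rw [norm_mul]
    refine mul_le_mul_of_nonneg_right ((norm_sub_le _ _).trans ?_) (norm_nonneg _)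
    refine add_le_add (hC _ _) ?_
    rw [← fnCut_univ]
    exact hC _ _
  · simpa using ((tendsto_fnCut θ n m x).sub_const (fn θ n m x)).mul_const (ψ x)

/-- The constants of the circuit and of the Kraus operator agree. -/
theorem squeezedVacuum_eq (r' z : ℝ) : squeezedVacuum r' z =
    ((Real.sqrt (2 * Real.pi) : ℝ) : ℂ)⁻¹ * prefactor (Real.exp r') *
      dampingFun (Real.exp r') z := by
  have hq : Real.sqrt Real.pi = Real.pi ^ (1 / 4 : ℝ) * Real.pi ^ (1 / 4 : ℝ) := by
    rw [← Real.rpow_add Real.pi_pos, Real.sqrt_eq_rpow]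
    norm_num
  have hs : Real.sqrt (2 / Real.exp r') = Real.sqrt 2 * Real.exp (-r' / 2) := by
    rw [div_eq_mul_inv, ← Real.exp_neg, Real.sqrt_mul (by norm_num), Real.exp_half]
  have hexp : -(z * Real.exp (-r')) ^ 2 / 2 = -z ^ 2 / (2 * Real.exp r' ^ 2) := by
    rw [Real.exp_neg]
    have := Real.exp_ne_zero r'
    field_simp
  have h4 : Real.pi ^ (1 / 4 : ℝ) ≠ 0 := (Real.rpow_pos_of_pos Real.pi_pos _).ne'
  have h2 : Real.sqrt 2 ≠ 0 := by positivity
  rw [squeezedVacuum, fock_zero_apply, hexp, prefactor, dampingFun, hs,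
    Real.sqrt_mul (by norm_num), hq]
  generalize Real.exp (-z ^ 2 / (2 * Real.exp r' ^ 2)) = E
  generalize Real.exp (-r' / 2) = F
  generalize Real.pi ^ (1 / 4 : ℝ) = a at h4 ⊢
  generalize Real.sqrt 2 = b at h2 ⊢
  rw [← Complex.ofReal_ne_zero] at h4 h2
  push_cast
  field_simp

theorem inv_sqrt_two_pi_smul_krausOp (θ r' : ℝ) (n : ℕ) (m : ℝ) (ψ : Wave ℝ) :
    ((Real.sqrt (2 * Real.pi) : ℝ) : ℂ)⁻¹ • krausOp θ r' n m ψ =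
      squeezedVacuumOp r' (rotation (Real.pi / 2) (fnOp θ n m ψ)) := by
  have e : ((Real.sqrt (2 * Real.pi) : ℝ) : ℂ)⁻¹ • krausOp θ r' n m ψ =
      (((Real.sqrt (2 * Real.pi) : ℝ) : ℂ)⁻¹ * prefactor (Real.exp r')) •
        dampingOp (Real.exp r') (rotation (Real.pi / 2) (fnOp θ n m ψ)) := by
    rw [mul_smul]
    rfl
  rw [e]
  generalize rotation (Real.pi / 2) (fnOp θ n m ψ) = g
  apply Lp.ext
  filter_upwards [Lp.coeFn_smul (((Real.sqrt (2 * Real.pi) : ℝ) : ℂ)⁻¹ * prefactor (Real.exp r'))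
    (dampingOp (Real.exp r') g), coeFn_mulOp (dampingFun (Real.exp r')) _ _ _ g,
    coeFn_mulOp (squeezedVacuum r') _ _ _ g] with z h1 h2 h3
  refine h1.trans (Eq.trans ?_ h3.symm)
  rw [Pi.smul_apply, dampingOp, h2, squeezedVacuum_eq, smul_eq_mul]
  ring

theorem isCircuitOutput_krausOp (θ r' : ℝ) (n : ℕ) (m : ℝ) (ψ : Wave ℝ) :
    IsCircuitOutput θ r' n m ψ
      (((Real.sqrt (2 * Real.pi) : ℝ) : ℂ)⁻¹ • krausOp θ r' n m ψ) := by
  rw [inv_sqrt_two_pi_smul_krausOp, IsCircuitOutput]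
  have h := (((squeezedVacuumOp r').comp (rotation (Real.pi / 2))).continuous.tendsto
    (fnOp θ n m ψ)).comp (tendsto_fnCutOp θ n m ψ)
  refine ((Lp.tendsto_Lp_iff_tendsto_eLpNorm' _ _).1 h).congr fun L => ?_
  refine eLpNorm_congr_ae ?_
  filter_upwards [cutoffProjection_ae θ r' n m L ψ] with z hz
  rw [hz]
  rfl

end Phantm

end

theorem mainTheorem2 (θ r' m : ℝ) (n : ℕ) :
    ∃ K : Phantm.Wave ℝ →L[ℂ] Phantm.Wave ℝ,
      (∀ ψ : Phantm.Wave ℝ, Phantm.IsCircuitOutput θ r' n m ψ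
        (((Real.sqrt (2 * Real.pi) : ℝ) : ℂ)⁻¹ • K ψ)) ∧
      Phantm.total K = Phantm.krausForm θ r' n m ∧
      Phantm.krausDisplacedForm θ r' n m ≤ Phantm.total K ∧
      Dense ((Phantm.krausDisplacedForm θ r' n m).domain : Set (Phantm.Wave ℝ)) ∧
      (∀ x : ℝ, Phantm.fn θ n m x =
        Complex.exp (-Complex.I * m * Phantm.sigma θ * x) *
          (Real.exp (-(x ^ 2 * Real.sin θ ^ 2) / (2 * (1 + Real.cos θ ^ 2))) : ℂ) *
          (Phantm.fnPoly θ n m).eval (x : ℂ)) ∧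
      (Real.sin θ ≠ 0 → (Phantm.fnPoly θ n m).natDegree = n) := by
  refine ⟨Phantm.krausOp θ r' n m, fun ψ => Phantm.isCircuitOutput_krausOp θ r' n m ψ,
    Phantm.total_krausOp θ r' n m, Phantm.krausDisplacedForm_le θ r' n m,
    Phantm.dense_domain_krausDisplacedForm θ r' n m, fun x => Phantm.fn_eq θ n m x,
    fun hr => Phantm.natDegree_fnPoly θ n m hr⟩
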